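/- Let $x_1,x_2,\dots$ be free variables and $x_{i\to j}=\prod_{r=i}^{j-1}x_r$. Let $\mathbb H^{\mathrm{symb}}$ be the free commutative graded $\mathbb Q$-algebra on the regular symbols $[x_{i_1\to i_2},\dots,x_{i_d\to i_{d+1}}]_{n_1,\dots,n_d}$ ($d\ge1$, $1\le i_1<\dots<i_{d+1}$, $n_r\geq 1$), of weight $n_1+\dots+n_d$, and symbols $[x_i]_0$ ($i\ge 1$), of weight $1$. Let $\overline{\mathbb H}^{\mathrm{symb}}\supset\mathbb H^{\mathrm{symb}}$ be the free commutative graded $\mathbb Q$-algebra on these symbols together with the inverted symbols $[x_{i_d\to i_{d+1}}^{-1},\dots,x_{i_1\to i_2}^{-1}]_{n_d,\dots,n_1}$, of weight $n_1+\dots+n_d$. Put $[x_{i\to j}]_0=-[x_{i\to j}^{-1}]_0=\sum_{r=i}^{j-1}[x_r]_0$, $[1]_0=0$, and $$[y_1,\dots,y_d|t_1,\dots,t_d]=\sum_{n_r\ge1}[y_1,\dots,y_d]_{n_1,\dots,n_d}\,t_1^{n_1-1}\cdots t_d^{n_d-1},\qquad [\emptyset|\emptyset]=1,\qquad \exp([y]_0t)=\sum_{n\ge0}\frac{[y]_0^n}{n!}t^n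 .$$ Let $\Delta\colon\overline{\mathbb H}^{\mathrm{symb}}\to\overline{\mathbb H}^{\mathrm{symb}}\otimes\overline{\mathbb H}^{\mathrm{symb}}$ be the algebra homomorphism with $\Delta[x_i]_0=[x_i]_0\otimes1+1\otimes[x_i]_0$ and, for every regular or inverted tuple $(y_1,\dots,y_d)$, $$\begin{aligned}\Delta[y_1,\dots,y_d|t_1,\dots,t_d]=\sum\;&[y_{i_1\to i_2},\dots,y_{i_k\to i_{k+1}}|t_{j_1},\dots,t_{j_k}]\otimes\prod_{\alpha=0}^k(-1)^{j_\alpha-i_\alpha}\exp([y_{i_\alpha\to i_{\alpha+1}}]_0t_{j_\alpha})\\ &[y_{j_\alpha-1}^{-1},\dots,y_{i_\alpha}^{-1}|t_{j_\alpha}-t_{j_\alpha-1},\dots,t_{j_\alpha}-t_{i_\alpha}]\,[y_{j_\alpha+1},\dots,y_{i_{\alpha+1}-1}|t_{j_\alpha+1}-t_{j_\alpha},\dots,t_{i_{\alpha+1}-1}-t_{j_\alpha}],\end{aligned}$$ where the sum is over all $k\ge0$ and $0=i_0=j_0<i_1\le j_1<\dots<i_k\le j_k<i_{k+1}=d+1$,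 and $y_{i\to j}=\prod_{r=i}^{j-1}y_r$, $y_0=1$, $t_0=0$. Let $\mathrm{INV}\colon\overline{\mathbb H}^{\mathrm{symb}}\to\mathbb H^{\mathrm{symb}}$ be the algebra homomorphism that fixes the regular symbols and the $[x_i]_0$ and is defined on the inverted symbols by induction on $d$ through $$\begin{aligned}\mathrm{INV}&([y_d^{-1},\dots,y_1^{-1}|-t_d,\dots,-t_1])\\ =&\sum_{j=0}^{d-1}(-1)^{d-1+j}\,\mathrm{INV}([y_j^{-1},\dots,y_1^{-1}|-t_j,\dots,-t_1])\,[y_{j+1},\dots,y_d|t_{j+1},\dots,t_d]\\ &+\sum_{j=1}^d\frac{(-1)^{d-1+j}}{t_j}\,\mathrm{INV}([y_{j-1}^{-1},\dots,y_1^{-1}|-t_{j-1},\dots,-t_1])\,[y_{j+1},\dots,y_d|t_{j+1},\dots,t_d]\\ &+\sum_{j=1}^d\frac{(-1)^{d+j}}{t_j}\,\mathrm{INV}([y_{j-1}^{-1},\dots,y_1^{-1}|t_j-t_{j-1},\dots,t_j-t_1])\exp([y_{1\to d+1}]_0t_j)\,[y_{j+1},\dots,y_d|t_{j+1}-t_j,\dots,t_d-t_j]\end{aligned}$$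 for every regular tuple $(y_1,\dots,y_d)$ (the poles at $t_j=0$ cancel). Let $\Delta_{\mathbb H}$ be the restriction of $(\mathrm{INV}\otimes\mathrm{INV})\circ\Delta$ to $\mathbb H^{\mathrm{symb}}$, and take the projections to weight $0$ as counits. **Theorem.** $\Delta$ makes $\overline{\mathbb H}^{\mathrm{symb}}$ a graded Hopf algebra. The coproduct $\Delta_{\mathbb H}$ is coassociative and makes $\mathbb H^{\mathrm{symb}}$ a graded Hopf algebra. The map $\mathrm{INV}\colon\overline{\mathbb H}^{\mathrm{symb}}\to\mathbb H^{\mathrm{symb}}$ is a homomorphism of graded Hopf algebras; in particular $\Delta_{\mathbb H}\circ\mathrm{INV}=(\mathrm{INV}\otimes\mathrm{INV})\circ\Delta$. -/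

import Mathlib

open scoped TensorProduct

noncomputable section

namespace PolyHopf

/-! ## Graded Hopf algebras and their homomorphisms -/

/-- The commutative `ℚ`-algebra `A`, with the decomposition `𝒜` by weights, the coproduct `Δ`, the
counit `ε` and the antipode `S`, is a graded Hopf algebra. -/
structure IsGradedHopfAlgebra {A : Type*} [CommRing A] [Algebra ℚ A] (𝒜 : ℕ → Submodule ℚ A)
    (Δ : A →ₐ[ℚ] A ⊗[ℚ] A) (ε : A →ₐ[ℚ] ℚ) (S : A →ₗ[ℚ] A) : Prop where
  gradedMonoid : SetLike.GradedMonoid 𝒜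
  isInternal : DirectSum.IsInternal 𝒜
  coassoc : (Algebra.TensorProduct.assoc ℚ ℚ ℚ A A A).toAlgHom.comp
      ((Algebra.TensorProduct.map Δ (AlgHom.id ℚ A)).comp Δ) =
    (Algebra.TensorProduct.map (AlgHom.id ℚ A) Δ).comp Δ
  rTensor_counit : (Algebra.TensorProduct.map ε (AlgHom.id ℚ A)).comp Δ =
    (Algebra.TensorProduct.lid ℚ A).symm
  lTensor_counit : (Algebra.TensorProduct.map (AlgHom.id ℚ A) ε).comp Δ =
    (Algebra.TensorProduct.rid ℚ ℚ A).symm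
  antipode_rTensor : LinearMap.mul' ℚ A ∘ₗ S.rTensor A ∘ₗ Δ.toLinearMap =
    Algebra.linearMap ℚ A ∘ₗ ε.toLinearMap
  antipode_lTensor : LinearMap.mul' ℚ A ∘ₗ S.lTensor A ∘ₗ Δ.toLinearMap =
    Algebra.linearMap ℚ A ∘ₗ ε.toLinearMap
  comul_mem : ∀ n, ∀ a ∈ 𝒜 n, Δ a ∈ ⨆ ij ∈ Finset.HasAntidiagonal.antidiagonal n,
    LinearMap.range (TensorProduct.map (𝒜 ij.1).subtype (𝒜 ij.2).subtype)
  counit_eq_zero : ∀ n, n ≠ 0 → ∀ a ∈ 𝒜 n, ε a = 0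
  antipode_mem : ∀ n, ∀ a ∈ 𝒜 n, S a ∈ 𝒜 n

/-- The axioms above give a Hopf algebra in the sense of Mathlib, with the given operations. -/
abbrev IsGradedHopfAlgebra.hopfAlgebra {A : Type*} [CommRing A] [Algebra ℚ A]
    {𝒜 : ℕ → Submodule ℚ A} {Δ : A →ₐ[ℚ] A ⊗[ℚ] A} {ε : A →ₐ[ℚ] ℚ} {S : A →ₗ[ℚ] A}
    (h : IsGradedHopfAlgebra 𝒜 Δ ε S) : HopfAlgebra ℚ A where
  toBialgebra := Bialgebra.ofAlgHom Δ ε h.coassoc h.rTensor_counit h.lTensor_counit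
  antipode := S
  mul_antipode_rTensor_comul := h.antipode_rTensor
  mul_antipode_lTensor_comul := h.antipode_lTensor

/-- The algebra homomorphism `f : A → B` is a homomorphism of graded Hopf algebras: it is
compatible with the coproducts, the counits, the antipodes and the gradings. -/
structure IsGradedHopfHom {A B : Type*} [CommRing A] [Algebra ℚ A] [CommRing B] [Algebra ℚ B]
    (𝒜 : ℕ → Submodule ℚ A) (ΔA : A →ₐ[ℚ] A ⊗[ℚ] A) (εA : A →ₐ[ℚ] ℚ) (SA : A →ₗ[ℚ] A)
    (ℬ : ℕ → Submodule ℚ B) (ΔB : B →ₐ[ℚ] B ⊗[ℚ] B) (εB : B →ₐ[ℚ] ℚ) (SB : B →ₗ[ℚ] B)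
    (f : A →ₐ[ℚ] B) : Prop where
  comul_comp : ΔB.comp f = (Algebra.TensorProduct.map f f).comp ΔA
  counit_comp : εB.comp f = εA
  antipode_comp : SB ∘ₗ f.toLinearMap = f.toLinearMap ∘ₗ SA
  map_mem : ∀ n, ∀ a ∈ 𝒜 n, f a ∈ ℬ n

/-! ## The symbols

For positive integers `a`, `b` put `x_{a→b} = ∏_{a ≤ r < b} x_r` if `a ≤ b` and
`x_{a→b} = x_{b→a}⁻¹` if `b < a`. A tuple `y_r = x_{p_r → p_{r+1}}`, `1 ≤ r ≤ d`, is recorded by the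
sequence `p = (p_1, …, p_{d+1})` of its end points. Thus
* `(x_{i_1→i_2}, …, x_{i_d→i_{d+1}})` has the strictly increasing sequence `(i_1, …, i_{d+1})`;
* `(x_{i_d→i_{d+1}}⁻¹, …, x_{i_1→i_2}⁻¹)` has the strictly decreasing one `(i_{d+1}, …, i_1)`;
* `y_{i→j} = ∏_{i ≤ r < j} y_r` is `x_{p_i → p_j}`, and reversing and inverting a tuple reverses `p`.
-/

/-- The generators of the algebra of regular symbols: `log i` is `[x_i]_0`, and `poly d p hp n` is
`[x_{p_1→p_2}, …, x_{p_{d+1}→p_{d+2}}]_{n_1,…,n_{d+1}}`, a symbol of depth `d + 1 ≥ 1`. -/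
inductive RegGen : Type
  | log (i : ℕ+) : RegGen
  | poly (d : ℕ) (p : Fin (d + 2) → ℕ+) (hp : StrictMono p) (n : Fin (d + 1) → ℕ+) : RegGen

/-- The generators of the auxiliary algebra: `[x_i]_0`, the regular symbols (`p` increasing) and the
inverted symbols (`p` decreasing). -/
inductive BarGen : Type
  | log (i : ℕ+) : BarGen
  | poly (d : ℕ) (p : Fin (d + 2) → ℕ+) (hp : StrictMono p ∨ StrictAnti p)
      (n : Fin (d + 1) → ℕ+) : BarGen

/-- The weight of a generator; `[x_i]_0` has weight 1. -/
def RegGen.weight : RegGen → ℕ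
  | .log _ => 1
  | .poly _ _ _ n => ∑ r, (n r : ℕ)

/-- The weight of a generator; `[x_i]_0` has weight 1. -/
def BarGen.weight : BarGen → ℕ
  | .log _ => 1
  | .poly _ _ _ n => ∑ r, (n r : ℕ)

/-- The free commutative `ℚ`-algebra `H` on the regular symbols. -/
abbrev HSymb : Type := MvPolynomial RegGen ℚ

/-- The free commutative `ℚ`-algebra `H̄` on the regular and the inverted symbols. -/
abbrev HBar : Type := MvPolynomial BarGen ℚ

/-- The grading of `H` by weight. -/
def gradeH (n : ℕ) : Submodule ℚ HSymb :=
  MvPolynomial.weightedHomogeneousSubmodule ℚ RegGen.weight n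

/-- The grading of `H̄` by weight. -/
def gradeBar (n : ℕ) : Submodule ℚ HBar :=
  MvPolynomial.weightedHomogeneousSubmodule ℚ BarGen.weight n

/-- The counit of `H`: the projection onto weight 0. -/
def counitH : HSymb →ₐ[ℚ] ℚ := MvPolynomial.aeval fun _ => 0

/-- The counit of `H̄`: the projection onto weight 0. -/
def counitBar : HBar →ₐ[ℚ] ℚ := MvPolynomial.aeval fun _ => 0

/-- The inclusion `H → H̄` on generators. -/
def RegGen.toBar : RegGen → BarGen
  | .log i => .log i
  | .poly d p hp n => .poly d p (Or.inl hp) n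

/-- The inclusion `H → H̄`. -/
def inclusion : HSymb →ₐ[ℚ] HBar := MvPolynomial.rename RegGen.toBar

/-- `[x_{a→b}]_0`, where `l r` stands for `[x_r]_0`: it is `∑_{a ≤ r < b} [x_r]_0` if `a ≤ b`, and
minus `[x_{b→a}]_0` if `b < a`. -/
def logTo {A : Type*} [CommRing A] (l : ℕ+ → A) (a b : ℕ+) : A :=
  ∑ r ∈ Finset.Ico a b, l r - ∑ r ∈ Finset.Ico b a, l r

/-! ## Generating series -/

/-- The indeterminate `t_r` for `1 ≤ r ≤ d`, and `0` for the other `r` (in particular `t_0 = 0`). -/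
def tVar {A : Type*} [CommRing A] (d : ℕ) (r : ℕ) : MvPowerSeries (Fin d) A :=
  if h : 1 ≤ r ∧ r ≤ d then MvPowerSeries.X ⟨r - 1, by omega⟩ else 0

/-- The end points `p_1, …, p_{d+1}` with their indices counted from 1. Also `p_0 = p_1`, so that
`y_0 = x_{p_0→p_1} = 1`. -/
def pt {d : ℕ} (p : Fin (d + 1) → ℕ+) (r : ℕ) : ℕ+ := p ⟨min (r - 1) d, by omega⟩

/-- `exp (c s)` for a power series `s` without constant term. -/
def expSeries {A : Type*} [CommRing A] [Algebra ℚ A] {d : ℕ} (c : A)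
    (s : MvPowerSeries (Fin d) A) : MvPowerSeries (Fin d) A :=
  PowerSeries.subst (MvPowerSeries.C c * s) (PowerSeries.exp ℚ)

open Classical in
/-- The generating series `[y_1,…,y_d | t_1,…,t_d] = ∑ [y_1,…,y_d]_{n_1,…,n_d} ∏ t_r^{n_r - 1}` over
`H̄`, with `[∅|∅] = 1`. (It is only used for monotone `p`; for other `p` it is set to 0.) -/
def genBar : (d : ℕ) → (Fin (d + 1) → ℕ+) → MvPowerSeries (Fin d) HBar
  | 0, _ => 1
  | d + 1, p => fun m =>
      if h : StrictMono p ∨ StrictAnti p then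
        MvPolynomial.X (BarGen.poly d p h fun r => (m r).succPNat)
      else 0

open Classical in
/-- The same generating series over `H`, for strictly increasing `p`. -/
def genReg : (d : ℕ) → (Fin (d + 1) → ℕ+) → MvPowerSeries (Fin d) HSymb
  | 0, _ => 1
  | d + 1, p => fun m =>
      if h : StrictMono p then
        MvPolynomial.X (RegGen.poly d p h fun r => (m r).succPNat)
      else 0

/-- `[y_1,…,y_k | s_1,…,s_k]` over `H̄`, with `s_1,…,s_k` power series without constant term. -/
def brBar {d k : ℕ} (p : Fin (k + 1) → ℕ+) (s : Fin k → MvPowerSeries (Fin d) HBar) :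
    MvPowerSeries (Fin d) HBar :=
  MvPowerSeries.subst s (genBar k p)

/-- `[y_1,…,y_k | s_1,…,s_k]` over `H`, with `s_1,…,s_k` power series without constant term. -/
def brReg {d k : ℕ} (p : Fin (k + 1) → ℕ+) (s : Fin k → MvPowerSeries (Fin d) HSymb) :
    MvPowerSeries (Fin d) HSymb :=
  MvPowerSeries.subst s (genReg k p)

/-- The exponent vector `(n_1 - 1, …, n_d - 1)`. -/
def expo {d : ℕ} (n : Fin d → ℕ+) : Fin d →₀ ℕ :=
  Finsupp.equivFunOnFinite.symm fun r => (n r : ℕ) - 1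

/-! ## The coproduct of the auxiliary algebra -/

/-- The index set `0 = i_0 = j_0 < i_1 ≤ j_1 < ⋯ < i_k ≤ j_k < i_{k+1} = d + 1` of the coproduct.
(The indices with `j_0 > 0` would involve symbols with the entry `y_0 = 1`, and do not occur.) -/
def Admissible {d k : ℕ} (i : Fin (k + 2) → Fin (d + 2)) (j : Fin (k + 1) → Fin (d + 2)) : Prop :=
  i 0 = 0 ∧ j 0 = 0 ∧ i (Fin.last (k + 1)) = Fin.last (d + 1) ∧
    ∀ α : Fin (k + 1), i α.castSucc ≤ j α ∧ j α < i α.succ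

/-- The factor for `α` in the right-hand tensor factor of the coproduct, where `i = i_α`,
`j = j_α` and `i' = i_{α+1}`:
`(-1)^(j-i) exp([y_{i→i'}]_0 t_j) [y_{j-1}⁻¹,…,y_i⁻¹ | t_j-t_{j-1},…,t_j-t_i]`
`[y_{j+1},…,y_{i'-1} | t_{j+1}-t_j,…,t_{i'-1}-t_j]`. -/
def comulFactor {d : ℕ} (p : Fin (d + 1) → ℕ+) (i j i' : ℕ) : MvPowerSeries (Fin d) HBar :=
  (-1) ^ (j - i) *
    expSeries (logTo (fun r => MvPolynomial.X (BarGen.log r)) (pt p i) (pt p i')) (tVar d j) *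
    brBar (fun a : Fin (j - i + 1) => pt p (j - a))
      (fun a : Fin (j - i) => tVar d j - tVar d (j - 1 - a)) *
    brBar (fun a : Fin (i' - 1 - j + 1) => pt p (j + 1 + a))
      (fun a : Fin (i' - 1 - j) => tVar d (j + 1 + a) - tVar d j)

open Classical in
/-- The coproduct of the generating series `[y_1,…,y_d | t_1,…,t_d]`. -/
def comulSeries {d : ℕ} (p : Fin (d + 1) → ℕ+) : MvPowerSeries (Fin d) (HBar ⊗[ℚ] HBar) :=
  ∑ k ∈ Finset.range (d + 1), ∑ i : Fin (k + 2) → Fin (d + 2), ∑ j : Fin (k + 1) → Fin (d + 2),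
    if Admissible i j then
      MvPowerSeries.map
          (Algebra.TensorProduct.includeLeft : HBar →ₐ[ℚ] HBar ⊗[ℚ] HBar).toRingHom
          (brBar (fun a : Fin (k + 1) => pt p (i a.succ)) (fun a : Fin k => tVar d (j a.succ))) *
        MvPowerSeries.map
          (Algebra.TensorProduct.includeRight : HBar →ₐ[ℚ] HBar ⊗[ℚ] HBar).toRingHom
          (∏ α : Fin (k + 1), comulFactor p (i α.castSucc) (j α) (i α.succ))
    else 0

/-- The coproduct `Δ : H̄ → H̄ ⊗ H̄` on generators. -/
def comulBarGen : BarGen → HBar ⊗[ℚ] HBar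
  | .log i => MvPolynomial.X (BarGen.log i) ⊗ₜ 1 + 1 ⊗ₜ MvPolynomial.X (BarGen.log i)
  | .poly _ p _ n => MvPowerSeries.coeff (expo n) (comulSeries p)

/-- The coproduct `Δ : H̄ → H̄ ⊗ H̄`. -/
def comulBar : HBar →ₐ[ℚ] HBar ⊗[ℚ] HBar := MvPolynomial.aeval comulBarGen

/-! ## The inversion map and the coproduct on regular symbols -/

/-- Division of a power series by an indeterminate that divides it, as a shift of coefficients. -/
def divVar {A : Type*} [CommRing A] {d : ℕ} (j : Fin d) (f : MvPowerSeries (Fin d) A) :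
    MvPowerSeries (Fin d) A :=
  fun m => MvPowerSeries.coeff (m + Finsupp.single j 1) f

theorem divVar_X_mul {A : Type*} [CommRing A] {d : ℕ} (j : Fin d) (f : MvPowerSeries (Fin d) A) :
    divVar j (MvPowerSeries.X j * f) = f := by
  ext m
  change MvPowerSeries.coeff (m + Finsupp.single j 1) (MvPowerSeries.X j * f) = _
  rw [add_comm, MvPowerSeries.X, MvPowerSeries.coeff_add_monomial_mul, one_mul]

/-- The series `INV [y_d⁻¹,…,y_1⁻¹ | -t_d,…,-t_1]` in `t_1,…,t_d` over `H`, for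
`y_r = x_{p_r→p_{r+1}}` with `p` strictly increasing, by recursion on the depth `d`. In the second
sum `j` stands for the summand of index `j + 1`; the two terms with the denominator `t_{j+1}` are
taken together, so that their difference is divisible by `t_{j+1}`. -/
def invSeries (d : ℕ) (p : Fin (d + 1) → ℕ+) : MvPowerSeries (Fin d) HSymb :=
  if d = 0 then 1
  else
    ∑ j : Fin d, (-1) ^ (d - 1 + j : ℕ) *
      (MvPowerSeries.subst (fun a : Fin (j : ℕ) => (tVar d (a + 1) : MvPowerSeries (Fin d) HSymb))
          (invSeries j fun a => pt p (a + 1)) *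
        brReg (fun a : Fin (d - j + 1) => pt p (j + 1 + a))
          (fun a : Fin (d - j) => tVar d (j + 1 + a))) +
    ∑ j : Fin d, (-1) ^ (d + (j + 1) : ℕ) *
      divVar j
        (MvPowerSeries.subst
            (fun a : Fin (j : ℕ) =>
              (tVar d (a + 1) - tVar d (j + 1) : MvPowerSeries (Fin d) HSymb))
            (invSeries j fun a => pt p (a + 1)) *
          expSeries (logTo (fun r => MvPolynomial.X (RegGen.log r)) (pt p 1) (pt p (d + 1)))
            (tVar d (j + 1)) *
          brReg (fun a : Fin (d - (j + 1) + 1) => pt p (j + 1 + 1 + a))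
            (fun a : Fin (d - (j + 1)) => tVar d (j + 1 + 1 + a) - tVar d (j + 1)) -
        MvPowerSeries.subst
            (fun a : Fin (j : ℕ) => (tVar d (a + 1) : MvPowerSeries (Fin d) HSymb))
            (invSeries j fun a => pt p (a + 1)) *
          brReg (fun a : Fin (d - (j + 1) + 1) => pt p (j + 1 + 1 + a))
            (fun a : Fin (d - (j + 1)) => tVar d (j + 1 + 1 + a)))
termination_by d
decreasing_by all_goals exact j.isLt

open Classical in
/-- The inversion map on generators: it fixes `[x_i]_0` and the regular symbols, and on the inverted
symbols it is given by the coefficients of the series above; the sign comes from the variables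
`-t_r` there. -/
def invGen : BarGen → HSymb
  | .log i => MvPolynomial.X (RegGen.log i)
  | .poly d p _ n =>
      if h : StrictMono p then MvPolynomial.X (RegGen.poly d p h n)
      else
        (-1) ^ (∑ r, ((n r : ℕ) - 1)) *
          MvPowerSeries.coeff (expo fun r => n (Fin.rev r))
            (invSeries (d + 1) fun r => p (Fin.rev r))

/-- The inversion map `INV : H̄ → H`. -/
def INV : HBar →ₐ[ℚ] HSymb := MvPolynomial.aeval invGen

/-- The coproduct of `H`: the restriction of `INV ∘ Δ` to the regular symbols. -/
def comulH : HSymb →ₐ[ℚ] HSymb ⊗[ℚ] HSymb :=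
  (Algebra.TensorProduct.map INV INV).comp (comulBar.comp inclusion)

end PolyHopf

end

/-!
The proof translates the symbols into moulds: functions of words `(p_1,t_1)…(p_d,t_d)` with an end
point `q`, with values in a commutative ring. Cutting words gives an associative product
(`Mould`), with shifts of the variables and with characters acting by conjugation.

*The coproduct is a composition of substitutions.* A point `φ : H̄ → R` has three kinds of values:
the generating series of its symbols form a mould `F`, its signed reversal `N = iota F` collects the
inverted tuples, and `exp ([x_i]_0 t)` gives characters. From such data one obtains a substitution
`SubstData.gax` (Écalle's gaxit): a ring endomorphism of the moulds that replaces each letter with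
variable `t` by the sum over all blocks containing a letter with this variable, in which the letters
before it contribute `N`, those after it contribute `F`, their variables are shifted by `t`, and the
characters conjugate. Local ring endomorphisms are determined by their values on letters
(`ringHom_unique`), so that a composition of substitutions is again a substitution (`gax_gax`), and
the composition of data is associative (`comp_assoc`). Expanded as a sum over chains of indices
(`mul_gax_eq_sum`), the composition formula is the formula for `Δ`; hence the convolution product of
points corresponds to the composition of substitutions (`ptData_convPt_agree`). Since points are
determined by their moulds (`point_ext`), the coassociativity and the counit axioms follow.
Here and below only words with monotone points matter, because only these carry symbols; the
substitution never leaves them.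

*The inversion map is characterized by a relation that composition preserves.* Let `M = 1 - 1/t`,
the mould with the values `1`, `-1/t_1` and `0` in depths `0`, `1` and at least `2`. The recursion
for `INV` says that `N * M * F = gax M` on words with increasing points, for every point that
factors through `INV` (`inversion_relation_seg`, `invRel_INV`); the values lie in the total ring of
fractions of a power series ring, so that the poles make sense. The data with this property are
closed under composition (`comp_stabilizes`, `InvRel.convPt`). Conversely the relation expresses the
values at the inverted symbols through those at the regular symbols and the `[x_i]_0`, so that every
point with this property factors through `INV` (`eq_comp_INV_of_invRel`). Applied to the point
`(INV ⊗ INV) ∘ Δ`, this is `Δ_H ∘ INV = (INV ⊗ INV) ∘ Δ` (`comulH_comp_INV`). As `INV` is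
surjective, the axioms for `H` follow from those for `H̄`.

*Gradings and antipodes.* If `t_r` has degree `-1`, then all generating series are homogeneous
(`HomogSeries`), and hence so are the coproducts and `INV`. A connected graded bialgebra has an
antipode, given by a geometric series (`exists_conv_inverse`), and bialgebra homomorphisms commute
with antipodes because inverses for the convolution product are unique
(`antipode_comp_of_comul_comp`).
-/

noncomputable section

namespace PolyHopf

/-! ### Moulds and their convolution product -/

/-- A mould: a function of the words `(p_1,t_1)…(p_d,t_d)` with an end point `q`. Such a word stands
for the tuple `x_{p_1→p_2}, …, x_{p_d→q}` with the variables `t_1, …, t_d`. -/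
def Mould (P T K : Type*) : Type _ := List (P × T) → P → K

/-- The first of the points `p_1, …, p_d, q` of a word with end point `q`. -/
def head {P T : Type*} : List (P × T) → P → P
  | [], q => q
  | x :: _, _ => x.1

namespace Mould

section Ring

variable {P T K : Type*}

@[ext] theorem ext {A B : Mould P T K} (h : ∀ w q, A w q = B w q) : A = B :=
  funext fun w => funext fun q => h w q

/-- The mould `u ↦ A (x u)`. -/
def tail (A : Mould P T K) (x : P × T) : Mould P T K := fun w q => A (x :: w) q

@[simp] theorem tail_apply (A : Mould P T K) (x w q) : A.tail x w q = A (x :: w) q := rfl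

variable [CommRing K]

instance : AddCommGroup (Mould P T K) :=
  inferInstanceAs (AddCommGroup (List (P × T) → P → K))

instance : Module K (Mould P T K) :=
  inferInstanceAs (Module K (List (P × T) → P → K))

@[simp] theorem add_apply (A B : Mould P T K) (w q) : (A + B) w q = A w q + B w q := rfl
@[simp] theorem zero_apply (w q) : (0 : Mould P T K) w q = 0 := rfl
@[simp] theorem neg_apply (A : Mould P T K) (w q) : (-A) w q = -A w q := rfl
@[simp] theorem sub_apply (A B : Mould P T K) (w q) : (A - B) w q = A w q - B w q := rfl
@[simp] theorem smul_apply (c : K) (A : Mould P T K) (w q) : (c • A) w q = c * A w q := rfl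

theorem sum_apply {ι : Type*} (s : Finset ι) (A : ι → Mould P T K) (w q) :
    (∑ i ∈ s, A i) w q = ∑ i ∈ s, A i w q := by
  classical
  induction s using Finset.induction_on with
  | empty => simp
  | insert a s ha ih => rw [Finset.sum_insert ha, Finset.sum_insert ha, add_apply, ih]

/-- The convolution product `(A * B)(w; q) = ∑_{w = u v} A (u; head (v; q)) * B (v; q)`. -/
def mul : Mould P T K → Mould P T K → Mould P T K
  | A, B, [], q => A [] q * B [] q
  | A, B, x :: w, q => A [] x.1 * B (x :: w) q + mul (tail A x) B w q

instance : Mul (Mould P T K) := ⟨mul⟩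

/-- The mould concentrated on empty words, with the given function of the end point. -/
def cst (f : P → K) : Mould P T K
  | [], q => f q
  | _ :: _, _ => 0

instance : One (Mould P T K) := ⟨cst 1⟩

@[simp] theorem cst_nil (f : P → K) (q) : (cst f : Mould P T K) [] q = f q := rfl
@[simp] theorem cst_cons (f : P → K) (x w q) : (cst f : Mould P T K) (x :: w) q = 0 := rfl
@[simp] theorem one_nil (q) : (1 : Mould P T K) [] q = 1 := rfl
@[simp] theorem one_cons (x w q) : (1 : Mould P T K) (x :: w) q = 0 := rfl
theorem cst_one : (cst 1 : Mould P T K) = 1 := rfl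
@[simp] theorem tail_cst (f : P → K) (x) : (cst f : Mould P T K).tail x = 0 := rfl
@[simp] theorem tail_add (A B : Mould P T K) (x) : (A + B).tail x = A.tail x + B.tail x := rfl
@[simp] theorem tail_smul (c : K) (A : Mould P T K) (x) : (c • A).tail x = c • A.tail x := rfl

@[simp] theorem mul_nil (A B : Mould P T K) (q) : (A * B) [] q = A [] q * B [] q := rfl

theorem mul_cons (A B : Mould P T K) (x w q) :
    (A * B) (x :: w) q = A [] x.1 * B (x :: w) q + (A.tail x * B) w q := rfl

theorem tail_mul (A B : Mould P T K) (x) :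
    (A * B).tail x = A [] x.1 • B.tail x + A.tail x * B := rfl

theorem add_mul_aux (B : Mould P T K) (w) : ∀ (A A' : Mould P T K) (q),
    ((A + A') * B) w q = (A * B) w q + (A' * B) w q := by
  induction w with
  | nil => intro A A' q; simp [add_mul]
  | cons x w ih => intro A A' q; rw [mul_cons, mul_cons, mul_cons, tail_add, ih]; simp; ring

theorem mul_add_aux (B B' : Mould P T K) (w) : ∀ (A : Mould P T K) (q),
    (A * (B + B')) w q = (A * B) w q + (A * B') w q := by
  induction w with
  | nil => intro A q; simp [mul_add]
  | cons x w ih => intro A q; rw [mul_cons, mul_cons, mul_cons, ih]; simp; ring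

theorem smul_mul_aux (c : K) (B : Mould P T K) (w) : ∀ (A : Mould P T K) (q),
    ((c • A) * B) w q = c * (A * B) w q := by
  induction w with
  | nil => intro A q; simp [mul_assoc]
  | cons x w ih => intro A q; rw [mul_cons, mul_cons, tail_smul, ih]; simp; ring

theorem mul_smul_aux (c : K) (B : Mould P T K) (w) : ∀ (A : Mould P T K) (q),
    (A * (c • B)) w q = c * (A * B) w q := by
  induction w with
  | nil => intro A q; simp [mul_left_comm]
  | cons x w ih => intro A q; rw [mul_cons, mul_cons, ih]; simp; ring

theorem zero_mul_aux (B : Mould P T K) : 0 * B = 0 := by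
  ext w q
  have := smul_mul_aux 0 B w 0 q
  simpa using this

theorem mul_zero_aux (B : Mould P T K) : B * 0 = 0 := by
  ext w q
  have := mul_smul_aux 0 0 w B q
  simpa using this

theorem mul_assoc_aux (B C : Mould P T K) (w) : ∀ (A : Mould P T K) (q),
    (A * B * C) w q = (A * (B * C)) w q := by
  induction w with
  | nil => intro A q; simp [mul_assoc]
  | cons x w ih =>
    intro A q
    rw [mul_cons, mul_cons, tail_mul, add_mul_aux, smul_mul_aux, ih, mul_cons]
    simp; ring

instance : Ring (Mould P T K) where
  __ := (inferInstance : AddCommGroup (Mould P T K))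
  left_distrib A B C := by ext w q; exact mul_add_aux B C w A q
  right_distrib A B C := by ext w q; exact add_mul_aux C w A B q
  zero_mul := zero_mul_aux
  mul_zero := mul_zero_aux
  mul_assoc A B C := by ext w q; exact mul_assoc_aux B C w A q
  one_mul A := by
    ext w q
    cases w with
    | nil => simp
    | cons x w =>
      rw [mul_cons]
      have : tail (1 : Mould P T K) x = 0 := rfl
      rw [this, zero_mul_aux]; simp
  mul_one A := by
    ext w q
    induction w generalizing A with
    | nil => simp
    | cons x w ih => rw [mul_cons, ih]; simp

theorem mul_smul' (c : K) (A B : Mould P T K) : A * (c • B) = c • (A * B) := by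
  ext w q; exact mul_smul_aux c B w A q

@[simp] theorem cst_mul_apply (f : P → K) (A : Mould P T K) (w q) :
    ((cst f : Mould P T K) * A) w q = f (head w q) * A w q := by
  cases w with
  | nil => rfl
  | cons x w => rw [mul_cons]; simp [head]

@[simp] theorem mul_cst_apply (f : P → K) (A : Mould P T K) (w q) :
    (A * (cst f : Mould P T K)) w q = A w q * f q := by
  induction w generalizing A with
  | nil => rfl
  | cons x w ih => rw [mul_cons, ih]; simp

theorem cst_mul_cst (f g : P → K) : (cst f * cst g : Mould P T K) = cst (f * g) := by
  ext w q; cases w <;> simp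

theorem cst_comm (f g : P → K) : (cst f * cst g : Mould P T K) = cst g * cst f := by
  rw [cst_mul_cst, cst_mul_cst, mul_comm]

/-- The product as a sum over the cuts of the word. -/
theorem mul_apply (A B : Mould P T K) (w q) : (A * B) w q =
    ∑ m ∈ Finset.range (w.length + 1), A (w.take m) (head (w.drop m) q) * B (w.drop m) q := by
  induction w generalizing A with
  | nil => simp [head]
  | cons x w ih =>
    rw [mul_cons, ih, List.length_cons, Finset.sum_range_succ' _ (w.length + 1), add_comm]
    rfl

/-- The value of a product depends only on the values of the factors at the pieces of the word. -/
theorem mul_congr {A A' B B' : Mould P T K} {w : List (P × T)} {q : P}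
    (h : ∀ u v, w = u ++ v →
      A u (head v q) * B v q = A' u (head v q) * B' v q) :
    (A * B) w q = (A' * B') w q := by
  rw [mul_apply, mul_apply]
  exact Finset.sum_congr rfl fun m _ => h _ _ (List.take_append_drop m w).symm

/-- The mould of the words of length one with second entry `s`. -/
def letter [DecidableEq T] (s : T) : Mould P T K
  | [x], _ => if x.2 = s then 1 else 0
  | _, _ => 0

@[simp] theorem letter_nil [DecidableEq T] (s : T) (q) : (letter s : Mould P T K) [] q = 0 := rfl

theorem tail_letter [DecidableEq T] (s : T) (x : P × T) :
    (letter s : Mould P T K).tail x = if x.2 = s then 1 else 0 := by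
  ext w q
  cases w with
  | nil => by_cases h : x.2 = s <;> simp [letter, h]
  | cons y w => by_cases h : x.2 = s <;> simp [letter, h]

/-- A ring endomorphism of the moulds is local if each value of the image depends only on finitely
many values of the argument. -/
def Local (H : Mould P T K →+* Mould P T K) : Prop :=
  ∀ w q, ∃ U : Finset (List (P × T) × P), ∀ M M' : Mould P T K,
    (∀ u ∈ U, M u.1 u.2 = M' u.1 u.2) → H M w q = H M' w q

theorem Local.comp {H H' : Mould P T K →+* Mould P T K} (h : Local H) (h' : Local H') :
    Local (H.comp H') := by
  classical
  intro w q
  obtain ⟨U, hU⟩ := h w q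
  choose V hV using h'
  refine ⟨U.biUnion fun u => V u.1 u.2, fun M M' hM => hU _ _ fun u hu => ?_⟩
  exact hV _ _ _ _ fun v hv => hM v (Finset.mem_biUnion.2 ⟨u, hu, hv⟩)

/-- Local ring endomorphisms that fix the moulds of depth zero are determined by their values on the
moulds `letter s`: on finitely many words a mould agrees with a finite sum of products that begin
with a mould of depth one. -/
theorem ringHom_unique [DecidableEq T] {H H' : Mould P T K →+* Mould P T K} (h : Local H)
    (h' : Local H') (hc : ∀ f, H (cst f) = cst f) (hc' : ∀ f, H' (cst f) = cst f)
    (hl : ∀ s, H (letter s) = H' (letter s)) (hn : ∀ s q, H (letter s) [] q = 0) : H = H' := by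
  classical
  suffices hs : ∀ n, ∀ w : List (P × T), w.length = n → ∀ q M, H M w q = H' M w q by
    ext M w q; exact hs _ w rfl q M
  intro n
  induction n using Nat.strong_induction_on with
  | _ n ih =>
  intro w hw q M
  obtain ⟨U, hU⟩ := h w q
  obtain ⟨U', hU'⟩ := h' w q
  let S : Finset (P × T) := (U ∪ U').biUnion fun u => u.1.toFinset
  let D : P × T → Mould P T K := fun x => cst (Pi.single x.1 1) * letter x.2
  have hD : ∀ x, H (D x) = H' (D x) := fun x => by simp only [D, map_mul, hc, hc', hl]
  have hD0 : ∀ x q, H (D x) [] q = 0 := fun x q => by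
    simp only [D, map_mul, hc, mul_nil, hn, mul_zero]
  let M' : Mould P T K := cst (fun q => M [] q) + ∑ x ∈ S, D x * M.tail x
  have hDt : ∀ x y, (D x).tail y = if y = x then 1 else 0 := by
    intro x y
    simp only [D, tail_mul, cst_nil, tail_cst, zero_mul, add_zero, tail_letter]
    by_cases hxy : y = x
    · subst hxy; simp
    · rw [if_neg hxy]
      by_cases h2 : y.2 = x.2
      · have : y.1 ≠ x.1 := fun h1 => hxy (Prod.ext h1 h2)
        simp [this]
      · simp [h2]
  have hDn : ∀ x p, D x [] p = 0 := fun x p => by simp [D]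
  have hM : ∀ u ∈ U ∪ U', M u.1 u.2 = M' u.1 u.2 := by
    rintro ⟨u, p⟩ hu
    cases u with
    | nil => simp [M', sum_apply, hDn]
    | cons y u =>
      have hy : y ∈ S := Finset.mem_biUnion.2 ⟨_, hu, by simp⟩
      simp only [M', add_apply, sum_apply, cst_cons, mul_cons, hDn, hDt, zero_mul, zero_add]
      rw [Finset.sum_eq_single y]
      · simp
      · intro x _ hx
        rw [if_neg (Ne.symm hx), zero_mul]; rfl
      · exact fun hy' => absurd hy hy'
  rw [hU M M' fun u hu => hM u (Finset.mem_union_left _ hu),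
    hU' M M' fun u hu => hM u (Finset.mem_union_right _ hu)]
  simp only [M', map_add, map_sum, map_mul, hc, hc', add_apply, sum_apply]
  congr 1
  refine Finset.sum_congr rfl fun x _ => ?_
  rw [← hD]
  refine mul_congr fun u v huv => ?_
  cases u with
  | nil => rw [hD0, zero_mul, zero_mul]
  | cons y u =>
    rw [ih v.length (by rw [← hw, huv]; simp) v rfl]

end Ring

/-! ### Shifts and characters -/

section Shift

variable {P T K : Type*} [CommRing K] [AddCommGroup T]

/-- The word with `s` subtracted from all its variables. -/
def shiftWord (s : T) (w : List (P × T)) : List (P × T) := w.map fun x => (x.1, x.2 - s)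

@[simp] theorem shiftWord_nil (s : T) : shiftWord s ([] : List (P × T)) = [] := rfl
@[simp] theorem shiftWord_cons (s : T) (x : P × T) (w) :
    shiftWord s (x :: w) = (x.1, x.2 - s) :: shiftWord s w := rfl

@[simp] theorem head_shiftWord (s : T) (w : List (P × T)) (q) :
    head (shiftWord s w) q = head w q := by cases w <;> rfl

theorem shiftWord_shiftWord (s t : T) (w : List (P × T)) :
    shiftWord s (shiftWord t w) = shiftWord (s + t) w := by
  simp only [shiftWord, List.map_map]
  congr 1; funext x; simp only [Function.comp]; rw [sub_sub, add_comm]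

/-- The function underlying `shift`. -/
def shiftFun (s : T) (M : Mould P T K) : Mould P T K := fun w q => M (shiftWord s w) q

theorem shiftFun_mul_apply (s : T) (B : Mould P T K) (w : List (P × T)) :
    ∀ (A : Mould P T K) (q : P), (A * B) (shiftWord s w) q =
      (shiftFun s A * shiftFun s B) w q := by
  induction w with
  | nil => intro A q; rfl
  | cons x w ih => intro A q; rw [shiftWord_cons, mul_cons, ih, mul_cons]; rfl

/-- Evaluation at shifted variables, `(shift s M)(w; q) = M(w - s; q)`. -/
def shift (s : T) : Mould P T K →+* Mould P T K where
  toFun := shiftFun s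
  map_one' := by ext w q; cases w <;> rfl
  map_mul' A B := by ext w q; exact shiftFun_mul_apply s B w A q
  map_zero' := rfl
  map_add' _ _ := rfl

theorem shift_apply (s : T) (M : Mould P T K) (w q) : shift s M w q = M (shiftWord s w) q := rfl

theorem shift_shift (s t : T) (M : Mould P T K) : shift s (shift t M) = shift (s + t) M := by
  ext w q; rw [shift_apply, shift_apply, shift_apply, shiftWord_shiftWord, add_comm]

theorem shift_zero (M : Mould P T K) : shift 0 M = M := by
  ext w q; rw [shift_apply]; congr; simp [shiftWord]

@[simp] theorem shift_cst (s : T) (f : P → K) : shift s (cst f : Mould P T K) = cst f := by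
  ext w q; cases w <;> rfl

theorem shift_letter [DecidableEq T] (s t : T) :
    shift s (letter t : Mould P T K) = letter (s + t) := by
  ext w q
  rw [shift_apply]
  match w with
  | [] => rfl
  | [x] => simp [letter, sub_eq_iff_eq_add, add_comm]
  | x :: y :: w => rfl

theorem shift_local (s : T) : Local (shift s : Mould P T K →+* Mould P T K) := fun w q =>
  ⟨{(shiftWord s w, q)}, fun _ _ h => h (shiftWord s w, q) (by simp)⟩

/-- Families of characters of `T`, one for each point. -/
abbrev Chars (P T K : Type*) [CommRing K] [AddCommGroup T] := Multiplicative T →* (P → K)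

/-- The value of the `q`-th character. -/
def ev (E : Chars P T K) (s : T) : P → K := E (Multiplicative.ofAdd s)

theorem ev_add (E : Chars P T K) (s t : T) : ev E (s + t) = ev E s * ev E t := by
  simp [ev, ofAdd_add]

theorem ev_zero (E : Chars P T K) : ev E (0 : T) = 1 := by simp [ev]

theorem ev_neg_mul (E : Chars P T K) (s : T) : ev E (-s) * ev E s = 1 := by
  rw [← ev_add, neg_add_cancel, ev_zero]

theorem ev_mul (E E' : Chars P T K) (s : T) : ev (E * E') s = ev E s * ev E' s := rfl

/-- Conjugation by a character: it multiplies the value at a word from `p` to `q` by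
`E_q(s) / E_p(s)`. -/
def conj (E : Chars P T K) (s : T) : Mould P T K →+* Mould P T K where
  toFun M := cst (ev E (-s)) * M * cst (ev E s)
  map_one' := by rw [mul_one, cst_mul_cst, ev_neg_mul, cst_one]
  map_mul' A B := by
    have : (cst (ev E s) * cst (ev E (-s)) : Mould P T K) = 1 := by
      rw [cst_comm, cst_mul_cst, ev_neg_mul, cst_one]
    calc cst (ev E (-s)) * (A * B) * cst (ev E s)
        = cst (ev E (-s)) * A * 1 * B * cst (ev E s) := by noncomm_ring
      _ = _ := by rw [← this]; noncomm_ring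
  map_zero' := by simp
  map_add' A B := by rw [mul_add, add_mul]

theorem conj_def (E : Chars P T K) (s : T) (M : Mould P T K) :
    conj E s M = cst (ev E (-s)) * M * cst (ev E s) := rfl

theorem conj_apply (E : Chars P T K) (s : T) (M : Mould P T K) (w q) :
    conj E s M w q = ev E (-s) (head w q) * M w q * ev E s q := by
  rw [conj_def, mul_cst_apply, cst_mul_apply]

@[simp] theorem conj_cst (E : Chars P T K) (s : T) (f : P → K) :
    conj E s (cst f : Mould P T K) = cst f := by
  rw [conj_def, mul_assoc, cst_comm f, ← mul_assoc, cst_mul_cst, ev_neg_mul, cst_one, one_mul]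

theorem conj_zero (E : Chars P T K) (M : Mould P T K) : conj E 0 M = M := by
  ext w q; simp [conj_apply, ev_zero]

theorem conj_conj (E : Chars P T K) (s t : T) (M : Mould P T K) :
    conj E s (conj E t M) = conj E (s + t) M := by
  ext w q
  simp only [conj_apply]
  rw [neg_add, ev_add, ev_add]; simp; ring

theorem conj_mul_conj (E E' : Chars P T K) (s : T) (M : Mould P T K) :
    conj E s (conj E' s M) = conj (E * E') s M := by
  ext w q
  simp only [conj_apply, ev_mul]
  simp; ring

theorem shift_conj (E : Chars P T K) (s t : T) (M : Mould P T K) :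
    shift t (conj E s M) = conj E s (shift t M) := by
  ext w q
  simp [shift_apply, conj_apply]

theorem conj_local (E : Chars P T K) (s : T) :
    Local (conj E s : Mould P T K →+* Mould P T K) := fun w q =>
  ⟨{(w, q)}, fun _ _ h => by rw [conj_apply, conj_apply, h (w, q) (by simp)]⟩

end Shift

end Mould

/-! ### Substitution of moulds -/

/-- The data of a substitution of moulds: the mould `F` for the part of a block that follows the
marked letter, the mould `N` for the part that precedes it, and the characters `E`. -/
structure SubstData (P T K : Type*) [CommRing K] [AddCommGroup T] where
  /-- the mould for the letters before the marked one -/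
  N : Mould P T K
  /-- the mould for the letters after the marked one -/
  F : Mould P T K
  /-- the characters for the marked letter -/
  E : Mould.Chars P T K

namespace SubstData

open Mould

section Words

variable {P T : Type*}

/-- Induction on the length of words, in the form needed for `gaxFun_cons`. -/
theorem word_induction {C : List (P × T) → Prop} (h0 : C [])
    (h1 : ∀ x w, (∀ u v, u ≠ [] → x :: w = u ++ v → C v) → C (x :: w)) : ∀ w, C w := by
  suffices h : ∀ n (w : List (P × T)), w.length = n → C w from fun w => h _ w rfl
  intro n
  induction n using Nat.strong_induction_on with
  | _ n ih =>
    intro w hw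
    cases w with
    | nil => exact h0
    | cons x w =>
      refine h1 x w fun u v hu huv => ih v.length ?_ v rfl
      have := congrArg List.length huv
      have hu := List.length_pos_iff.2 hu
      simp at this hw
      omega

/-- The variables of a word. -/
def vars [DecidableEq T] (w : List (P × T)) : Finset T := (w.map Prod.snd).toFinset

theorem mem_vars [DecidableEq T] {w : List (P × T)} {t : T} : t ∈ vars w ↔ ∃ x ∈ w, x.2 = t := by
  simp [vars]

end Words

/-- The trivial substitution data. -/
def trivial (P T K : Type*) [CommRing K] [AddCommGroup T] : SubstData P T K := ⟨1, 1, 1⟩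

theorem trivial_F (P T K : Type*) [CommRing K] [AddCommGroup T] : (trivial P T K).F = 1 := rfl

variable {P T K : Type*} [CommRing K] [AddCommGroup T] [DecidableEq T]

/-- The image of `letter s`: the sum over the letters with variable `s` in the word `a x b` from
`p` to `q` of `E_{p→q}(s) N(a - s) F(b - s)`. -/
def block (D : SubstData P T K) (s : T) : Mould P T K :=
  conj D.E s (shift s (D.N * letter 0 * D.F))

theorem block_nil (D : SubstData P T K) (s : T) (q : P) : D.block s [] q = 0 := by
  simp [block, conj_apply, shift_apply]

theorem mul_letter_zero_mul_eq_zero (N F : Mould P T K) (w : List (P × T))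
    (hw : ∀ x ∈ w, x.2 ≠ 0) :
    ∀ q, (N * (letter 0 : Mould P T K) * F) w q = 0 := by
  induction w generalizing N with
  | nil => intro q; simp
  | cons x w ih =>
    intro q
    rw [mul_cons, tail_mul, tail_letter, if_neg (hw x (by simp))]
    have := ih (N.tail x) (fun y hy => hw y (by simp [hy])) q
    simp [this]

theorem block_eq_zero (D : SubstData P T K) {s : T} {w : List (P × T)} (h : s ∉ vars w) (q : P) :
    D.block s w q = 0 := by
  rw [block, conj_apply, shift_apply, mul_letter_zero_mul_eq_zero]
  · simp
  · intro x hx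
    simp only [shiftWord, List.mem_map] at hx
    obtain ⟨y, hy, rfl⟩ := hx
    intro h0
    exact h (mem_vars.2 ⟨y, hy, sub_eq_zero.1 h0⟩)

/-- The substitution, computed correctly on the words of length at most the first argument. -/
def gaxAux (D : SubstData P T K) : ℕ → Mould P T K → Mould P T K
  | _, M, [], q => M [] q
  | 0, _, _ :: _, _ => 0
  | n + 1, M, x :: w, q =>
    ∑ s ∈ vars (x :: w), (D.block s * gaxAux D n (M.tail (x.1, s))) (x :: w) q

/-- The substitution of moulds: `gax D M (w; q)` is the sum over all decompositions of `w` into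
blocks with a marked letter in each; a block with first point `p` and marked variable `s`
contributes the value of `block s` and is contracted to the letter `(p, s)` in the argument
of `M`. -/
def gaxFun (D : SubstData P T K) (M : Mould P T K) : Mould P T K :=
  fun w q => gaxAux D w.length M w q

theorem block_mul_congr (D : SubstData P T K) (s : T) {B B' : Mould P T K} {w q}
    (h : ∀ u v, u ≠ [] → w = u ++ v → B v q = B' v q) :
    (D.block s * B) w q = (D.block s * B') w q := by
  refine mul_congr fun u v huv => ?_
  cases u with
  | nil => rw [block_nil, zero_mul, zero_mul]
  | cons y u => rw [h _ _ (by simp) huv]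

theorem gaxAux_eq (D : SubstData P T K) : ∀ n M (w : List (P × T)) q, w.length ≤ n →
    gaxAux D n M w q = D.gaxFun M w q := by
  suffices h : ∀ n m M (w : List (P × T)) q, w.length ≤ n → w.length ≤ m →
      gaxAux D n M w q = gaxAux D m M w q from fun n M w q hn => h _ _ M w q hn le_rfl
  intro n
  induction n with
  | zero =>
    intro m M w q h _
    obtain rfl : w = [] := List.length_eq_zero_iff.1 (by omega)
    cases m <;> rfl
  | succ n ih =>
    intro m M w q hn hm
    cases w with
    | nil => cases m <;> rfl
    | cons x w =>
      obtain ⟨m, rfl⟩ : ∃ k, m = k + 1 := ⟨m - 1, by simp at hm; omega⟩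
      refine Finset.sum_congr rfl fun s _ => block_mul_congr D s fun u v hu huv => ?_
      have := congrArg List.length huv
      have hu := List.length_pos_iff.2 hu
      simp at this hn hm
      exact ih m _ v q (by omega) (by omega)

theorem gaxFun_nil (D : SubstData P T K) (M : Mould P T K) (q) :
    D.gaxFun M [] q = M [] q := rfl

theorem gaxFun_cons_of_subset (D : SubstData P T K) (M : Mould P T K) (x : P × T) (w q)
    {S : Finset T} (hS : vars (x :: w) ⊆ S) : D.gaxFun M (x :: w) q =
      ∑ s ∈ S, (D.block s * D.gaxFun (M.tail (x.1, s))) (x :: w) q := by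
  rw [← Finset.sum_subset hS]
  · change ∑ s ∈ vars (x :: w), (D.block s * gaxAux D w.length (M.tail (x.1, s))) (x :: w) q = _
    refine Finset.sum_congr rfl fun s _ => block_mul_congr D s fun u v hu huv => ?_
    have := congrArg List.length huv
    have hu := List.length_pos_iff.2 hu
    simp at this
    exact gaxAux_eq D _ _ _ _ (by omega)
  · intro s _ hs
    rw [mul_apply]
    refine Finset.sum_eq_zero fun m _ => ?_
    rw [block_eq_zero, zero_mul]
    intro h
    obtain ⟨y, hy, h⟩ := mem_vars.1 h
    exact hs (mem_vars.2 ⟨y, List.mem_of_mem_take hy, h⟩)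

theorem gaxFun_cons (D : SubstData P T K) (M : Mould P T K) (x : P × T) (w q) :
    D.gaxFun M (x :: w) q =
      ∑ s ∈ vars (x :: w), (D.block s * D.gaxFun (M.tail (x.1, s))) (x :: w) q :=
  gaxFun_cons_of_subset D M x w q le_rfl

theorem gaxFun_add (D : SubstData P T K) (A B : Mould P T K) :
    D.gaxFun (A + B) = D.gaxFun A + D.gaxFun B := by
  suffices h : ∀ w A B q, D.gaxFun (A + B) w q = (D.gaxFun A + D.gaxFun B) w q by
    ext w q; exact h w A B q
  intro w
  induction w using word_induction with
  | h0 => intro A B q; rfl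
  | h1 x w ih =>
    intro A B q
    rw [Mould.add_apply, gaxFun_cons, gaxFun_cons, gaxFun_cons, ← Finset.sum_add_distrib]
    refine Finset.sum_congr rfl fun s _ => ?_
    rw [← Mould.add_apply, ← mul_add, tail_add]
    exact block_mul_congr D s fun u v hu huv => ih u v hu huv _ _ _

theorem gaxFun_smul (D : SubstData P T K) (c : K) (A : Mould P T K) :
    D.gaxFun (c • A) = c • D.gaxFun A := by
  suffices h : ∀ w A q, D.gaxFun (c • A) w q = (c • D.gaxFun A) w q by
    ext w q; exact h w A q
  intro w
  induction w using word_induction with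
  | h0 => intro A q; rfl
  | h1 x w ih =>
    intro A q
    rw [Mould.smul_apply, gaxFun_cons, gaxFun_cons, Finset.mul_sum]
    refine Finset.sum_congr rfl fun s _ => ?_
    rw [← Mould.smul_apply, ← mul_smul', tail_smul]
    exact block_mul_congr D s fun u v hu huv => ih u v hu huv _ _

theorem gaxFun_zero (D : SubstData P T K) : D.gaxFun 0 = 0 := by
  have := gaxFun_smul D 0 0
  simpa using this

theorem gaxFun_cst (D : SubstData P T K) (f : P → K) : D.gaxFun (cst f) = cst f := by
  ext w q
  cases w with
  | nil => rfl
  | cons x w =>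
    rw [gaxFun_cons]
    refine Finset.sum_eq_zero fun s _ => ?_
    rw [tail_cst, gaxFun_zero, mul_zero]; rfl

theorem gaxFun_letter (D : SubstData P T K) (s : T) : D.gaxFun (letter s) = D.block s := by
  ext w q
  cases w with
  | nil => rw [block_nil]; rfl
  | cons x w =>
    rw [gaxFun_cons_of_subset D _ x w q (Finset.subset_insert s _),
      Finset.sum_eq_single s]
    · rw [tail_letter, if_pos rfl, ← cst_one, gaxFun_cst, cst_one, mul_one]
    · intro t _ ht
      rw [tail_letter, if_neg ht, gaxFun_zero, mul_zero]; rfl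
    · intro h; simp at h

theorem gaxFun_mul (D : SubstData P T K) (A B : Mould P T K) :
    D.gaxFun (A * B) = D.gaxFun A * D.gaxFun B := by
  suffices h : ∀ w A B q, D.gaxFun (A * B) w q = (D.gaxFun A * D.gaxFun B) w q by
    ext w q; exact h w A B q
  intro w
  induction w using word_induction with
  | h0 => intro A B q; rfl
  | h1 x w ih =>
    intro A B q
    set S := vars (x :: w) with hS
    have h1 : D.gaxFun (A * B) (x :: w) q =
        A [] x.1 * D.gaxFun B (x :: w) q +
          ((∑ s ∈ S, D.block s * D.gaxFun (A.tail (x.1, s))) * D.gaxFun B) (x :: w) q := by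
      rw [gaxFun_cons, gaxFun_cons D B, Finset.mul_sum, Finset.sum_mul, Mould.sum_apply,
        ← Finset.sum_add_distrib]
      refine Finset.sum_congr rfl fun s _ => ?_
      rw [tail_mul, gaxFun_add, gaxFun_smul, mul_add, mul_smul', Mould.add_apply, Mould.smul_apply, mul_assoc]
      congr 1
      exact block_mul_congr D s fun u v hu huv => ih u v hu huv _ _ _
    rw [h1, mul_cons (D.gaxFun A), mul_cons (∑ s ∈ S, _), Mould.sum_apply, Finset.sum_eq_zero (s := S)]
    · rw [zero_mul, zero_add, gaxFun_nil]
      congr 1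
      refine mul_congr fun u v huv => ?_
      congr 1
      rw [tail_apply, tail_apply, Mould.sum_apply, gaxFun_cons_of_subset D A x u (head v q) (S := S)]
      intro t ht
      rw [mem_vars] at ht
      obtain ⟨y, hy, rfl⟩ := ht
      rw [hS, huv, mem_vars]
      refine ⟨y, ?_, rfl⟩
      simp only [List.mem_cons, List.mem_append] at hy ⊢
      tauto
    · intro s _
      rw [mul_nil, block_nil, zero_mul]

/-- The substitution of moulds, a ring endomorphism. -/
def gax (D : SubstData P T K) : Mould P T K →+* Mould P T K where
  toFun := D.gaxFun
  map_one' := by rw [← cst_one, gaxFun_cst]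
  map_mul' := gaxFun_mul D
  map_zero' := gaxFun_zero D
  map_add' := gaxFun_add D

theorem gax_cst (D : SubstData P T K) (f : P → K) : D.gax (cst f) = cst f := gaxFun_cst D f

theorem gax_letter (D : SubstData P T K) (s : T) : D.gax (letter s) = D.block s :=
  gaxFun_letter D s

theorem gax_nil (D : SubstData P T K) (M : Mould P T K) (q) : D.gax M [] q = M [] q := rfl

theorem gax_cons (D : SubstData P T K) (M : Mould P T K) (x : P × T) (w q) :
    D.gax M (x :: w) q =
      ∑ s ∈ vars (x :: w), (D.block s * D.gax (M.tail (x.1, s))) (x :: w) q :=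
  gaxFun_cons D M x w q

/-- Congruence for substitutions: if the values of the data agree on all words satisfying a property
that passes to subwords, the substitutions agree on these words. -/
theorem gax_congr {D D' : SubstData P T K} (good : List (P × T) → P → Prop)
    (hsub : ∀ u v q, good (u ++ v) q → good u (head v q) ∧ good v q)
    (hD : ∀ s w q, good w q → D.block s w q = D'.block s w q) (w : List (P × T)) :
    ∀ (M M' : Mould P T K) (q : P), good w q →
      (∀ u, (u.map Prod.fst).Sublist (w.map Prod.fst) → (∀ y ∈ u, y.2 ∈ vars w) →
        M u q = M' u q) → D.gax M w q = D'.gax M' w q := by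
  induction w using word_induction with
  | h0 =>
    intro M M' q _ h
    exact h [] (by simp) (by simp)
  | h1 x w ih =>
    intro M M' q hw h
    rw [gax_cons, gax_cons]
    refine Finset.sum_congr rfl fun s hs => mul_congr fun u v huv => ?_
    rw [huv] at hw
    rw [hD s u _ (hsub u v q hw).1]
    cases u with
    | nil => rw [block_nil, zero_mul, zero_mul]
    | cons y u =>
      congr 1
      refine ih _ v (by simp) huv _ _ _ (hsub _ v q hw).2 fun u' hu' hv' => ?_
      obtain ⟨rfl, rfl⟩ : x = y ∧ w = u ++ v := by simpa using huv
      refine h _ ?_ ?_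
      · simp only [List.map_cons, List.map_append]
        exact (hu'.trans (List.sublist_append_right _ _)).cons_cons _
      · intro z hz
        rcases List.mem_cons.1 hz with rfl | hz
        · exact hs
        · obtain ⟨a, ha, hb⟩ := mem_vars.1 (hv' z hz)
          exact mem_vars.2 ⟨a, by simp [ha], hb⟩

theorem gax_local (D : SubstData P T K) : Local D.gax := by
  classical
  intro w q
  -- the words of length at most `n` in the points and the variables of `w`
  induction w using word_induction with
  | h0 => exact ⟨{([], q)}, fun M M' h => h ([], q) (by simp)⟩
  | h1 x w ih =>
    have ih' : ∀ v, ∃ U : Finset (List (P × T) × P), (∃ u, u ≠ [] ∧ x :: w = u ++ v) →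
        ∀ M M' : Mould P T K, (∀ u ∈ U, M u.1 u.2 = M' u.1 u.2) →
          D.gax M v q = D.gax M' v q := by
      intro v
      by_cases h : ∃ u, u ≠ [] ∧ x :: w = u ++ v
      · obtain ⟨u, hu, huv⟩ := h
        obtain ⟨U, hU⟩ := ih u v hu huv
        exact ⟨U, fun _ => hU⟩
      · exact ⟨∅, fun h' => absurd h' h⟩
    choose U hU using ih'
    refine ⟨(vars (x :: w)).biUnion fun s =>
      ((x :: w).tails.toFinset.biUnion U).image fun u => ((x.1, s) :: u.1, u.2), ?_⟩
    intro M M' h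
    rw [gax_cons, gax_cons]
    refine Finset.sum_congr rfl fun s hs => block_mul_congr D s fun u v hu huv => ?_
    refine hU v ⟨u, hu, huv⟩ _ _ fun z hz => h ((x.1, s) :: z.1, z.2) ?_
    refine Finset.mem_biUnion.2 ⟨s, hs, Finset.mem_image.2 ⟨z, ?_, rfl⟩⟩
    refine Finset.mem_biUnion.2 ⟨v, ?_, hz⟩
    rw [List.mem_toFinset, List.mem_tails, huv]
    exact List.suffix_append u v

/-- Substitution and shifts commute up to a conjugation: the product over the blocks of the
characters of the individual blocks is the character of the whole word. -/
theorem gax_shift (D : SubstData P T K) (s : T) (M : Mould P T K) :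
    D.gax (shift s M) = conj D.E s (shift s (D.gax M)) := by
  have := ringHom_unique (H := D.gax.comp (shift s))
    (H' := (conj D.E s).comp ((shift s).comp D.gax))
    (D.gax_local.comp (shift_local s))
    ((conj_local _ _).comp ((shift_local s).comp D.gax_local))
    (fun f => by simp [gax_cst]) (fun f => by simp [gax_cst])
    (fun t => by
      simp only [RingHom.comp_apply, shift_letter, gax_letter, block]
      rw [shift_conj, shift_shift, conj_conj])
    (fun t q => by simp [gax_letter, shift_letter, block_nil])
  exact congrArg (fun H => H M) this

theorem gax_conj (D : SubstData P T K) (E : Chars P T K) (s : T) (M : Mould P T K) :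
    D.gax (conj E s M) = conj E s (D.gax M) := by
  rw [conj_def, map_mul, map_mul, gax_cst, gax_cst, conj_def]

/-- The composition of substitution data. -/
def comp (D₁ D₂ : SubstData P T K) : SubstData P T K where
  N := D₂.gax D₁.N * D₂.N
  F := D₂.F * D₂.gax D₁.F
  E := D₁.E * D₂.E

theorem comp_F (D₁ D₂ : SubstData P T K) : (D₁.comp D₂).F = D₂.F * D₂.gax D₁.F := rfl

/-- On letters, the composition of two substitutions is the substitution with the composed data. -/
theorem gax_block (D₁ D₂ : SubstData P T K) (s : T) :
    D₂.gax (D₁.block s) = (D₁.comp D₂).block s := by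
  rw [block, gax_conj, gax_shift, conj_mul_conj, block]
  congr 2
  rw [map_mul, map_mul, gax_letter, block, shift_zero, conj_zero]
  simp only [comp, mul_assoc]

theorem gax_gax (D₁ D₂ : SubstData P T K) (M : Mould P T K) :
    D₂.gax (D₁.gax M) = (D₁.comp D₂).gax M := by
  have := ringHom_unique (H := D₂.gax.comp D₁.gax) (H' := (D₁.comp D₂).gax)
    (D₂.gax_local.comp D₁.gax_local) (gax_local _)
    (fun f => by simp [gax_cst]) (fun f => gax_cst _ f)
    (fun t => by rw [RingHom.comp_apply, gax_letter, gax_letter, gax_block])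
    (fun t q => by rw [RingHom.comp_apply, gax_letter, gax_block, block_nil])
  exact congrArg (fun H => H M) this

theorem comp_assoc (D₁ D₂ D₃ : SubstData P T K) :
    (D₁.comp D₂).comp D₃ = D₁.comp (D₂.comp D₃) := by
  have hN : ((D₁.comp D₂).comp D₃).N = (D₁.comp (D₂.comp D₃)).N := by
    change D₃.gax (D₂.gax D₁.N * D₂.N) * D₃.N = (D₂.comp D₃).gax D₁.N * (D₃.gax D₂.N * D₃.N)
    rw [map_mul, gax_gax, mul_assoc]
  have hF : ((D₁.comp D₂).comp D₃).F = (D₁.comp (D₂.comp D₃)).F := by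
    change D₃.F * D₃.gax (D₂.F * D₂.gax D₁.F) = D₃.F * D₃.gax D₂.F * (D₂.comp D₃).gax D₁.F
    rw [map_mul, gax_gax, mul_assoc]
  have hE : ((D₁.comp D₂).comp D₃).E = (D₁.comp (D₂.comp D₃)).E := mul_assoc _ _ _
  cases h : (D₁.comp D₂).comp D₃
  cases h' : D₁.comp (D₂.comp D₃)
  simp_all

/-- The substitution with trivial data is the identity. -/
theorem gax_trivial (M : Mould P T K) : (trivial P T K).gax M = M := by
  have := ringHom_unique (H := (trivial P T K).gax) (H' := RingHom.id _)
    (gax_local _) (fun w q => ⟨{(w, q)}, fun _ _ h => h (w, q) (by simp)⟩)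
    (fun f => gax_cst _ f) (fun f => rfl)
    (fun t => by
      rw [gax_letter, block, trivial, one_mul, mul_one, shift_letter, add_zero]
      ext w q
      simp [conj_apply, ev])
    (fun t q => by rw [gax_letter, block_nil])
  exact congrArg (fun H => H M) this

theorem trivial_comp_F (D : SubstData P T K) : ((trivial P T K).comp D).F = D.F := by
  rw [comp_F, trivial_F, map_one, mul_one]

theorem comp_trivial_F (D : SubstData P T K) : (D.comp (trivial P T K)).F = D.F := by
  rw [comp_F, trivial_F, gax_trivial, one_mul]

/-- For a fixed mould `M`, the data with `N * M * F = gax M` are closed under composition. The class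
`good` restricts the relation to words that the substitution does not leave: `good` passes to the
pieces of a word, and to the words that arise by contracting the blocks to single letters. -/
theorem comp_stabilizes (D₁ D₂ : SubstData P T K) (M : Mould P T K)
    (good : List (P × T) → P → Prop)
    (hsub : ∀ u v q, good (u ++ v) q → good u (head v q) ∧ good v q)
    (hcon : ∀ u w q, (u.map Prod.fst).Sublist (w.map Prod.fst) → (∀ y ∈ u, y.2 ∈ vars w) →
      good w q → good u q)
    (h₁ : ∀ w q, good w q → (D₁.N * M * D₁.F) w q = D₁.gax M w q)
    (h₂ : ∀ w q, good w q → (D₂.N * M * D₂.F) w q = D₂.gax M w q) (w q) (hw : good w q) :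
    ((D₁.comp D₂).N * M * (D₁.comp D₂).F) w q = (D₁.comp D₂).gax M w q := by
  have e : (D₁.comp D₂).N * M * (D₁.comp D₂).F =
      D₂.gax D₁.N * ((D₂.N * M * D₂.F) * D₂.gax D₁.F) := by simp only [comp, mul_assoc]
  rw [e]
  calc (D₂.gax D₁.N * ((D₂.N * M * D₂.F) * D₂.gax D₁.F)) w q
      = (D₂.gax D₁.N * (D₂.gax M * D₂.gax D₁.F)) w q := by
        refine mul_congr fun u v huv => ?_
        congr 1
        refine mul_congr fun u' v' huv' => ?_
        rw [h₂ u' _ (hsub u' v' q (huv' ▸ (hsub u v q (huv ▸ hw)).2)).1]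
    _ = D₂.gax (D₁.N * M * D₁.F) w q := by rw [map_mul, map_mul, mul_assoc]
    _ = D₂.gax (D₁.gax M) w q :=
        gax_congr good hsub (fun _ _ _ _ => rfl) w _ _ q hw fun u hu hv =>
          h₁ u q (hcon u w q hu hv hw)
    _ = _ := by rw [gax_gax]

end SubstData

/-! ### Reversal of words -/

namespace Mould

section Words

variable {P T : Type*}

theorem head_append (u v : List (P × T)) (q : P) : head (u ++ v) q = head u (head v q) := by
  cases u <;> rfl

variable [AddCommGroup T]

/-- The reversed word: for `w = (p_1,t_1)…(p_d,t_d)` with end point `q` it is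
`(q,-t_d)(p_d,-t_{d-1})…(p_2,-t_1)`, to be read with end point `p_1`. -/
def revWord : List (P × T) → P → List (P × T)
  | [], _ => []
  | x :: w, q => revWord w q ++ [(head w q, -x.2)]

@[simp] theorem length_revWord (w : List (P × T)) (q) : (revWord w q).length = w.length := by
  induction w with
  | nil => rfl
  | cons x w ih => simp [revWord, ih]

theorem head_revWord (w : List (P × T)) (q) : head (revWord w q) (head w q) = q := by
  induction w with
  | nil => rfl
  | cons x w ih => rw [revWord, head_append]; exact ih

theorem revWord_append (u v : List (P × T)) (q) :
    revWord (u ++ v) q = revWord v q ++ revWord u (head v q) := by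
  induction u with
  | nil => simp [revWord]
  | cons x u ih => simp [revWord, ih, head_append]

theorem revWord_revWord (w : List (P × T)) (q) : revWord (revWord w q) (head w q) = w := by
  induction w with
  | nil => rfl
  | cons x w ih =>
    rw [revWord, revWord_append]
    have : head [(head w q, -x.2)] (head (x :: w) q) = head w q := rfl
    rw [this, ih]
    simp [revWord, head]

theorem revWord_shiftWord (s : T) (w : List (P × T)) (q) :
    revWord (shiftWord s w) q = shiftWord (-s) (revWord w q) := by
  induction w with
  | nil => rfl
  | cons x w ih =>
    rw [shiftWord_cons, revWord, ih, head_shiftWord, revWord]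
    simp [shiftWord, add_comm, sub_eq_add_neg]

end Words

variable {P T K : Type*} [CommRing K] [AddCommGroup T]

/-- The signed reversal of moulds. On words of reversed tuples it turns the mould of the inverted
symbols into the factor of the coproduct that belongs to the letters before a marked one. -/
def iota (M : Mould P T K) : Mould P T K :=
  fun w q => (-1) ^ w.length * M (revWord w q) (head w q)

theorem iota_apply (M : Mould P T K) (w q) :
    iota M w q = (-1) ^ w.length * M (revWord w q) (head w q) := rfl

@[simp] theorem iota_nil (M : Mould P T K) (q) : iota M [] q = M [] q := by
  simp [iota_apply, revWord, head]

theorem iota_iota (M : Mould P T K) : iota (iota M) = M := by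
  ext w q
  rw [iota_apply, iota_apply, length_revWord, ← mul_assoc, ← mul_pow, revWord_revWord,
    head_revWord]
  simp

theorem iota_add (A B : Mould P T K) : iota (A + B) = iota A + iota B := by
  ext w q; simp [iota_apply, mul_add]

theorem iota_zero : iota (0 : Mould P T K) = 0 := by
  ext w q; simp [iota_apply]

theorem iota_neg (A : Mould P T K) : iota (-A) = -iota A := by
  ext w q; simp [iota_apply]

theorem iota_cst (f : P → K) : iota (cst f : Mould P T K) = cst f := by
  ext w q
  cases w with
  | nil => simp
  | cons x w =>
    rw [iota_apply]
    rcases h : revWord (x :: w) q with _ | ⟨y, l⟩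
    · simp [revWord] at h
    · simp

theorem iota_one : iota (1 : Mould P T K) = 1 := iota_cst 1

theorem iota_mul (A B : Mould P T K) : iota (A * B) = iota B * iota A := by
  ext w q
  rw [iota_apply, mul_apply, mul_apply, Finset.mul_sum, ← Finset.sum_range_reflect,
    length_revWord]
  refine Finset.sum_congr rfl fun m hm => ?_
  have hm : m ≤ w.length := by simpa [Nat.lt_succ_iff] using hm
  simp only [add_tsub_cancel_right]
  obtain ⟨u, v, rfl, rfl⟩ : ∃ u v, w = u ++ v ∧ u.length = m :=
    ⟨w.take m, w.drop m, (List.take_append_drop m w).symm, by simp [hm]⟩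
  have hl : (u ++ v).length - u.length = (revWord v q).length := by simp
  rw [hl, revWord_append, List.take_left, List.drop_left, List.take_left, List.drop_left,
    head_append, head_revWord, iota_apply, iota_apply, List.length_append, pow_add]
  ring

theorem iota_letter [DecidableEq T] (s : T) :
    iota (letter s : Mould P T K) = -letter (-s) := by
  ext w q
  rw [iota_apply]
  match w with
  | [] => simp [revWord]
  | [x] => by_cases h : x.2 = -s <;> simp [letter, revWord, neg_eq_iff_eq_neg, h]
  | x :: y :: w =>
    rcases h : revWord (x :: y :: w) q with _ | ⟨z, _ | ⟨z', l⟩⟩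
    · simp [letter]
    · have := congrArg List.length h
      simp at this
    · simp [letter]

theorem iota_shift (s : T) (M : Mould P T K) : iota (shift s M) = shift (-s) (iota M) := by
  ext w q
  rw [iota_apply, shift_apply, shift_apply, iota_apply, revWord_shiftWord, neg_neg,
    head_shiftWord]
  simp [shiftWord]

theorem iota_conj (E : Chars P T K) (s : T) (M : Mould P T K) :
    iota (conj E s M) = conj E (-s) (iota M) := by
  ext w q
  rw [iota_apply, conj_apply, conj_apply, iota_apply, head_revWord, neg_neg]
  ring

end Mould

namespace SubstData

open Mould

variable {P T K : Type*} [CommRing K] [AddCommGroup T] [DecidableEq T]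

theorem iota_block (D : SubstData P T K) (hD : D.N = iota D.F) (s : T) :
    iota (D.block s) = -D.block (-s) := by
  rw [block, iota_conj, iota_shift, iota_mul, iota_mul, iota_letter, hD, iota_iota, neg_zero,
    block, hD, neg_mul, mul_neg, map_neg, map_neg, mul_assoc]

/-- The conjugate of a substitution by the reversal. -/
def gaxIota (D : SubstData P T K) : Mould P T K →+* Mould P T K where
  toFun M := iota (D.gax (iota M))
  map_one' := by rw [iota_one, map_one, iota_one]
  map_mul' A B := by rw [iota_mul, map_mul, iota_mul]
  map_zero' := by rw [iota_zero, map_zero, iota_zero]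
  map_add' A B := by rw [iota_add, map_add, iota_add]

theorem gaxIota_apply (D : SubstData P T K) (M : Mould P T K) :
    D.gaxIota M = iota (D.gax (iota M)) := rfl

/-- Substitutions whose two moulds are exchanged by the reversal commute with it. -/
theorem gax_iota (D : SubstData P T K) (hD : D.N = iota D.F) (M : Mould P T K) :
    D.gax (iota M) = iota (D.gax M) := by
  have hloc : Local D.gaxIota := by
    classical
    intro w q
    obtain ⟨U, hU⟩ := D.gax_local (revWord w q) (head w q)
    refine ⟨U.image fun u => (revWord u.1 u.2, head u.1 u.2), fun M M' h => ?_⟩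
    rw [gaxIota_apply, gaxIota_apply, iota_apply, iota_apply]
    congr 1
    refine hU _ _ fun u hu => ?_
    rw [iota_apply, iota_apply, h _ (Finset.mem_image.2 ⟨u, hu, rfl⟩)]
  have := ringHom_unique (H := D.gax) (H' := D.gaxIota) D.gax_local hloc
    (fun f => gax_cst _ f) (fun f => by rw [gaxIota_apply, iota_cst, gax_cst, iota_cst])
    (fun s => by
      rw [gaxIota_apply, iota_letter, map_neg, gax_letter, iota_neg, gax_letter, D.iota_block hD,
        neg_neg, neg_neg])
    (fun s q => by rw [gax_letter, block_nil])
  have e : D.gax M = iota (D.gax (iota M)) := congrArg (fun H => H M) this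
  rw [e, iota_iota]

theorem comp_N_eq_iota (D₁ D₂ : SubstData P T K) (h₁ : D₁.N = iota D₁.F) (h₂ : D₂.N = iota D₂.F) :
    (D₁.comp D₂).N = iota (D₁.comp D₂).F := by
  change D₂.gax D₁.N * D₂.N = iota (D₂.F * D₂.gax D₁.F)
  rw [iota_mul, h₁, gax_iota _ h₂, h₂]

end SubstData

/-! ### Substitutions as sums over chains of indices -/

section Chains

open Mould SubstData

theorem sum_fin_cons {X A : Type*} [Fintype X] [AddCommMonoid A] {n : ℕ}
    (f : (Fin (n + 1) → X) → A) :
    ∑ I, f I = ∑ x, ∑ I : Fin n → X, f (Fin.cons x I) := by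
  rw [← (Fin.consEquiv fun _ : Fin (n + 1) => X).sum_comp, Fintype.sum_prod_type]
  rfl

variable {P T K : Type*}

/-- The word with the letters `(c r, τ r)` for `i ≤ r < j`. -/
def seg (c : ℕ → P) (τ : ℕ → T) (i j : ℕ) : List (P × T) :=
  (List.range' i (j - i)).map fun r => (c r, τ r)

@[simp] theorem length_seg (c : ℕ → P) (τ : ℕ → T) (i j : ℕ) : (seg c τ i j).length = j - i := by
  simp [seg]

theorem seg_self (c : ℕ → P) (τ : ℕ → T) {i j : ℕ} (h : j ≤ i) : seg c τ i j = [] := by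
  simp [seg, Nat.sub_eq_zero_of_le h]

theorem seg_cons (c : ℕ → P) (τ : ℕ → T) {i j : ℕ} (h : i < j) :
    seg c τ i j = (c i, τ i) :: seg c τ (i + 1) j := by
  obtain ⟨k, rfl⟩ : ∃ k, j = i + (k + 1) := ⟨j - i - 1, by omega⟩
  have h1 : i + (k + 1) - i = k + 1 := by omega
  have h2 : i + (k + 1) - (i + 1) = k := by omega
  simp [seg, h1, h2, List.range'_succ]

theorem head_seg (c : ℕ → P) (τ : ℕ → T) {i j : ℕ} (h : i ≤ j) : head (seg c τ i j) (c j) = c i := by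
  rcases h.eq_or_lt with rfl | h
  · rw [seg_self c τ le_rfl]; rfl
  · rw [seg_cons c τ h]; rfl

theorem shiftWord_seg [AddCommGroup T] (s : T) (c : ℕ → P) (τ : ℕ → T) (i j : ℕ) :
    shiftWord s (seg c τ i j) = seg c (fun r => τ r - s) i j := by
  simp [shiftWord, seg]

variable [CommRing K]

theorem mul_seg (A B : Mould P T K) (c : ℕ → P) (τ : ℕ → T) {i j : ℕ} (h : i ≤ j) :
    (A * B) (seg c τ i j) (c j) =
      ∑ m ∈ Finset.Icc i j, A (seg c τ i m) (c m) * B (seg c τ m j) (c j) := by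
  induction h using Nat.decreasingInduction generalizing A with
  | self => simp [seg_self c τ le_rfl]
  | of_succ i h ih =>
    have h : i < j := h
    rw [seg_cons c τ h, mul_cons, ih, ← Finset.add_sum_Ioc_eq_sum_Icc h.le,
      seg_self c τ (le_refl i), seg_cons c τ h]
    congr 1
    refine Finset.sum_congr (by ext; simp) fun m hm => ?_
    rw [seg_cons c τ (i := i) (j := m) (Finset.mem_Ioc.1 hm).1, tail_apply]

theorem mul_letter_mul_seg [DecidableEq T] (N F : Mould P T K) (s : T) (c : ℕ → P) (τ : ℕ → T) {i j : ℕ}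
    (h : i ≤ j) : (N * (letter s : Mould P T K) * F) (seg c τ i j) (c j) =
      ∑ m ∈ Finset.Ico i j,
        if τ m = s then N (seg c τ i m) (c m) * F (seg c τ (m + 1) j) (c j) else 0 := by
  rw [mul_assoc, mul_seg _ _ _ _ h, ← Finset.sum_Ico_add_eq_sum_Icc h, seg_self c τ (le_refl j)]
  simp only [mul_nil, letter_nil, zero_mul, mul_zero, add_zero]
  refine Finset.sum_congr rfl fun m hm => ?_
  rw [seg_cons c τ (Finset.mem_Ico.1 hm).2, mul_cons, tail_letter]
  by_cases hs : τ m = s <;> simp [hs]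

variable [AddCommGroup T]

namespace SubstData

/-- The contribution of the block `i, …, i' - 1` with marked letter `j`. -/
def blockTerm (D : SubstData P T K) (c : ℕ → P) (τ : ℕ → T) (i j i' : ℕ) : K :=
  ev D.E (-τ j) (c i) * ev D.E (τ j) (c i') *
    (D.N (shiftWord (τ j) (seg c τ i j)) (c j) *
      D.F (shiftWord (τ j) (seg c τ (j + 1) i')) (c i'))

/-- The sum over the chains `i = i_0 ≤ j_0 < i_1 ≤ ⋯ ≤ j_{k-1} < i_k = e`. -/
def chainSum (D : SubstData P T K) (c : ℕ → P) (τ : ℕ → T) (e k : ℕ) (i : Fin (e + 1))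
    (M : Mould P T K) : K :=
  ∑ I : Fin (k + 1) → Fin (e + 1), ∑ J : Fin k → Fin (e + 1),
    if I 0 = i ∧ I (Fin.last k) = Fin.last e ∧ ∀ α, I α.castSucc ≤ J α ∧ J α < I α.succ then
      (∏ α, D.blockTerm c τ (I α.castSucc) (J α) (I α.succ)) *
        M (List.ofFn fun α => (c (I α.castSucc), τ (J α))) (c e) else 0

theorem chainSum_zero (D : SubstData P T K) (c : ℕ → P) (τ : ℕ → T) (e : ℕ) (i : Fin (e + 1))
    (M : Mould P T K) : D.chainSum c τ e 0 i M = if i = Fin.last e then M [] (c e) else 0 := by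
  have h : ∀ f : (Fin 0 → Fin (e + 1)) → K, ∑ J, f J = f Fin.elim0 := fun f => by
    rw [Fintype.sum_unique]; congr
  rw [chainSum, sum_fin_cons]
  simp only [h]
  rw [Finset.sum_eq_single i]
  · simp
  · intro x _ hx; simp [hx]
  · simp

theorem chainSum_succ (D : SubstData P T K) (c : ℕ → P) (τ : ℕ → T) (e k : ℕ) (i : Fin (e + 1))
    (M : Mould P T K) : D.chainSum c τ e (k + 1) i M =
      ∑ i' : Fin (e + 1), ∑ j : Fin (e + 1), if (i : ℕ) ≤ j ∧ j < i' then
        D.blockTerm c τ i j i' * D.chainSum c τ e k i' (M.tail (c i, τ j)) else 0 := by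
  rw [chainSum, sum_fin_cons, Finset.sum_eq_single i]
  · have h : ∀ i' j : Fin (e + 1), (if (i : ℕ) ≤ j ∧ j < i' then
        D.blockTerm c τ i j i' * D.chainSum c τ e k i' (M.tail (c i, τ j)) else 0) =
      ∑ I : Fin (k + 1) → Fin (e + 1), if I 0 = i' then ∑ J : Fin k → Fin (e + 1),
        if (i ≤ j ∧ j < I 0) ∧ I (Fin.last k) = Fin.last e ∧
          ∀ α, I α.castSucc ≤ J α ∧ J α < I α.succ then
        D.blockTerm c τ i j (I 0) * ((∏ α, D.blockTerm c τ (I α.castSucc) (J α) (I α.succ)) *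
          M ((c i, τ j) :: List.ofFn fun α => (c (I α.castSucc), τ (J α))) (c e)) else 0
        else 0 := by
      intro i' j
      by_cases hj : (i : ℕ) ≤ j ∧ j < i'
      · rw [if_pos hj, chainSum, Finset.mul_sum]
        refine Finset.sum_congr rfl fun I _ => ?_
        by_cases hI : I 0 = i'
        · subst hI
          rw [if_pos rfl, Finset.mul_sum]
          refine Finset.sum_congr rfl fun J _ => ?_
          have hj' : i ≤ j ∧ j < I 0 := hj
          simp only [hj', true_and, mul_ite, mul_zero, tail_apply, and_self]
        · rw [if_neg hI, Finset.sum_eq_zero, mul_zero]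
          intro J _; simp [hI]
      · rw [if_neg hj, Finset.sum_eq_zero]
        intro I _
        by_cases hI : I 0 = i'
        · subst hI
          rw [if_pos rfl, Finset.sum_eq_zero]
          intro J _
          rw [if_neg]
          exact fun h => hj h.1
        · rw [if_neg hI]
    simp only [h]
    have : ∀ f : Fin (e + 1) → (Fin (k + 1) → Fin (e + 1)) → K,
        ∑ i', ∑ j, ∑ I : Fin (k + 1) → Fin (e + 1), (if I 0 = i' then f j I else 0) =
          ∑ I : Fin (k + 1) → Fin (e + 1), ∑ j, f j I := by
      intro f
      rw [Finset.sum_congr rfl fun i' _ => Finset.sum_comm, Finset.sum_comm]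
      refine Finset.sum_congr rfl fun I _ => ?_
      rw [Finset.sum_comm]
      refine Finset.sum_congr rfl fun j _ => ?_
      simp
    rw [this]
    refine Finset.sum_congr rfl fun I _ => ?_
    rw [sum_fin_cons]
    refine Finset.sum_congr rfl fun j _ => Finset.sum_congr rfl fun J _ => ?_
    refine if_congr ?_ ?_ rfl
    · rw [Fin.forall_fin_succ, ← Fin.succ_last]
      simp only [Fin.cons_zero, Fin.cons_succ, Fin.castSucc_zero, true_and,
        ← Fin.succ_castSucc]
      tauto
    · rw [Fin.prod_univ_succ, List.ofFn_succ]
      simp only [Fin.cons_zero, Fin.cons_succ, Fin.castSucc_zero, ← Fin.succ_castSucc, mul_assoc]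
  · intro x _ hx
    refine Finset.sum_eq_zero fun I _ => Finset.sum_eq_zero fun J _ => ?_
    rw [if_neg]
    exact fun h => hx h.1
  · simp

variable [DecidableEq T]

theorem block_seg (D : SubstData P T K) (s : T) (c : ℕ → P) (τ : ℕ → T) {i i' : ℕ} (h : i ≤ i') :
    D.block s (seg c τ i i') (c i') =
      ∑ j ∈ Finset.Ico i i', if τ j = s then D.blockTerm c τ i j i' else 0 := by
  rw [block, conj_apply, head_seg c τ h, shift_apply, shiftWord_seg,
    mul_letter_mul_seg _ _ _ _ _ h, Finset.mul_sum, Finset.sum_mul]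
  refine Finset.sum_congr rfl fun j _ => ?_
  by_cases hs : τ j = s
  · subst hs
    simp only [sub_self, if_true, blockTerm, shiftWord_seg]
    ring
  · simp [hs, sub_eq_zero]

theorem gax_seg (D : SubstData P T K) (M : Mould P T K) (c : ℕ → P) (τ : ℕ → T) {i e : ℕ}
    (h : i < e) : D.gax M (seg c τ i e) (c e) =
      ∑ i' : Fin (e + 1), ∑ j : Fin (e + 1), if i ≤ j ∧ j < i' then
        D.blockTerm c τ i j i' * D.gax (M.tail (c i, τ j)) (seg c τ i' e) (c e) else 0 := by
  have key : ∀ s, (D.block s * D.gax (M.tail (c i, s))) (seg c τ i e) (c e) =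
      ∑ i' : Fin (e + 1), ∑ j : Fin (e + 1), if i ≤ j ∧ j < i' then
        if s = τ j then
        D.blockTerm c τ i j i' * D.gax (M.tail (c i, τ j)) (seg c τ i' e) (c e) else 0 else 0 := by
    intro s
    rw [mul_seg _ _ _ _ h.le]
    have e1 : Finset.Icc i e = (Finset.range (e + 1)).filter (i ≤ ·) := by
      ext; simp; omega
    rw [e1, Finset.sum_filter, ← Fin.sum_univ_eq_sum_range (fun m => if i ≤ m then
      D.block s (seg c τ i m) (c m) * D.gax (M.tail (c i, s)) (seg c τ m e) (c e) else 0)]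
    refine Finset.sum_congr rfl fun i' _ => ?_
    by_cases hi : i ≤ i'
    · rw [if_pos hi, block_seg _ _ _ _ hi, Finset.sum_mul]
      have e2 : Finset.Ico i (i' : ℕ) =
          (Finset.range (e + 1)).filter (fun j => i ≤ j ∧ j < i') := by
        ext; simp; omega
      rw [e2, Finset.sum_filter, ← Fin.sum_univ_eq_sum_range (fun j => if i ≤ j ∧ j < i' then
        (if τ j = s then D.blockTerm c τ i j i' else 0) *
          D.gax (M.tail (c i, s)) (seg c τ i' e) (c e) else 0)]
      refine Finset.sum_congr rfl fun j _ => ?_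
      by_cases hs : τ j = s
      · subst hs; simp
      · simp [hs, Ne.symm hs]
    · rw [if_neg hi, Finset.sum_eq_zero]
      intro j _
      rw [if_neg]
      rintro ⟨h1, h2⟩
      have h2 : (j : ℕ) < i' := h2
      omega
  have hv : ∀ j, i ≤ j → j < e → τ j ∈ vars (seg c τ i e) := fun j h1 h2 => by
    refine mem_vars.2 ⟨(c j, τ j), ?_, rfl⟩
    simp only [seg, List.mem_map, List.mem_range']
    exact ⟨j, ⟨j - i, by omega, by omega⟩, rfl⟩
  have e3 : D.gax M (seg c τ i e) (c e) = ∑ s ∈ vars (seg c τ i e),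
      (D.block s * D.gax (M.tail (c i, s))) (seg c τ i e) (c e) := by
    rw [seg_cons c τ h, gax_cons]
  rw [e3, Finset.sum_congr rfl fun s _ => key s, Finset.sum_comm]
  refine Finset.sum_congr rfl fun i' _ => ?_
  rw [Finset.sum_comm]
  refine Finset.sum_congr rfl fun j _ => ?_
  by_cases hj : i ≤ j ∧ j < i'
  · simp only [if_pos hj]
    rw [Finset.sum_ite_eq' (vars (seg c τ i e)) (τ j), if_pos]
    refine hv j hj.1 ?_
    have h2 : (j : ℕ) < i' := hj.2
    have := i'.2
    omega
  · simp [hj]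

theorem gax_eq_sum_chainSum (D : SubstData P T K) (c : ℕ → P) (τ : ℕ → T) (e : ℕ) :
    ∀ n (i : Fin (e + 1)) (M : Mould P T K), e - i < n →
      D.gax M (seg c τ i e) (c e) = ∑ k ∈ Finset.range n, D.chainSum c τ e k i M := by
  intro n
  induction n with
  | zero => intro i M h; omega
  | succ n ih =>
    intro i M h
    rw [Finset.sum_range_succ', chainSum_zero]
    simp only [chainSum_succ]
    by_cases hi : i = Fin.last e
    · subst hi
      rw [Finset.sum_eq_zero, if_pos rfl, zero_add]
      · simp only [Fin.val_last]
        rw [seg_self c τ le_rfl, gax_nil]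
      · intro k _
        refine Finset.sum_eq_zero fun i' _ => Finset.sum_eq_zero fun j _ => ?_
        rw [if_neg]
        rintro ⟨h1, h2⟩
        have h2 : (j : ℕ) < i' := h2
        have := i'.2
        simp at h1
        omega
    · have hi' : (i : ℕ) < e := by
        have := i.2
        have h3 : (i : ℕ) ≠ e := fun h => hi (Fin.ext h)
        omega
      rw [if_neg hi, add_zero, gax_seg _ _ _ _ hi']
      refine Eq.trans ?_ Finset.sum_comm
      refine Finset.sum_congr rfl fun i' _ => ?_
      refine Eq.trans ?_ Finset.sum_comm
      refine Finset.sum_congr rfl fun j _ => ?_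
      by_cases hj : (i : ℕ) ≤ j ∧ j < i'
      · simp only [if_pos hj]
        have h2 : (j : ℕ) < i' := hj.2
        rw [ih _ _ (by omega), Finset.mul_sum]
      · simp only [if_neg hj, Finset.sum_const_zero]

/-- The product formula in the form in which the coproduct is given: the sum over the index set
`0 = i_0 = j_0 < i_1 ≤ j_1 < ⋯ < i_k ≤ j_k < i_{k+1} = d + 1`. -/
theorem mul_gax_eq_sum (D : SubstData P T K) (A M : Mould P T K) (c : ℕ → P) (τ : ℕ → T) (d : ℕ)
    [∀ k (I : Fin (k + 2) → Fin (d + 2)) (J : Fin (k + 1) → Fin (d + 2)),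
      Decidable (Admissible I J)] :
    (A * D.gax M) (seg c τ 1 (d + 1)) (c (d + 1)) =
      ∑ k ∈ Finset.range (d + 1), ∑ I : Fin (k + 2) → Fin (d + 2),
        ∑ J : Fin (k + 1) → Fin (d + 2), if Admissible I J then
          A (seg c τ 1 (I 1)) (c (I 1)) *
          (∏ α : Fin k, D.blockTerm c τ (I α.succ.castSucc) (J α.succ) (I α.succ.succ)) *
          M (List.ofFn fun α : Fin k => (c (I α.succ.castSucc), τ (J α.succ))) (c (d + 1))
        else 0 := by
  have h1 : ∀ k (I : Fin (k + 1) → Fin (d + 2)) (J : Fin k → Fin (d + 2)) (x y : Fin (d + 2)),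
      Admissible (Fin.cons x I : Fin (k + 2) → Fin (d + 2)) (Fin.cons y J) ↔
        x = 0 ∧ y = 0 ∧ (0 < I 0) ∧ I (Fin.last k) = Fin.last (d + 1) ∧
          ∀ α, I α.castSucc ≤ J α ∧ J α < I α.succ := by
    intro k I J x y
    rw [Admissible, Fin.forall_fin_succ, ← Fin.succ_last]
    simp only [Fin.cons_zero, Fin.cons_succ, Fin.castSucc_zero, ← Fin.succ_castSucc]
    constructor
    · rintro ⟨rfl, rfl, h3, h4, h5⟩
      exact ⟨rfl, rfl, h4.2, h3, h5⟩
    · rintro ⟨rfl, rfl, h4, h3, h5⟩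
      exact ⟨rfl, rfl, h3, ⟨le_rfl, h4⟩, h5⟩
  rw [mul_seg _ _ _ _ (by omega)]
  have e1 : Finset.Icc 1 (d + 1) = (Finset.range (d + 2)).filter (0 < ·) := by
    ext; simp; omega
  rw [e1, Finset.sum_filter, ← Fin.sum_univ_eq_sum_range (fun m => if 0 < m then
    A (seg c τ 1 m) (c m) * D.gax M (seg c τ m (d + 1)) (c (d + 1)) else 0)]
  have h2 : ∀ i : Fin (d + 2), (if 0 < (i : ℕ) then
      A (seg c τ 1 i) (c i) * D.gax M (seg c τ i (d + 1)) (c (d + 1)) else 0) =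
      ∑ k ∈ Finset.range (d + 1), if 0 < (i : ℕ) then
        A (seg c τ 1 i) (c i) * D.chainSum c τ (d + 1) k i M else 0 := by
    intro i
    by_cases hi : 0 < (i : ℕ)
    · simp only [if_pos hi]
      rw [D.gax_eq_sum_chainSum c τ (d + 1) (d + 1) i M (by omega), Finset.mul_sum]
    · simp [hi]
  simp only [h2]
  rw [Finset.sum_comm]
  refine Finset.sum_congr rfl fun k _ => ?_
  rw [sum_fin_cons]
  refine Eq.trans ?_ (Finset.sum_eq_single 0 (fun x _ hx => Finset.sum_eq_zero fun I _ =>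
    Finset.sum_eq_zero fun J _ => if_neg fun h => hx h.1) (by simp)).symm
  have h3 : ∀ i : Fin (d + 2), (if 0 < (i : ℕ) then
      A (seg c τ 1 i) (c i) * D.chainSum c τ (d + 1) k i M else 0) =
      ∑ I : Fin (k + 1) → Fin (d + 2), if I 0 = i then ∑ J : Fin k → Fin (d + 2),
        if 0 < I 0 ∧ I (Fin.last k) = Fin.last (d + 1) ∧
          ∀ α, I α.castSucc ≤ J α ∧ J α < I α.succ then
        A (seg c τ 1 (I 0)) (c (I 0)) *
          (∏ α, D.blockTerm c τ (I α.castSucc) (J α) (I α.succ)) *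
          M (List.ofFn fun α => (c (I α.castSucc), τ (J α))) (c (d + 1)) else 0 else 0 := by
    intro i
    by_cases hi : 0 < (i : ℕ)
    · rw [if_pos hi, chainSum, Finset.mul_sum]
      refine Finset.sum_congr rfl fun I _ => ?_
      by_cases hI : I 0 = i
      · subst hI
        rw [if_pos rfl, Finset.mul_sum]
        refine Finset.sum_congr rfl fun J _ => ?_
        have hi' : 0 < I 0 := hi
        simp only [hi', true_and, mul_ite, mul_zero, mul_assoc]
      · rw [if_neg hI, Finset.sum_eq_zero, mul_zero]
        intro J _; simp [hI]
    · rw [if_neg hi, Finset.sum_eq_zero]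
      intro I _
      by_cases hI : I 0 = i
      · subst hI
        rw [if_pos rfl, Finset.sum_eq_zero]
        intro J _
        rw [if_neg]
        exact fun h => hi h.1
      · rw [if_neg hI]
  simp only [h3]
  rw [Finset.sum_comm]
  refine Finset.sum_congr rfl fun I _ => ?_
  rw [Finset.sum_ite_eq, if_pos (Finset.mem_univ _), sum_fin_cons]
  refine Eq.trans ?_ (Finset.sum_eq_single 0 (fun x _ hx => Finset.sum_eq_zero fun J _ =>
    if_neg fun h => hx ((h1 _ _ _ _ _).1 h).2.1) (by simp)).symm
  refine Finset.sum_congr rfl fun J _ => ?_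
  refine if_congr ?_ ?_ rfl
  · rw [h1]; tauto
  · simp only [← Fin.succ_castSucc, Fin.cons_succ]
    rfl

end SubstData

end Chains

/-! ### Exponentials and substitution of power series -/

section Exponential

variable {R : Type*} [CommRing R] {σ : Type*}

/-- The ideal of the power series all of whose terms have degree greater than `N`. -/
def highIdeal (σ R : Type*) [CommRing R] (N : ℕ) : Ideal (MvPowerSeries σ R) where
  carrier := {f | ((N + 1 : ℕ) : ℕ∞) ≤ f.order}
  add_mem' {f g} hf hg := le_trans (le_min hf hg) MvPowerSeries.min_order_le_add
  zero_mem' := by simp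
  smul_mem' c f hf := le_trans (le_trans hf le_add_self) MvPowerSeries.le_order_mul

theorem coeff_eq_of_sub_mem {N : ℕ} {f g : MvPowerSeries σ R} (h : f - g ∈ highIdeal σ R N)
    {e : σ →₀ ℕ} (he : e.degree ≤ N) : f.coeff e = g.coeff e := by
  have : (f - g).coeff e = 0 := MvPowerSeries.coeff_of_lt_order
    (lt_of_lt_of_le (by exact_mod_cast Nat.lt_succ_of_le he) h)
  rwa [map_sub, sub_eq_zero] at this

theorem pow_mem_highIdeal {s : MvPowerSeries σ R} (hs : s.constantCoeff = 0) (N : ℕ) :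
    s ^ (N + 1) ∈ highIdeal σ R N :=
  MvPowerSeries.le_order_pow_of_constantCoeff_eq_zero (N + 1) hs

variable [Algebra ℚ R]

/-- `exp s` for a power series `s` without constant term. -/
def expS (s : MvPowerSeries σ R) : MvPowerSeries σ R := PowerSeries.subst s (PowerSeries.exp ℚ)

theorem expSeries_eq {d : ℕ} (c : R) (s : MvPowerSeries (Fin d) R) :
    expSeries c s = expS (MvPowerSeries.C c * s) := rfl

theorem expS_zero : expS (0 : MvPowerSeries σ R) = 1 := by
  rw [expS, PowerSeries.subst_zero_eq_C_constantCoeff]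
  simp

theorem expS_eq_subst_exp {s : MvPowerSeries σ R} (hs : s.constantCoeff = 0) :
    expS s = PowerSeries.subst s (PowerSeries.exp R) := by
  have h := PowerSeries.HasSubst.of_constantCoeff_zero hs
  ext e
  rw [expS, PowerSeries.coeff_subst h, PowerSeries.coeff_subst h]
  refine finsum_congr fun n => ?_
  rw [PowerSeries.coeff_exp, PowerSeries.coeff_exp, algebraMap_smul]
  simp [Algebra.smul_def]

theorem map_expS {S : Type*} [CommRing S] [Algebra ℚ S] (f : R →+* S) {s : MvPowerSeries σ R}
    (hs : s.constantCoeff = 0) : MvPowerSeries.map f (expS s) = expS (MvPowerSeries.map f s) := by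
  rw [expS_eq_subst_exp hs, expS_eq_subst_exp (by
    rw [← MvPowerSeries.coeff_zero_eq_constantCoeff_apply, MvPowerSeries.coeff_map,
      MvPowerSeries.coeff_zero_eq_constantCoeff_apply, hs, map_zero]),
    PowerSeries.map_subst (PowerSeries.HasSubst.of_constantCoeff_zero hs), PowerSeries.map_exp]

theorem subst_expS {τ : Type*} {a : σ → MvPowerSeries τ R} (ha : MvPowerSeries.HasSubst a)
    {s : MvPowerSeries σ R} (hs : s.constantCoeff = 0) :
    MvPowerSeries.subst a (expS s) = expS (MvPowerSeries.subst a s) := by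
  rw [expS, expS, PowerSeries.subst_def, PowerSeries.subst_def,
    MvPowerSeries.subst_comp_subst_apply _ ha]
  exact (PowerSeries.HasSubst.of_constantCoeff_zero hs).const

/-- Modulo terms of high degree, `expS s` is the exponential of a nilpotent element. -/
theorem mk_expS {s : MvPowerSeries σ R} (hs : s.constantCoeff = 0) (N : ℕ) :
    Ideal.Quotient.mk (highIdeal σ R N) (expS s) =
      IsNilpotent.exp (Ideal.Quotient.mk (highIdeal σ R N) s) := by
  have hn : (Ideal.Quotient.mk (highIdeal σ R N) s) ^ (N + 1) = 0 := by
    rw [← map_pow, Ideal.Quotient.eq_zero_iff_mem]; exact pow_mem_highIdeal hs N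
  have h := PowerSeries.HasSubst.of_constantCoeff_zero hs
  rw [IsNilpotent.exp_eq_sum hn]
  have e1 : ∑ i ∈ Finset.range (N + 1), (i.factorial : ℚ)⁻¹ •
      (Ideal.Quotient.mk (highIdeal σ R N) s) ^ i = Ideal.Quotient.mk (highIdeal σ R N)
        (∑ i ∈ Finset.range (N + 1), (i.factorial : ℚ)⁻¹ • s ^ i) := by
    rw [map_sum]
    refine Finset.sum_congr rfl fun i _ => ?_
    rw [← map_pow]
    exact (map_rat_smul (Ideal.Quotient.mk (highIdeal σ R N)) _ _).symm
  rw [e1, Ideal.Quotient.eq]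
  refine MvPowerSeries.nat_le_order fun e he => ?_
  rw [map_sub, sub_eq_zero, expS, PowerSeries.coeff_subst h,
    finsum_eq_sum_of_support_subset (s := Finset.range (N + 1))]
  · rw [map_sum]
    refine Finset.sum_congr rfl fun i _ => ?_
    rw [PowerSeries.coeff_exp]
    simp only [one_div, Algebra.algebraMap_self, RingHom.id_apply]
    exact (map_rat_smul (MvPowerSeries.coeff e) _ _).symm
  · intro i hi
    by_contra hi'
    refine hi ?_
    have hi' : N + 1 ≤ i := by simpa using hi'
    have : (s ^ i).coeff e = 0 := by
      refine MvPowerSeries.coeff_of_lt_order (lt_of_lt_of_le ?_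
        (MvPowerSeries.le_order_pow_of_constantCoeff_eq_zero i hs))
      exact_mod_cast lt_of_lt_of_le he hi'
    simp only [this, smul_zero]

theorem expS_add {s t : MvPowerSeries σ R} (hs : s.constantCoeff = 0) (ht : t.constantCoeff = 0) :
    expS (s + t) = expS s * expS t := by
  ext e
  refine coeff_eq_of_sub_mem (N := e.degree) ?_ le_rfl
  have hn : ∀ {u : MvPowerSeries σ R}, u.constantCoeff = 0 →
      IsNilpotent (Ideal.Quotient.mk (highIdeal σ R e.degree) u) := fun hu =>
    ⟨e.degree + 1, by
      rw [← map_pow, Ideal.Quotient.eq_zero_iff_mem]; exact pow_mem_highIdeal hu _⟩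
  rw [← Ideal.Quotient.eq, map_mul, mk_expS (by rw [map_add, hs, ht, add_zero]), mk_expS hs,
    mk_expS ht, map_add, IsNilpotent.exp_add_of_commute (Commute.all _ _) (hn hs) (hn ht)]

end Exponential

section Subst

variable {R : Type*} [CommRing R]

theorem constantCoeff_map_eq_zero {σ S : Type*} [CommRing S] (f : R →+* S) {s : MvPowerSeries σ R}
    (hs : s.constantCoeff = 0) : (MvPowerSeries.map f s).constantCoeff = 0 := by
  rw [MvPowerSeries.constantCoeff_map, hs, map_zero]

theorem constantCoeff_tVar (d r : ℕ) :
    (tVar d r : MvPowerSeries (Fin d) R).constantCoeff = 0 := by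
  rw [tVar]; split_ifs <;> simp

theorem tVar_zero (d : ℕ) : (tVar d 0 : MvPowerSeries (Fin d) R) = 0 := by
  rw [tVar, dif_neg (by omega)]

theorem map_tVar {S : Type*} [CommRing S] (f : R →+* S) (d r : ℕ) :
    MvPowerSeries.map f (tVar d r : MvPowerSeries (Fin d) R) = tVar d r := by
  rw [tVar, tVar]; split_ifs <;> simp

theorem subst_tVar {n d : ℕ} {s : Fin d → MvPowerSeries (Fin n) R}
    (hs : ∀ a, (s a).constantCoeff = 0) (r : ℕ) :
    MvPowerSeries.subst s (tVar d r : MvPowerSeries (Fin d) R) =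
      if h : 1 ≤ r ∧ r ≤ d then s ⟨r - 1, by omega⟩ else 0 := by
  have hs' := MvPowerSeries.hasSubst_of_constantCoeff_zero hs
  rw [tVar]
  split_ifs with h
  · rw [MvPowerSeries.subst_X hs']
  · rw [← MvPowerSeries.coe_substAlgHom hs', map_zero]

/-- Substitution as a ring homomorphism. -/
def substHom {n d : ℕ} (s : Fin d → MvPowerSeries (Fin n) R) (hs : ∀ a, (s a).constantCoeff = 0) :
    MvPowerSeries (Fin d) R →+* MvPowerSeries (Fin n) R :=
  (MvPowerSeries.substAlgHom (R := R)
    (MvPowerSeries.hasSubst_of_constantCoeff_zero hs)).toRingHom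

theorem substHom_apply {n d : ℕ} (s : Fin d → MvPowerSeries (Fin n) R)
    (hs : ∀ a, (s a).constantCoeff = 0) (f : MvPowerSeries (Fin d) R) :
    substHom s hs f = MvPowerSeries.subst s f :=
  congrFun (MvPowerSeries.coe_substAlgHom (MvPowerSeries.hasSubst_of_constantCoeff_zero hs)) f

end Subst

/-! ### The moulds of a point of the auxiliary algebra -/

open Mould

section Points

variable {R : Type*} [CommRing R] {n : ℕ} {L : Type*} [CommRing L]

/-- The power series without constant term, the possible values of the variables `t_r`. -/
def Zc (n : ℕ) (R : Type*) [CommRing R] : AddSubgroup (MvPowerSeries (Fin n) R) :=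
  (MvPowerSeries.constantCoeff (σ := Fin n) (R := R)).toAddMonoidHom.ker

instance : DecidableEq (Zc n R) := Classical.decEq _

theorem constantCoeff_coe_zc (s : Zc n R) : (s : MvPowerSeries (Fin n) R).constantCoeff = 0 :=
  s.2

theorem revWord_seg (c : ℕ → ℕ+) (τ : ℕ → Zc n R) {i j : ℕ} (h : i ≤ j) :
    revWord (seg c τ i j) (c j) = (List.range (j - i)).map fun a => (c (j - a), -τ (j - 1 - a)) := by
  induction h using Nat.decreasingInduction with
  | self => rw [seg_self c τ le_rfl]; simp [revWord]
  | of_succ i h ih =>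
    have h : i < j := h
    have e : j - i = (j - (i + 1)) + 1 := by omega
    rw [seg_cons c τ h, revWord, ih, e, List.range_succ, List.map_append, head_seg c τ h]
    have e1 : j - (j - (i + 1)) = i + 1 := by omega
    have e2 : j - 1 - (j - (i + 1)) = i := by omega
    simp [e1, e2]

theorem constantCoeff_C_mul (c : R) (s : Zc n R) :
    (MvPowerSeries.C c * (s : MvPowerSeries (Fin n) R)).constantCoeff = 0 := by
  rw [map_mul, constantCoeff_coe_zc s, mul_zero]

variable [Algebra ℚ R]

/-- The value at `s_0, …, s_{k-1}` of the generating series of the symbol with end points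
`p_0, …, p_k` under the point `φ`. -/
def ser (φ : HBar →ₐ[ℚ] R) (k : ℕ) (p : ℕ → ℕ+) (s : ℕ → Zc n R) : MvPowerSeries (Fin n) R :=
  MvPowerSeries.subst (fun a : Fin k => (s a : MvPowerSeries (Fin n) R))
    (MvPowerSeries.map φ.toRingHom (genBar k fun a => p a))

theorem ser_congr (φ : HBar →ₐ[ℚ] R) {k k' : ℕ} {p p' : ℕ → ℕ+} {s s' : ℕ → Zc n R} (hk : k = k')
    (hp : ∀ a ≤ k, p a = p' a) (hs : ∀ a < k, s a = s' a) : ser φ k p s = ser φ k' p' s' := by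
  subst hk
  have h1 : (fun a : Fin (k + 1) => p a) = fun a : Fin (k + 1) => p' a :=
    funext fun a => hp a (Nat.lt_succ_iff.1 a.2)
  have h2 : (fun a : Fin k => (s a : MvPowerSeries (Fin n) R)) =
      fun a : Fin k => (s' a : MvPowerSeries (Fin n) R) :=
    funext fun a => by rw [hs a a.2]
  rw [ser, ser, h1, h2]

theorem ser_zero (φ : HBar →ₐ[ℚ] R) (p : ℕ → ℕ+) (s : ℕ → Zc n R) : ser φ 0 p s = 1 := by
  have : ∀ f : Fin 0 → MvPowerSeries (Fin n) R, MvPowerSeries.subst f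
      (1 : MvPowerSeries (Fin 0) R) = 1 := fun f => by
    rw [← MvPowerSeries.coe_substAlgHom
      (MvPowerSeries.hasSubst_of_constantCoeff_zero fun a : Fin 0 => a.elim0), map_one]
  rw [ser, genBar, map_one, this]

/-- The mould of a point `φ : H̄ → R`: its value at a word is the value of the generating series of
the corresponding symbol, mapped to `L` by `κ`. -/
def ptMould (κ : MvPowerSeries (Fin n) R →+* L) (φ : HBar →ₐ[ℚ] R) : Mould ℕ+ (Zc n R) L :=
  fun w q => κ (ser φ w.length (fun a => (w.map Prod.fst).getD a q)
    fun a => (w.map Prod.snd).getD a 0)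

/-- The primitive `∑_{r < q} [x_r]_0` of the function `[x_{a→b}]_0`. -/
def logPot (q : ℕ+) : HBar := ∑ r ∈ Finset.Ico 1 q, MvPolynomial.X (BarGen.log r)

theorem logTo_eq {A : Type*} [CommRing A] (l : ℕ+ → A) (a b : ℕ+) :
    logTo l a b = ∑ r ∈ Finset.Ico 1 b, l r - ∑ r ∈ Finset.Ico 1 a, l r := by
  have h : ∀ a b : ℕ+, a ≤ b → ∑ r ∈ Finset.Ico a b, l r =
      ∑ r ∈ Finset.Ico 1 b, l r - ∑ r ∈ Finset.Ico 1 a, l r := by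
    intro a b hab
    rw [eq_sub_iff_add_eq, add_comm, ← Finset.sum_union]
    · rw [Finset.Ico_union_Ico_eq_Ico one_le hab]
    · exact Finset.Ico_disjoint_Ico_consecutive 1 a b
  rw [logTo]
  rcases le_total a b with hab | hab
  · rw [h a b hab, Finset.Ico_eq_empty_of_le hab]; simp
  · rw [h b a hab, Finset.Ico_eq_empty_of_le hab]; simp

/-- The characters `t ↦ exp ((∑_{r < q} [x_r]_0) t)` of a point. -/
def ptChars (κ : MvPowerSeries (Fin n) R →+* L) (φ : HBar →ₐ[ℚ] R) : Chars ℕ+ (Zc n R) L where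
  toFun s := fun q => κ (expSeries (φ (logPot q)) ((Multiplicative.toAdd s : Zc n R) :
    MvPowerSeries (Fin n) R))
  map_one' := by
    ext q
    simp [expSeries_eq, expS_zero]
  map_mul' s t := by
    ext q
    simp only [toAdd_mul, AddSubgroup.coe_add, expSeries_eq, mul_add, Pi.mul_apply]
    rw [expS_add (constantCoeff_C_mul _ _) (constantCoeff_C_mul _ _), map_mul]

theorem ev_ptChars (κ : MvPowerSeries (Fin n) R →+* L) (φ : HBar →ₐ[ℚ] R) (s : Zc n R) (q : ℕ+) :
    ev (ptChars κ φ) s q = κ (expSeries (φ (logPot q)) (s : MvPowerSeries (Fin n) R)) := rfl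

theorem ev_ptChars_mul (κ : MvPowerSeries (Fin n) R →+* L) (φ : HBar →ₐ[ℚ] R) (s : Zc n R)
    (a b : ℕ+) : ev (ptChars κ φ) (-s) a * ev (ptChars κ φ) s b =
      κ (expSeries (φ (logTo (fun r => MvPolynomial.X (BarGen.log r)) a b))
        (s : MvPowerSeries (Fin n) R)) := by
  rw [ev_ptChars, ev_ptChars, ← map_mul, expSeries_eq, expSeries_eq, expSeries_eq,
    ← expS_add (constantCoeff_C_mul _ _) (constantCoeff_C_mul _ _), logTo_eq]
  congr 2
  simp only [map_sub, AddSubgroup.coe_neg, logPot]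
  ring

/-- The substitution data of a point. -/
def ptData (κ : MvPowerSeries (Fin n) R →+* L) (φ : HBar →ₐ[ℚ] R) :
    SubstData ℕ+ (Zc n R) L where
  N := iota (ptMould κ φ)
  F := ptMould κ φ
  E := ptChars κ φ

theorem ptData_F (κ : MvPowerSeries (Fin n) R →+* L) (φ : HBar →ₐ[ℚ] R) :
    (ptData κ φ).F = ptMould κ φ := rfl

theorem ptData_N (κ : MvPowerSeries (Fin n) R →+* L) (φ : HBar →ₐ[ℚ] R) :
    (ptData κ φ).N = iota (ptMould κ φ) := rfl

theorem ptMould_nil (κ : MvPowerSeries (Fin n) R →+* L) (φ : HBar →ₐ[ℚ] R) (q : ℕ+) :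
    ptMould κ φ [] q = 1 := by
  rw [ptMould, List.length_nil, ser_zero, map_one]

theorem ptMould_map_range (κ : MvPowerSeries (Fin n) R →+* L) (φ : HBar →ₐ[ℚ] R) (k : ℕ)
    (p : ℕ → ℕ+) (s : ℕ → Zc n R) :
    ptMould κ φ ((List.range k).map fun a => (p a, s a)) (p k) = κ (ser φ k p s) := by
  rw [ptMould]
  congr 1
  refine ser_congr φ (by simp) (fun a ha => ?_) fun a ha => ?_
  · have ha : a ≤ k := by simpa using ha
    rcases ha.eq_or_lt with rfl | ha
    · rw [List.getD_eq_default _ _ (by simp)]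
    · rw [List.getD_eq_getElem _ _ (by simpa using ha)]; simp
  · have ha : a < k := by simpa using ha
    rw [List.getD_eq_getElem _ _ (by simpa using ha)]; simp

theorem ptMould_seg (κ : MvPowerSeries (Fin n) R →+* L) (φ : HBar →ₐ[ℚ] R)
    (c : ℕ → ℕ+) (τ : ℕ → Zc n R) {i j : ℕ} (h : i ≤ j) :
    ptMould κ φ (seg c τ i j) (c j) =
      κ (ser φ (j - i) (fun a => c (i + a)) fun a => τ (i + a)) := by
  rw [← ptMould_map_range, seg, List.range'_eq_map_range, List.map_map]
  have : i + (j - i) = j := by omega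
  rw [this]
  rfl

theorem iota_ptMould_seg (κ : MvPowerSeries (Fin n) R →+* L) (φ : HBar →ₐ[ℚ] R)
    (c : ℕ → ℕ+) (τ : ℕ → Zc n R) {i j : ℕ} (h : i ≤ j) :
    iota (ptMould κ φ) (seg c τ i j) (c j) = (-1) ^ (j - i) *
      κ (ser φ (j - i) (fun a => c (j - a)) fun a => -τ (j - 1 - a)) := by
  rw [iota_apply, revWord_seg c τ h, head_seg c τ h, length_seg, ← ptMould_map_range]
  have : j - (j - i) = i := by omega
  rw [this]

theorem ptMould_ofFn (κ : MvPowerSeries (Fin n) R →+* L) (φ : HBar →ₐ[ℚ] R) (k : ℕ)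
    (p : Fin (k + 1) → ℕ+) (s : Fin k → Zc n R) :
    ptMould κ φ (List.ofFn fun a => (p a.castSucc, s a)) (p (Fin.last k)) =
      κ (MvPowerSeries.subst (fun a => (s a : MvPowerSeries (Fin n) R))
        (MvPowerSeries.map φ.toRingHom (genBar k p))) := by
  rw [ptMould, ser_congr φ (k' := k) (p' := fun a => if h : a < k + 1 then p ⟨a, h⟩ else 1)
    (s' := fun a => if h : a < k then s ⟨a, h⟩ else 0) (by simp)]
  · have h1 : (fun a : Fin (k + 1) => if h : (a : ℕ) < k + 1 then p ⟨a, h⟩ else 1) = p :=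
      funext fun a => dif_pos a.2
    rw [ser, h1]
    simp
  · intro a ha
    have ha : a ≤ k := by simpa using ha
    rw [dif_pos (Nat.lt_succ_of_le ha)]
    rcases ha.eq_or_lt with rfl | ha
    · rw [List.getD_eq_default _ _ (by simp)]; rfl
    · rw [List.getD_eq_getElem _ _ (by simpa using ha)]; simp
  · intro a ha
    have ha : a < k := by simpa using ha
    rw [List.getD_eq_getElem _ _ (by simpa using ha)]; simp [ha]

/-! ### The coproduct as a composition of substitutions -/

variable {A : Type*} [CommRing A] [Algebra ℚ A]

/-- Evaluation of a power series over `A` at a point of `A` and at values of the variables. -/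
def evalSeries (φ : A →ₐ[ℚ] R) {d : ℕ} (s : Fin d → Zc n R) :
    MvPowerSeries (Fin d) A →+* MvPowerSeries (Fin n) R :=
  (substHom (fun a => (s a : MvPowerSeries (Fin n) R)) fun a => constantCoeff_coe_zc (s a)).comp
    (MvPowerSeries.map φ.toRingHom)

theorem evalSeries_apply (φ : A →ₐ[ℚ] R) {d : ℕ} (s : Fin d → Zc n R)
    (f : MvPowerSeries (Fin d) A) : evalSeries φ s f =
      MvPowerSeries.subst (fun a => (s a : MvPowerSeries (Fin n) R))
        (MvPowerSeries.map φ.toRingHom f) :=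
  substHom_apply _ (fun a => constantCoeff_coe_zc (s a)) _

/-- The values `s_1, …, s_d` as a sequence that is zero elsewhere. -/
def extend {d : ℕ} (s : Fin d → Zc n R) (r : ℕ) : Zc n R :=
  if h : 1 ≤ r ∧ r ≤ d then s ⟨r - 1, by omega⟩ else 0

theorem evalSeries_tVar (φ : A →ₐ[ℚ] R) {d : ℕ} (s : Fin d → Zc n R) (r : ℕ) :
    evalSeries φ s (tVar d r) = (extend s r : MvPowerSeries (Fin n) R) := by
  rw [evalSeries_apply, map_tVar, subst_tVar (fun a => constantCoeff_coe_zc (s a)), extend]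
  split_ifs <;> rfl

theorem evalSeries_subst (φ : A →ₐ[ℚ] R) {d k : ℕ} (s : Fin d → Zc n R)
    {u : Fin k → MvPowerSeries (Fin d) A} (hu : ∀ a, (u a).constantCoeff = 0)
    (f : MvPowerSeries (Fin k) A) :
    evalSeries φ s (MvPowerSeries.subst u f) =
      MvPowerSeries.subst (fun a => evalSeries φ s (u a)) (MvPowerSeries.map φ.toRingHom f) := by
  have h1 := MvPowerSeries.hasSubst_of_constantCoeff_zero hu
  rw [evalSeries_apply, MvPowerSeries.map_subst h1, MvPowerSeries.subst_comp_subst_apply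
    (h1.map _) (MvPowerSeries.hasSubst_of_constantCoeff_zero fun a =>
      constantCoeff_coe_zc (s a))]
  simp only [evalSeries_apply]

theorem evalSeries_expSeries (φ : A →ₐ[ℚ] R) {d : ℕ} (s : Fin d → Zc n R) (c : A)
    {u : MvPowerSeries (Fin d) A} (hu : u.constantCoeff = 0) :
    evalSeries φ s (expSeries c u) = expSeries (φ c) (evalSeries φ s u) := by
  have h : (MvPowerSeries.C c * u).constantCoeff = 0 := by rw [map_mul, hu, mul_zero]
  rw [evalSeries_apply, expSeries_eq, map_expS _ h, subst_expS
    (MvPowerSeries.hasSubst_of_constantCoeff_zero fun a => constantCoeff_coe_zc (s a))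
    (constantCoeff_map_eq_zero _ h), expSeries_eq, ← evalSeries_apply, map_mul]
  congr 2
  rw [evalSeries_apply, MvPowerSeries.map_C, MvPowerSeries.subst_C]
  rfl

theorem constantCoeff_tVar_sub (A : Type*) [CommRing A] (d r r' : ℕ) :
    (tVar d r - tVar d r' : MvPowerSeries (Fin d) A).constantCoeff = 0 := by
  rw [map_sub, constantCoeff_tVar, constantCoeff_tVar, sub_zero]

theorem evalSeries_comulFactor (κ : MvPowerSeries (Fin n) R →+* L) (φ : HBar →ₐ[ℚ] R) {d : ℕ}
    (p : Fin (d + 1) → ℕ+) (s : Fin d → Zc n R) {i j i' : ℕ} (hij : i ≤ j) (hji : j < i') :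
    κ (evalSeries φ s (comulFactor p i j i')) =
      (ptData κ φ).blockTerm (pt p) (extend s) i j i' := by
  rw [SubstData.blockTerm]
  change _ = ev (ptChars κ φ) _ _ * ev (ptChars κ φ) _ _ *
    (iota (ptMould κ φ) _ _ * ptMould κ φ _ _)
  rw [ev_ptChars_mul, shiftWord_seg, shiftWord_seg, iota_ptMould_seg _ _ _ _ hij,
    ptMould_seg _ _ _ _ hji, comulFactor, map_mul, map_mul, map_mul, map_mul, map_mul, map_mul,
    evalSeries_expSeries _ _ _ (constantCoeff_tVar _ _), evalSeries_tVar, brBar, brBar,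
    evalSeries_subst _ _ (fun a => constantCoeff_tVar_sub _ _ _ _),
    evalSeries_subst _ _ (fun a => constantCoeff_tVar_sub _ _ _ _)]
  have e1 : i' - 1 - j = i' - (j + 1) := by omega
  rw [e1]
  have e2 : ser φ (j - i) (fun a => pt p (j - a))
        (fun a => -(extend s (j - 1 - a) - extend s j)) =
      MvPowerSeries.subst (fun a : Fin (j - i) =>
          evalSeries φ s (tVar d j - tVar d (j - 1 - (a : ℕ))))
        (MvPowerSeries.map φ.toRingHom (genBar (j - i) fun a => pt p (j - (a : ℕ)))) := by
    rw [ser]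
    congr 1
    funext a
    rw [map_sub, evalSeries_tVar, evalSeries_tVar]
    simp
  have e3 : ser φ (i' - (j + 1)) (fun a => pt p (j + 1 + a))
        (fun a => (extend s (j + 1 + a) - extend s j)) =
      MvPowerSeries.subst (fun a : Fin (i' - (j + 1)) =>
          evalSeries φ s (tVar d (j + 1 + (a : ℕ)) - tVar d j))
        (MvPowerSeries.map φ.toRingHom
          (genBar (i' - (j + 1)) fun a => pt p (j + 1 + (a : ℕ)))) := by
    rw [ser]
    congr 1
    funext a
    rw [map_sub, evalSeries_tVar, evalSeries_tVar]
    simp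
  rw [e2, e3, map_pow, map_neg, map_one, map_pow, map_neg, map_one]
  ring

theorem subst_one_fin_zero {d : ℕ} {A : Type*} [CommRing A] (u : Fin 0 → MvPowerSeries (Fin d) A) :
    MvPowerSeries.subst u (1 : MvPowerSeries (Fin 0) A) = 1 := by
  rw [← MvPowerSeries.coe_substAlgHom
    (MvPowerSeries.hasSubst_of_constantCoeff_zero fun a : Fin 0 => a.elim0), map_one]

theorem evalSeries_comulFactor_zero (κ : MvPowerSeries (Fin n) R →+* L) (φ : HBar →ₐ[ℚ] R) {d : ℕ}
    (p : Fin (d + 1) → ℕ+) (s : Fin d → Zc n R) {i' : ℕ} (hi : 0 < i') :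
    κ (evalSeries φ s (comulFactor p 0 0 i')) =
      ptMould κ φ (seg (pt p) (extend s) 1 i') (pt p i') := by
  rw [comulFactor, tVar_zero, ptMould_seg _ _ _ _ hi]
  congr 1
  have e0 : brBar (fun a : Fin (0 - 0 + 1) => pt p (0 - a))
      (fun a : Fin (0 - 0) => (0 : MvPowerSeries (Fin d) HBar) - tVar d (0 - 1 - a)) = 1 :=
    subst_one_fin_zero _
  rw [e0, expSeries_eq, mul_zero, expS_zero, Nat.sub_self, pow_zero, one_mul, one_mul, one_mul,
    brBar, evalSeries_subst _ _ (fun a => by rw [sub_zero]; exact constantCoeff_tVar _ _), ser]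
  congr 1
  funext a
  rw [sub_zero, evalSeries_tVar]

end Points

open Mould

/-! ### Monotone words -/

section MonoWord

variable {P T : Type*}

theorem map_fst_revWord [AddCommGroup T] (w : List (P × T)) (q : P) :
    (revWord w q).map Prod.fst ++ [head w q] = (w.map Prod.fst ++ [q]).reverse := by
  induction w with
  | nil => rfl
  | cons x w ih =>
    rw [revWord, List.map_append, List.map_cons (l := w), List.cons_append, List.reverse_cons, ← ih]
    rfl

variable [LinearOrder P]

/-- The points of a word, including its end point, are strictly increasing or strictly
decreasing. -/
def MonoWord (w : List (P × T)) (q : P) : Prop :=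
  (w.map Prod.fst ++ [q]).Pairwise (· < ·) ∨ (w.map Prod.fst ++ [q]).Pairwise (· > ·)

theorem MonoWord.of_sublist {w u : List (P × T)} {q r : P} (h : MonoWord w q)
    (hu : (u.map Prod.fst ++ [r]).Sublist (w.map Prod.fst ++ [q])) : MonoWord u r :=
  h.imp (fun h => h.sublist hu) (fun h => h.sublist hu)

theorem MonoWord.append {u v : List (P × T)} {q : P} (h : MonoWord (u ++ v) q) :
    MonoWord u (head v q) ∧ MonoWord v q := by
  constructor
  · refine h.of_sublist ?_
    rw [List.map_append, List.append_assoc]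
    refine (List.Sublist.refl _).append ?_
    cases v <;> simp [head]
  · refine h.of_sublist ?_
    rw [List.map_append, List.append_assoc]
    exact List.sublist_append_right _ _

theorem MonoWord.contract {u w : List (P × T)} {q : P} (h : MonoWord w q)
    (hu : (u.map Prod.fst).Sublist (w.map Prod.fst)) : MonoWord u q :=
  h.of_sublist (hu.append (List.Sublist.refl _))

theorem MonoWord.strictMono_or {w : List (P × T)} {q : P} (h : MonoWord w q) :
    StrictMono (fun a : Fin (w.length + 1) => (w.map Prod.fst).getD a q) ∨
      StrictAnti (fun a : Fin (w.length + 1) => (w.map Prod.fst).getD a q) := by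
  have key : ∀ a : Fin (w.length + 1), (w.map Prod.fst).getD a q =
      (w.map Prod.fst ++ [q])[a.1]'(by simpa using a.2) := by
    intro a
    rcases (Nat.lt_succ_iff.1 a.2).eq_or_lt with ha | ha
    · rw [List.getD_eq_default _ _ (by simp [ha]), List.getElem_append_right (by simp [ha])]
      simp
    · rw [List.getD_eq_getElem _ _ (by simpa using ha), List.getElem_append_left]
  refine h.imp (fun h a b hab => ?_) (fun h a b hab => ?_)
  · simp only [key]
    exact List.pairwise_iff_getElem.1 h _ _ _ _ hab
  · simp only [key]
    exact List.pairwise_iff_getElem.1 h _ _ _ _ hab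

theorem monoWord_ofFn {k : ℕ} {p : Fin (k + 1) → P} (hp : StrictMono p ∨ StrictAnti p)
    (s : Fin k → T) :
    MonoWord (List.ofFn fun a => (p a.castSucc, s a)) (p (Fin.last k)) := by
  have e : (List.ofFn fun a => (p a.castSucc, s a)).map Prod.fst ++ [p (Fin.last k)] =
      List.ofFn p := by
    rw [List.ofFn_succ', List.concat_eq_append, List.map_ofFn]; rfl
  rw [MonoWord, e]
  exact hp.imp (fun h => List.pairwise_ofFn.2 fun i j hij => h hij)
    (fun h => List.pairwise_ofFn.2 fun i j hij => h hij)

theorem MonoWord.revWord [AddCommGroup T] {w : List (P × T)} {q : P} (h : MonoWord w q) :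
    MonoWord (revWord w q) (head w q) := by
  rw [MonoWord, map_fst_revWord, List.pairwise_reverse, List.pairwise_reverse]
  exact h.symm

theorem MonoWord.shiftWord [AddCommGroup T] {w : List (P × T)} {q : P} (h : MonoWord w q) (s : T) :
    MonoWord (shiftWord s w) q := by
  have : (Mould.shiftWord s w).map Prod.fst = w.map Prod.fst := by
    rw [Mould.shiftWord, List.map_map]; rfl
  rw [MonoWord, this]
  exact h

end MonoWord

namespace SubstData

variable {P T K : Type*} [LinearOrder P] [CommRing K] [AddCommGroup T]

/-- Two substitution data agree on monotone words. -/
structure Agree (D D' : SubstData P T K) : Prop where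
  N : ∀ w q, MonoWord w q → D.N w q = D'.N w q
  F : ∀ w q, MonoWord w q → D.F w q = D'.F w q
  E : D.E = D'.E

theorem Agree.symm {D D' : SubstData P T K} (h : D.Agree D') : D'.Agree D :=
  ⟨fun w q hw => (h.N w q hw).symm, fun w q hw => (h.F w q hw).symm, h.E.symm⟩

theorem Agree.trans {D D' D'' : SubstData P T K} (h : D.Agree D') (h' : D'.Agree D'') :
    D.Agree D'' :=
  ⟨fun w q hw => (h.N w q hw).trans (h'.N w q hw),
    fun w q hw => (h.F w q hw).trans (h'.F w q hw), h.E.trans h'.E⟩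

theorem Agree.refl (D : SubstData P T K) : D.Agree D :=
  ⟨fun _ _ _ => rfl, fun _ _ _ => rfl, rfl⟩

variable [DecidableEq T]

theorem Agree.block {D D' : SubstData P T K} (h : D.Agree D') (s : T) {w q}
    (hw : MonoWord w q) : D.block s w q = D'.block s w q := by
  rw [SubstData.block, SubstData.block, conj_apply, conj_apply, h.E, shift_apply, shift_apply]
  congr 2
  have hw := hw.shiftWord s
  refine mul_congr fun u v huv => ?_
  rw [huv] at hw
  rw [h.F _ _ hw.append.2]
  congr 1
  refine mul_congr fun u' v' huv' => ?_
  have hu := hw.append.1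
  rw [huv'] at hu
  rw [h.N _ _ hu.append.1]

theorem Agree.gax {D D' : SubstData P T K} (h : D.Agree D') {M M' : Mould P T K} {w q}
    (hM : ∀ u q, MonoWord u q → M u q = M' u q) (hw : MonoWord w q) :
    D.gax M w q = D'.gax M' w q :=
  gax_congr MonoWord (fun _ _ _ h => h.append) (fun s _ _ hw => h.block s hw) w M M' q hw
    fun u hu _ => hM u q (hw.contract hu)

theorem Agree.comp {D₁ D₁' D₂ D₂' : SubstData P T K} (h₁ : D₁.Agree D₁') (h₂ : D₂.Agree D₂') :
    (D₁.comp D₂).Agree (D₁'.comp D₂') := by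
  refine ⟨fun w q hw => mul_congr fun u v huv => ?_, fun w q hw => mul_congr fun u v huv => ?_, ?_⟩
  · rw [huv] at hw
    rw [h₂.gax h₁.N hw.append.1, h₂.N _ _ hw.append.2]
  · rw [huv] at hw
    rw [h₂.gax h₁.F hw.append.2, h₂.F _ _ hw.append.1]
  · change D₁.E * D₂.E = D₁'.E * D₂'.E
    rw [h₁.E, h₂.E]

end SubstData

/-! ### Convolution of points -/

section Convolution

variable {R : Type*} [CommRing R] {n : ℕ} {L : Type*} [CommRing L]

theorem word_eq_seg (w : List (ℕ+ × Zc n R)) (q : ℕ+) :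
    w = seg (pt fun a : Fin (w.length + 1) => (w.map Prod.fst).getD a q)
      (extend fun a : Fin w.length => (w.map Prod.snd).getD a 0) 1 (w.length + 1) := by
  refine List.ext_getElem (by simp) fun a h1 h2 => ?_
  have e : min a w.length = a := by omega
  have e1 : 1 + a ≤ w.length := by omega
  simp [seg, pt, extend, e, h1, e1]

variable [Algebra ℚ R]

/-- The homomorphism `a ⊗ b ↦ φ a * ψ b`. -/
def liftPt (φ ψ : HBar →ₐ[ℚ] R) : HBar ⊗[ℚ] HBar →ₐ[ℚ] R :=
  Algebra.TensorProduct.lift φ ψ fun _ _ => Commute.all _ _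

theorem liftPt_tmul (φ ψ : HBar →ₐ[ℚ] R) (a b : HBar) :
    liftPt φ ψ (a ⊗ₜ b) = φ a * ψ b := by
  simp [liftPt]

theorem liftPt_tmul_one (φ ψ : HBar →ₐ[ℚ] R) (a : HBar) : liftPt φ ψ (a ⊗ₜ 1) = φ a := by
  rw [liftPt_tmul, map_one, mul_one]

theorem liftPt_one_tmul (φ ψ : HBar →ₐ[ℚ] R) (a : HBar) : liftPt φ ψ (1 ⊗ₜ a) = ψ a := by
  rw [liftPt_tmul, map_one, one_mul]

/-- The product of two points that is dual to the coproduct of `H̄`. -/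
def convPt (φ ψ : HBar →ₐ[ℚ] R) : HBar →ₐ[ℚ] R :=
  (liftPt φ ψ).comp comulBar

theorem convPt_log (φ ψ : HBar →ₐ[ℚ] R) (i : ℕ+) :
    convPt φ ψ (MvPolynomial.X (BarGen.log i)) =
      φ (MvPolynomial.X (BarGen.log i)) + ψ (MvPolynomial.X (BarGen.log i)) := by
  simp [convPt, comulBar, comulBarGen, liftPt_tmul]

theorem expo_succPNat {d : ℕ} (m : Fin d →₀ ℕ) : expo (fun r => (m r).succPNat) = m := by
  ext r; simp [expo]

theorem map_genBar_succ {d : ℕ} (φ : HBar →ₐ[ℚ] R) (p : Fin (d + 2) → ℕ+)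
    (hp : StrictMono p ∨ StrictAnti p) (m : Fin (d + 1) →₀ ℕ) :
    MvPowerSeries.coeff m (MvPowerSeries.map φ.toRingHom (genBar (d + 1) p)) =
      φ (MvPolynomial.X (BarGen.poly d p hp fun r => (m r).succPNat)) := by
  rw [MvPowerSeries.coeff_map]
  refine congrArg φ ?_
  change genBar (d + 1) p m = _
  rw [genBar]
  exact dif_pos hp

theorem map_convPt_genBar {d : ℕ} (φ ψ : HBar →ₐ[ℚ] R) (p : Fin (d + 2) → ℕ+)
    (hp : StrictMono p ∨ StrictAnti p) :
    MvPowerSeries.map (convPt φ ψ).toRingHom (genBar (d + 1) p) =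
      MvPowerSeries.map (liftPt φ ψ).toRingHom
        (comulSeries p) := by
  ext m
  rw [map_genBar_succ _ _ hp, MvPowerSeries.coeff_map, convPt, AlgHom.comp_apply, comulBar,
    MvPolynomial.aeval_X, comulBarGen, expo_succPNat]
  rfl

/-- The convolution product of points is the composition of the corresponding substitutions. -/
theorem ptMould_convPt (κ : MvPowerSeries (Fin n) R →+* L) (φ ψ : HBar →ₐ[ℚ] R)
    (w : List (ℕ+ × Zc n R)) (q : ℕ+) (hw : MonoWord w q) :
    ptMould κ (convPt φ ψ) w q = ((ptData κ φ).comp (ptData κ ψ)).F w q := by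
  classical
  change _ = (ptMould κ ψ * (ptData κ ψ).gax (ptMould κ φ)) w q
  rcases hd : w.length with _ | d
  · rw [List.length_eq_zero_iff] at hd
    subst hd
    rw [mul_nil, SubstData.gax_nil, ptMould_nil, ptMould_nil, ptMould_nil, mul_one]
  · have hp := hw.strictMono_or
    obtain ⟨p, hpe⟩ : ∃ p : Fin (w.length + 1) → ℕ+,
        p = fun a : Fin (w.length + 1) => (w.map Prod.fst).getD a q := ⟨_, rfl⟩
    obtain ⟨s, hse⟩ : ∃ s : Fin w.length → Zc n R,
        s = fun a : Fin w.length => (w.map Prod.snd).getD a 0 := ⟨_, rfl⟩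
    have hwe := word_eq_seg w q
    have hq : q = pt p (w.length + 1) := by
      simp [pt, hpe]
    have hl : ptMould κ (convPt φ ψ) w q =
        κ (MvPowerSeries.subst (fun a => (s a : MvPowerSeries (Fin n) R))
          (MvPowerSeries.map (convPt φ ψ).toRingHom (genBar w.length p))) := by
      rw [ptMould, ser, hpe, hse]
    rw [← hpe] at hp hwe
    rw [← hse] at hwe
    rw [hl]
    clear hl hpe hse hw
    generalize w.length = l at *
    subst hd
    rw [hwe, hq, map_convPt_genBar φ ψ p hp, SubstData.mul_gax_eq_sum]
    clear hwe hq w q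
    set Θ : MvPowerSeries (Fin (d + 1)) (HBar ⊗[ℚ] HBar) →+* L := κ.comp
      ((substHom (fun a => (s a : MvPowerSeries (Fin n) R)) fun a => constantCoeff_coe_zc (s a)).comp
        (MvPowerSeries.map
          (liftPt φ ψ).toRingHom)) with hΘ
    have hΘl : ∀ f, Θ (MvPowerSeries.map
        (Algebra.TensorProduct.includeLeft : HBar →ₐ[ℚ] HBar ⊗[ℚ] HBar).toRingHom f) =
        κ (evalSeries φ s f) := by
      intro f
      rw [hΘ, RingHom.comp_apply, RingHom.comp_apply, evalSeries, RingHom.comp_apply]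
      congr 2
      ext m
      simp [MvPowerSeries.coeff_map, liftPt_tmul]
    have hΘr : ∀ f, Θ (MvPowerSeries.map
        (Algebra.TensorProduct.includeRight : HBar →ₐ[ℚ] HBar ⊗[ℚ] HBar).toRingHom f) =
        κ (evalSeries ψ s f) := by
      intro f
      rw [hΘ, RingHom.comp_apply, RingHom.comp_apply, evalSeries, RingHom.comp_apply]
      congr 2
      ext m
      simp [MvPowerSeries.coeff_map, liftPt_tmul]
    have h0 : κ (MvPowerSeries.subst (fun a => (s a : MvPowerSeries (Fin n) R))
        (MvPowerSeries.map
          (liftPt φ ψ).toRingHom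
          (comulSeries p))) = Θ (comulSeries p) := by
      rw [hΘ, RingHom.comp_apply, RingHom.comp_apply, substHom_apply]
    rw [h0, comulSeries, map_sum]
    refine Finset.sum_congr rfl fun k _ => ?_
    rw [map_sum]
    refine Finset.sum_congr rfl fun I _ => ?_
    rw [map_sum]
    refine Finset.sum_congr rfl fun J _ => ?_
    by_cases hIJ : Admissible I J
    · rw [if_pos hIJ, if_pos hIJ, map_mul, hΘl, hΘr, mul_comm]
      congr 1
      · rw [map_prod, map_prod, Fin.prod_univ_succ]
        congr 1
        · have h1 : (0 : ℕ) < I 1 := by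
            have := (hIJ.2.2.2 0).2
            rw [hIJ.2.1] at this
            exact this
          rw [Fin.castSucc_zero, hIJ.1, hIJ.2.1]
          exact evalSeries_comulFactor_zero κ ψ p s h1
        · refine Finset.prod_congr rfl fun α _ => ?_
          have h1 := hIJ.2.2.2 α.succ
          exact evalSeries_comulFactor κ ψ p s h1.1 h1.2
      · rw [brBar, evalSeries_subst _ _ (fun a => constantCoeff_tVar _ _)]
        have h1 := ptMould_ofFn κ φ k (fun a => pt p (I a.succ)) (fun a => extend s (J a.succ))
        have h2 : pt p (I (Fin.last k).succ) = pt p (d + 1 + 1) := by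
          rw [Fin.succ_last, hIJ.2.2.1, Fin.val_last]
        rw [h2] at h1
        simp only [evalSeries_tVar]
        exact h1.symm
    · rw [if_neg hIJ, if_neg hIJ, map_zero]

theorem ptChars_convPt (κ : MvPowerSeries (Fin n) R →+* L) (φ ψ : HBar →ₐ[ℚ] R) :
    ptChars κ (convPt φ ψ) = ptChars κ φ * ptChars κ ψ := by
  ext s q
  change κ _ = κ _ * κ _
  rw [← map_mul, expSeries_eq, expSeries_eq, expSeries_eq,
    ← expS_add (constantCoeff_C_mul _ _) (constantCoeff_C_mul _ _)]
  congr 2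
  rw [← add_mul, ← map_add]
  congr 2
  simp only [logPot, map_sum, convPt_log, Finset.sum_add_distrib]

/-- The convolution product of points corresponds to the composition of their substitutions. The
data agree on monotone words only, since the coproduct is prescribed only there. -/
theorem ptData_convPt_agree (κ : MvPowerSeries (Fin n) R →+* L) (φ ψ : HBar →ₐ[ℚ] R) :
    (ptData κ (convPt φ ψ)).Agree ((ptData κ φ).comp (ptData κ ψ)) where
  N w q hw := by
    rw [SubstData.comp_N_eq_iota _ _ rfl rfl]
    change iota (ptMould κ (convPt φ ψ)) w q = _
    rw [iota_apply, iota_apply, ptMould_convPt κ φ ψ _ _ hw.revWord]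
  F := ptMould_convPt κ φ ψ
  E := ptChars_convPt κ φ ψ

/-- Points are determined by their moulds on monotone words. -/
theorem point_ext {φ ψ : HBar →ₐ[ℚ] R}
    (hlog : ∀ i, φ (MvPolynomial.X (BarGen.log i)) = ψ (MvPolynomial.X (BarGen.log i)))
    (h : ∀ (n : ℕ) (w : List (ℕ+ × Zc n R)) (q : ℕ+), MonoWord w q →
      ptMould (RingHom.id _) φ w q = ptMould (RingHom.id _) ψ w q) : φ = ψ := by
  refine MvPolynomial.algHom_ext fun g => ?_
  cases g with
  | log i => exact hlog i
  | poly d p hp m =>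
    let s : Fin (d + 1) → Zc (d + 1) R := fun a =>
      ⟨MvPowerSeries.X a, MvPowerSeries.constantCoeff_X a⟩
    have h1 := h (d + 1) _ _ (monoWord_ofFn hp s)
    rw [ptMould_ofFn, ptMould_ofFn] at h1
    have hs : (fun a => (s a : MvPowerSeries (Fin (d + 1)) R)) = MvPowerSeries.X := rfl
    rw [hs, MvPowerSeries.subst_self] at h1
    have h2 := congrArg (MvPowerSeries.coeff (expo m)) h1
    simp only [RingHom.id_apply, id] at h2
    rw [map_genBar_succ _ _ hp, map_genBar_succ _ _ hp] at h2
    have hm : (fun r => ((expo m) r).succPNat) = m := by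
      funext r
      refine PNat.eq ?_
      simp only [expo, Finsupp.equivFunOnFinite_symm_apply_apply, Nat.succPNat_coe]
      exact Nat.succ_pred_eq_of_pos (m r).pos
    rwa [hm] at h2

theorem convPt_assoc (φ₁ φ₂ φ₃ : HBar →ₐ[ℚ] R) :
    convPt (convPt φ₁ φ₂) φ₃ = convPt φ₁ (convPt φ₂ φ₃) := by
  refine point_ext (fun i => by simp only [convPt_log, add_assoc]) fun n w q hw => ?_
  have h1 := (ptData_convPt_agree (RingHom.id _) (convPt φ₁ φ₂) φ₃).trans
    ((ptData_convPt_agree (n := n) (RingHom.id _) φ₁ φ₂).comp (SubstData.Agree.refl _))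
  have h2 := (ptData_convPt_agree (RingHom.id _) φ₁ (convPt φ₂ φ₃)).trans
    ((SubstData.Agree.refl _).comp (ptData_convPt_agree (n := n) (RingHom.id _) φ₂ φ₃))
  rw [SubstData.comp_assoc] at h1
  exact (h1.trans h2.symm).F w q hw

/-- The point given by the counit. -/
def unitPt (R : Type*) [CommRing R] [Algebra ℚ R] : HBar →ₐ[ℚ] R :=
  (Algebra.ofId ℚ R).comp counitBar

theorem unitPt_X (g : BarGen) : unitPt R (MvPolynomial.X g) = 0 := by
  simp [unitPt, counitBar]

theorem ptMould_unitPt (κ : MvPowerSeries (Fin n) R →+* L) (w : List (ℕ+ × Zc n R)) (q : ℕ+)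
    (hw : MonoWord w q) : ptMould κ (unitPt R) w q = (1 : Mould ℕ+ (Zc n R) L) w q := by
  cases w with
  | nil => rw [ptMould_nil, one_nil]
  | cons x w =>
    rw [one_cons, ptMould, ser]
    have : MvPowerSeries.map (unitPt R).toRingHom (genBar (x :: w).length
        fun a => ((x :: w).map Prod.fst).getD a q) = 0 := by
      ext m
      exact (map_genBar_succ (d := w.length) _ _ hw.strictMono_or m).trans (unitPt_X _)
    rw [this, ← MvPowerSeries.coe_substAlgHom
      (MvPowerSeries.hasSubst_of_constantCoeff_zero fun a => constantCoeff_coe_zc _), map_zero,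
      map_zero]

theorem ptData_unitPt_agree (κ : MvPowerSeries (Fin n) R →+* L) :
    (ptData κ (unitPt R)).Agree (SubstData.trivial _ _ _) where
  N w q hw := by
    change iota (ptMould κ (unitPt R)) w q = (1 : Mould ℕ+ (Zc n R) L) w q
    rw [iota_apply, ptMould_unitPt κ _ _ hw.revWord, ← iota_apply, iota_one]
  F w q hw := ptMould_unitPt κ w q hw
  E := by
    ext s q
    change κ _ = 1
    have : unitPt R (logPot q) = 0 := by
      rw [logPot, map_sum]
      exact Finset.sum_eq_zero fun r _ => unitPt_X _
    rw [this, expSeries_eq, map_zero, zero_mul, expS_zero, map_one]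

end Convolution

open Mould

section Convolution

variable {R : Type*} [CommRing R] [Algebra ℚ R] {n : ℕ} {L : Type*} [CommRing L]

theorem unitPt_convPt (φ : HBar →ₐ[ℚ] R) : convPt (unitPt R) φ = φ := by
  refine point_ext (fun i => by rw [convPt_log, unitPt_X, zero_add]) fun n w q hw => ?_
  have h := (ptData_convPt_agree (n := n) (RingHom.id _) (unitPt R) φ).trans
    ((ptData_unitPt_agree (RingHom.id _)).comp (SubstData.Agree.refl (ptData (RingHom.id _) φ)))
  have h2 := h.F w q hw
  rw [SubstData.trivial_comp_F] at h2
  exact h2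

theorem convPt_unitPt (φ : HBar →ₐ[ℚ] R) : convPt φ (unitPt R) = φ := by
  refine point_ext (fun i => by rw [convPt_log, unitPt_X, add_zero]) fun n w q hw => ?_
  have h := (ptData_convPt_agree (n := n) (RingHom.id _) φ (unitPt R)).trans
    ((SubstData.Agree.refl (ptData (RingHom.id _) φ)).comp (ptData_unitPt_agree (RingHom.id _)))
  have h2 := h.F w q hw
  rw [SubstData.comp_trivial_F] at h2
  exact h2

end Convolution

/-! ### The bialgebra axioms for the auxiliary algebra -/

/-- Both sides are the product of the three universal points of `H̄ ⊗ H̄ ⊗ H̄`, so that this is the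
associativity of the convolution of points. -/
theorem comulBar_coassoc :
    (Algebra.TensorProduct.assoc ℚ ℚ ℚ HBar HBar HBar).toAlgHom.comp
      ((Algebra.TensorProduct.map comulBar (AlgHom.id ℚ HBar)).comp comulBar) =
    (Algebra.TensorProduct.map (AlgHom.id ℚ HBar) comulBar).comp comulBar := by
  let φ₁ : HBar →ₐ[ℚ] HBar ⊗[ℚ] (HBar ⊗[ℚ] HBar) := Algebra.TensorProduct.includeLeft
  let φ₂ : HBar →ₐ[ℚ] HBar ⊗[ℚ] (HBar ⊗[ℚ] HBar) :=
    Algebra.TensorProduct.includeRight.comp Algebra.TensorProduct.includeLeft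
  let φ₃ : HBar →ₐ[ℚ] HBar ⊗[ℚ] (HBar ⊗[ℚ] HBar) :=
    Algebra.TensorProduct.includeRight.comp Algebra.TensorProduct.includeRight
  have hl : (Algebra.TensorProduct.assoc ℚ ℚ ℚ HBar HBar HBar).toAlgHom.comp
      (Algebra.TensorProduct.map comulBar (AlgHom.id ℚ HBar)) =
      liftPt (R := HBar ⊗[ℚ] (HBar ⊗[ℚ] HBar)) (convPt φ₁ φ₂) φ₃ := by
    refine Algebra.TensorProduct.ext ?_ ?_
    · have : (Algebra.TensorProduct.assoc ℚ ℚ ℚ HBar HBar HBar).toAlgHom.comp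
          (Algebra.TensorProduct.includeLeft :
            HBar ⊗[ℚ] HBar →ₐ[ℚ] (HBar ⊗[ℚ] HBar) ⊗[ℚ] HBar) =
          liftPt (R := HBar ⊗[ℚ] (HBar ⊗[ℚ] HBar)) φ₁ φ₂ := by
        refine Algebra.TensorProduct.ext ?_ ?_ <;> ext <;>
          simp [φ₁, φ₂, liftPt_tmul_one, liftPt_one_tmul, Algebra.TensorProduct.one_def]
      ext g
      have := congrArg (fun f => f (comulBar (MvPolynomial.X g))) this
      simpa [convPt, liftPt_tmul_one] using this
    · ext g
      simp [φ₃, liftPt_one_tmul, Algebra.TensorProduct.one_def]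
  have hr : Algebra.TensorProduct.map (AlgHom.id ℚ HBar) comulBar =
      liftPt (R := HBar ⊗[ℚ] (HBar ⊗[ℚ] HBar)) φ₁ (convPt φ₂ φ₃) := by
    refine Algebra.TensorProduct.ext ?_ ?_
    · ext g
      simp [φ₁, liftPt_tmul_one]
    · have : (Algebra.TensorProduct.includeRight :
            HBar ⊗[ℚ] HBar →ₐ[ℚ] HBar ⊗[ℚ] (HBar ⊗[ℚ] HBar)) =
          liftPt (R := HBar ⊗[ℚ] (HBar ⊗[ℚ] HBar)) φ₂ φ₃ := by
        refine Algebra.TensorProduct.ext ?_ ?_ <;> ext <;> simp [φ₂, φ₃, liftPt_tmul_one, liftPt_one_tmul]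
      ext g
      have := congrArg (fun f => f (comulBar (MvPolynomial.X g))) this
      simpa [convPt, liftPt_one_tmul] using this
  have h := convPt_assoc (R := HBar ⊗[ℚ] (HBar ⊗[ℚ] HBar)) φ₁ φ₂ φ₃
  rw [← AlgHom.comp_assoc, hl, hr]
  exact h

theorem comulBar_rTensor_counit :
    (Algebra.TensorProduct.map counitBar (AlgHom.id ℚ HBar)).comp comulBar =
      (Algebra.TensorProduct.lid ℚ HBar).symm := by
  have h : ((Algebra.TensorProduct.lid ℚ HBar).toAlgHom).comp
      (Algebra.TensorProduct.map counitBar (AlgHom.id ℚ HBar)) =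
      liftPt (unitPt HBar) (AlgHom.id ℚ HBar) := by
    refine Algebra.TensorProduct.ext ?_ ?_ <;>
      refine MvPolynomial.algHom_ext fun g => ?_ <;>
      simp [unitPt, liftPt_tmul, Algebra.ofId_apply, Algebra.smul_def]
  have h2 := unitPt_convPt (AlgHom.id ℚ HBar)
  rw [convPt, ← h] at h2
  ext g
  rw [← (Algebra.TensorProduct.lid ℚ HBar).injective.eq_iff]
  have := congrArg (fun f => f (MvPolynomial.X g)) h2
  simpa using this

theorem comulBar_lTensor_counit :
    (Algebra.TensorProduct.map (AlgHom.id ℚ HBar) counitBar).comp comulBar =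
      (Algebra.TensorProduct.rid ℚ ℚ HBar).symm := by
  have h : ((Algebra.TensorProduct.rid ℚ ℚ HBar).toAlgHom).comp
      (Algebra.TensorProduct.map (AlgHom.id ℚ HBar) counitBar) =
      liftPt (AlgHom.id ℚ HBar) (unitPt HBar) := by
    refine Algebra.TensorProduct.ext ?_ ?_ <;>
      refine MvPolynomial.algHom_ext fun g => ?_ <;>
      simp [unitPt, liftPt_tmul, Algebra.ofId_apply, Algebra.smul_def]
  have h2 := convPt_unitPt (AlgHom.id ℚ HBar)
  rw [convPt, ← h] at h2
  ext g
  rw [← (Algebra.TensorProduct.rid ℚ ℚ HBar).injective.eq_iff]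
  have := congrArg (fun f => f (MvPolynomial.X g)) h2
  simpa using this

open Mould

/-! ### The recursion for the inversion map -/

section InvSeries

variable {A : Type*} [CommRing A]

/-- The values of the variables that put `t_{j+1}` equal to zero. -/
def dropVar {d : ℕ} (j : Fin d) (a : Fin d) : Zc d A :=
  if a = j then 0 else ⟨MvPowerSeries.X a, MvPowerSeries.constantCoeff_X a⟩

theorem extend_dropVar {d : ℕ} (j : Fin d) : extend (dropVar (A := A) j) (j + 1) = 0 := by
  rw [extend, dif_pos ⟨by omega, j.2⟩, dropVar, if_pos (Fin.ext (by simp))]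

variable [Algebra ℚ A] {R : Type*} [CommRing R] [Algebra ℚ R] {n : ℕ}

/-- The value of the `k`-th member of a family of series, attached to the end points
`p_0, …, p_k`, at a point of `A` and at the values `s_0, …, s_{k-1}` of the variables. -/
def serOf (θ : A →ₐ[ℚ] R) (G : (k : ℕ) → (Fin (k + 1) → ℕ+) → MvPowerSeries (Fin k) A) (k : ℕ)
    (p : ℕ → ℕ+) (s : ℕ → Zc n R) : MvPowerSeries (Fin n) R :=
  evalSeries θ (fun a : Fin k => s a) (G k fun a => p a)

theorem serOf_congr (θ : A →ₐ[ℚ] R) (G : (k : ℕ) → (Fin (k + 1) → ℕ+) → MvPowerSeries (Fin k) A)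
    {k k' : ℕ} {p p' : ℕ → ℕ+} {s s' : ℕ → Zc n R} (hk : k = k')
    (hp : ∀ a ≤ k, p a = p' a) (hs : ∀ a < k, s a = s' a) :
    serOf θ G k p s = serOf θ G k' p' s' := by
  subst hk
  have h1 : (fun a : Fin (k + 1) => p a) = fun a : Fin (k + 1) => p' a :=
    funext fun a => hp a (Nat.lt_succ_iff.1 a.2)
  have h2 : (fun a : Fin k => s a) = fun a : Fin k => s' a := funext fun a => hs a a.2
  rw [serOf, serOf, h1, h2]

theorem evalSeries_subst_eq_serOf (θ : A →ₐ[ℚ] R)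
    (G : (k : ℕ) → (Fin (k + 1) → ℕ+) → MvPowerSeries (Fin k) A) {d k : ℕ} (s : Fin d → Zc n R)
    (p : ℕ → ℕ+) {u : Fin k → MvPowerSeries (Fin d) A} {t : ℕ → Zc n R}
    (hu : ∀ a, (u a).constantCoeff = 0)
    (h : ∀ a, evalSeries θ s (u a) = (t a : MvPowerSeries (Fin n) R)) :
    evalSeries θ s (MvPowerSeries.subst u (G k fun a => p a)) = serOf θ G k p t := by
  rw [evalSeries_subst θ s hu, serOf, evalSeries_apply]
  simp only [h]

theorem coeff_evalSeries_dropVar {d : ℕ} (j : Fin d) (f : MvPowerSeries (Fin d) A)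
    {m : Fin d →₀ ℕ} (hm : m j = 0) :
    MvPowerSeries.coeff m (evalSeries (AlgHom.id ℚ A) (dropVar j) f) =
      MvPowerSeries.coeff m f := by
  classical
  have hmap : MvPowerSeries.map (AlgHom.id ℚ A).toRingHom f = f := by
    ext e; simp
  rw [evalSeries_apply, hmap, MvPowerSeries.coeff_subst
    (MvPowerSeries.hasSubst_of_constantCoeff_zero fun a => constantCoeff_coe_zc _),
    finsum_eq_single _ m]
  · have h : (m.prod fun a e => (dropVar (A := A) j a : MvPowerSeries (Fin d) A) ^ e) =
        MvPowerSeries.monomial m 1 := by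
      rw [MvPowerSeries.monomial_one_eq]
      refine Finsupp.prod_congr fun a ha => ?_
      rw [dropVar, if_neg]
      rintro rfl
      exact (Finsupp.mem_support_iff.1 ha) hm
    rw [h, MvPowerSeries.coeff_monomial_same, smul_eq_mul, mul_one]
  · intro e he
    by_cases hj : e j = 0
    · have h : (e.prod fun a k => (dropVar (A := A) j a : MvPowerSeries (Fin d) A) ^ k) =
          MvPowerSeries.monomial e 1 := by
        rw [MvPowerSeries.monomial_one_eq]
        refine Finsupp.prod_congr fun a ha => ?_
        rw [dropVar, if_neg]
        rintro rfl
        exact (Finsupp.mem_support_iff.1 ha) hj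
      rw [h, MvPowerSeries.coeff_monomial_ne he.symm, smul_zero]
    · have h : (e.prod fun a k => (dropVar (A := A) j a : MvPowerSeries (Fin d) A) ^ k) = 0 := by
        refine Finset.prod_eq_zero (Finsupp.mem_support_iff.2 hj) ?_
        simp [dropVar, hj]
      rw [h, map_zero, smul_zero]

/-- A series that vanishes for `t_{j+1} = 0` is divisible by `t_{j+1}`. -/
theorem X_mul_divVar {d : ℕ} {j : Fin d} {f : MvPowerSeries (Fin d) A}
    (h : evalSeries (AlgHom.id ℚ A) (dropVar j) f = 0) :
    MvPowerSeries.X j * divVar j f = f := by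
  have hd : MvPowerSeries.X j ∣ f := MvPowerSeries.X_dvd_iff.2 fun m hm => by
    rw [← coeff_evalSeries_dropVar j f hm, h, map_zero]
  obtain ⟨g, rfl⟩ := hd
  rw [divVar_X_mul]

/-- The numerator of the terms with the denominator `t_{j+1}` in the recursion for `INV`. -/
def invNumerator {d : ℕ} (p : Fin (d + 1) → ℕ+) (j : Fin d) : MvPowerSeries (Fin d) HSymb :=
  MvPowerSeries.subst
      (fun a : Fin (j : ℕ) => (tVar d (a + 1) - tVar d (j + 1) : MvPowerSeries (Fin d) HSymb))
      (invSeries j fun a => pt p (a + 1)) *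
    expSeries (logTo (fun r => MvPolynomial.X (RegGen.log r)) (pt p 1) (pt p (d + 1)))
      (tVar d (j + 1)) *
    brReg (fun a : Fin (d - (j + 1) + 1) => pt p (j + 1 + 1 + a))
      (fun a : Fin (d - (j + 1)) => tVar d (j + 1 + 1 + a) - tVar d (j + 1)) -
  MvPowerSeries.subst
      (fun a : Fin (j : ℕ) => (tVar d (a + 1) : MvPowerSeries (Fin d) HSymb))
      (invSeries j fun a => pt p (a + 1)) *
    brReg (fun a : Fin (d - (j + 1) + 1) => pt p (j + 1 + 1 + a))
      (fun a : Fin (d - (j + 1)) => tVar d (j + 1 + 1 + a))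

theorem invSeries_zero (p : Fin 1 → ℕ+) : invSeries 0 p = 1 := by
  rw [invSeries, if_pos rfl]

theorem invSeries_eq {d : ℕ} (hd : d ≠ 0) (p : Fin (d + 1) → ℕ+) : invSeries d p =
    ∑ j : Fin d, (-1) ^ (d - 1 + j : ℕ) *
      (MvPowerSeries.subst (fun a : Fin (j : ℕ) => (tVar d (a + 1) : MvPowerSeries (Fin d) HSymb))
          (invSeries j fun a => pt p (a + 1)) *
        brReg (fun a : Fin (d - j + 1) => pt p (j + 1 + a))
          (fun a : Fin (d - j) => tVar d (j + 1 + a))) +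
    ∑ j : Fin d, (-1) ^ (d + (j + 1) : ℕ) * divVar j (invNumerator p j) := by
  conv_lhs => rw [invSeries, if_neg hd]
  rfl

theorem evalSeries_invNumerator (θ : HSymb →ₐ[ℚ] R) {d : ℕ} (s : Fin d → Zc n R)
    (p : Fin (d + 1) → ℕ+) (j : Fin d) :
    evalSeries θ s (invNumerator p j) =
      serOf θ invSeries j (fun a => pt p (a + 1))
          (fun a => extend s (a + 1) - extend s (j + 1)) *
        expSeries (θ (logTo (fun r => MvPolynomial.X (RegGen.log r)) (pt p 1) (pt p (d + 1))))
          (extend s (j + 1) : MvPowerSeries (Fin n) R) *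
        serOf θ genReg (d - (j + 1)) (fun a => pt p (j + 1 + 1 + a))
          (fun a => extend s (j + 1 + 1 + a) - extend s (j + 1)) -
      serOf θ invSeries j (fun a => pt p (a + 1)) (fun a => extend s (a + 1)) *
        serOf θ genReg (d - (j + 1)) (fun a => pt p (j + 1 + 1 + a))
          (fun a => extend s (j + 1 + 1 + a)) := by
  rw [invNumerator, brReg, brReg, map_sub, map_mul, map_mul, map_mul,
    evalSeries_expSeries _ _ _ (constantCoeff_tVar _ _), evalSeries_tVar]
  refine congrArg₂ (· - ·) ?_ ?_
  · refine congrArg₂ (· * ·) (congrArg (· * _) ?_) ?_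
    · exact evalSeries_subst_eq_serOf θ invSeries s (fun a => pt p (a + 1)) (fun a => constantCoeff_tVar_sub HSymb _ _ _)
        fun a => by rw [map_sub, evalSeries_tVar, evalSeries_tVar]; rfl
    · exact evalSeries_subst_eq_serOf θ genReg s (fun a => pt p (j + 1 + 1 + a)) (fun a => constantCoeff_tVar_sub HSymb _ _ _)
        fun a => by rw [map_sub, evalSeries_tVar, evalSeries_tVar]; rfl
  · refine congrArg₂ (· * ·) ?_ ?_
    · exact evalSeries_subst_eq_serOf θ invSeries s (fun a => pt p (a + 1)) (fun a => constantCoeff_tVar _ _)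
        fun a => by rw [evalSeries_tVar]
    · exact evalSeries_subst_eq_serOf θ genReg s (fun a => pt p (j + 1 + 1 + a)) (fun a => constantCoeff_tVar _ _)
        fun a => by rw [evalSeries_tVar]

/-- The poles in the recursion for `INV` cancel. -/
theorem X_mul_divVar_invNumerator {d : ℕ} (p : Fin (d + 1) → ℕ+) (j : Fin d) :
    MvPowerSeries.X j * divVar j (invNumerator p j) = invNumerator p j := by
  refine X_mul_divVar ?_
  rw [evalSeries_invNumerator, extend_dropVar]
  simp only [sub_zero, AddSubgroup.coe_zero, expSeries_eq, mul_zero, expS_zero, mul_one, sub_self]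

theorem evalSeries_invSeries (θ : HSymb →ₐ[ℚ] R) {d : ℕ} (hd : d ≠ 0) (s : Fin d → Zc n R)
    (p : Fin (d + 1) → ℕ+) :
    evalSeries θ s (invSeries d p) =
      ∑ j : Fin d, (-1) ^ (d - 1 + j : ℕ) *
        (serOf θ invSeries j (fun a => pt p (a + 1)) (fun a => extend s (a + 1)) *
          serOf θ genReg (d - j) (fun a => pt p (j + 1 + a)) (fun a => extend s (j + 1 + a))) +
      ∑ j : Fin d, (-1) ^ (d + (j + 1) : ℕ) *
        evalSeries θ s (divVar j (invNumerator p j)) := by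
  rw [invSeries_eq hd, map_add, map_sum, map_sum]
  congr 1
  · refine Finset.sum_congr rfl fun j _ => ?_
    rw [map_mul, map_mul, map_pow, map_neg, map_one]
    refine congrArg (_ * ·) (congrArg₂ (· * ·) ?_ ?_)
    · exact evalSeries_subst_eq_serOf θ invSeries s (fun a => pt p (a + 1)) (fun a => constantCoeff_tVar _ _)
        fun a => by rw [evalSeries_tVar]
    · exact evalSeries_subst_eq_serOf θ genReg s (fun a => pt p (j + 1 + a)) (fun a => constantCoeff_tVar _ _)
        fun a => by rw [evalSeries_tVar]
  · refine Finset.sum_congr rfl fun j _ => ?_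
    rw [map_mul, map_pow, map_neg, map_one]

theorem extend_mul_divVar_invNumerator (θ : HSymb →ₐ[ℚ] R) {d : ℕ} (s : Fin d → Zc n R)
    (p : Fin (d + 1) → ℕ+) (j : Fin d) :
    (extend s (j + 1) : MvPowerSeries (Fin n) R) *
      evalSeries θ s (divVar j (invNumerator p j)) = evalSeries θ s (invNumerator p j) := by
  conv_rhs => rw [← X_mul_divVar_invNumerator p j]
  rw [map_mul]
  congr 1
  have h := evalSeries_tVar θ s (j + 1)
  rw [tVar, dif_pos ⟨by omega, j.2⟩] at h
  exact h.symm

end InvSeries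

/-! ### The moulds of a point that factors through the inversion map -/

section InvPoint

variable {R : Type*} [CommRing R] [Algebra ℚ R] {n : ℕ} {L : Type*} [CommRing L]

theorem map_genReg_succ {d : ℕ} (θ : HSymb →ₐ[ℚ] R) (p : Fin (d + 2) → ℕ+)
    (hp : StrictMono p) (m : Fin (d + 1) →₀ ℕ) :
    MvPowerSeries.coeff m (MvPowerSeries.map θ.toRingHom (genReg (d + 1) p)) =
      θ (MvPolynomial.X (RegGen.poly d p hp fun r => (m r).succPNat)) := by
  rw [MvPowerSeries.coeff_map]
  refine congrArg θ ?_
  change genReg (d + 1) p m = _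
  rw [genReg]
  exact dif_pos hp

theorem INV_X (g : BarGen) : INV (MvPolynomial.X g) = invGen g := by
  rw [INV, MvPolynomial.aeval_X]

theorem map_INV_genBar_of_strictMono (θ : HSymb →ₐ[ℚ] R) {k : ℕ} (p : Fin (k + 1) → ℕ+)
    (hp : StrictMono p) :
    MvPowerSeries.map (θ.comp INV).toRingHom (genBar k p) =
      MvPowerSeries.map θ.toRingHom (genReg k p) := by
  cases k with
  | zero => rw [genBar, genReg, map_one, map_one]
  | succ d =>
    ext m
    rw [map_genBar_succ _ _ (Or.inl hp), map_genReg_succ _ _ hp, AlgHom.comp_apply, INV_X, invGen,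
      dif_pos hp]

/-- The coefficients of the series of inverted symbols, which is obtained from `invSeries` by
reversing the order of the variables and changing their signs. -/
theorem coeff_map_INV_genBar_of_strictAnti (θ : HSymb →ₐ[ℚ] R) {k : ℕ} (p : Fin (k + 1) → ℕ+)
    (hp : StrictAnti p) (m : Fin k →₀ ℕ) :
    MvPowerSeries.coeff m (MvPowerSeries.map (θ.comp INV).toRingHom (genBar k p)) =
      (-1) ^ (∑ a, m a) * MvPowerSeries.coeff (Finsupp.equivMapDomain Fin.revPerm m)
        (MvPowerSeries.map θ.toRingHom (invSeries k fun a => p (Fin.rev a))) := by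
  cases k with
  | zero =>
    have h : Finsupp.equivMapDomain Fin.revPerm m = m := Subsingleton.elim _ _
    rw [invSeries_zero, genBar, map_one (MvPowerSeries.map _), map_one (MvPowerSeries.map _), h, Finset.univ_eq_empty, Finset.sum_empty,
      pow_zero, one_mul]
  | succ d =>
    have hp' : ¬ StrictMono p := fun h => by
      have h1 := h (Fin.zero_lt_one (n := d))
      have h2 := hp (Fin.zero_lt_one (n := d))
      exact lt_asymm h1 h2
    have h1 : (expo fun r => (m (Fin.rev r)).succPNat) = Finsupp.equivMapDomain Fin.revPerm m := by
      ext r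
      simp [expo, Finsupp.equivMapDomain_apply]
    rw [map_genBar_succ _ _ (Or.inr hp), AlgHom.comp_apply, INV_X, invGen, dif_neg hp',
      MvPowerSeries.coeff_map, h1, map_mul, map_pow, map_neg, map_one]
    simp only [Nat.succPNat_coe, Nat.succ_sub_one]
    rfl

/-- A point that factors through `INV` has the expected values at the regular symbols. -/
theorem serOf_genBar_of_strictMonoOn (θ : HSymb →ₐ[ℚ] R) {k : ℕ} {p : ℕ → ℕ+}
    (hp : StrictMonoOn p (Set.Iic k)) (s : ℕ → Zc n R) :
    ser (θ.comp INV) k p s = serOf θ genReg k p s := by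
  rw [ser, serOf, evalSeries_apply, map_INV_genBar_of_strictMono θ]
  intro a b hab
  exact hp (Nat.lt_succ_iff.1 a.2) (Nat.lt_succ_iff.1 b.2) hab

/-- The values at the inverted symbols of a point that factors through `INV`, in the order and with
the signs of the variables that the recursion uses. -/
theorem ser_INV_of_strictMonoOn_rev (θ : HSymb →ₐ[ℚ] R) {k : ℕ} {p : ℕ → ℕ+}
    (hp : StrictMonoOn p (Set.Iic k)) (s : ℕ → Zc n R) :
    ser (θ.comp INV) k (fun a => p (k - a)) (fun a => -s (k - 1 - a)) =
      serOf θ invSeries k p s := by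
  have hp' : StrictAnti fun a : Fin (k + 1) => p (k - a) := by
    intro a b hab
    have : (a : ℕ) < b := hab
    have := b.2
    exact hp (Set.mem_Iic.2 (by omega)) (Set.mem_Iic.2 (by omega)) (by omega)
  rw [ser, serOf, evalSeries_apply]
  ext e
  rw [MvPowerSeries.coeff_subst (MvPowerSeries.hasSubst_of_constantCoeff_zero fun a =>
      constantCoeff_coe_zc _), MvPowerSeries.coeff_subst
      (MvPowerSeries.hasSubst_of_constantCoeff_zero fun a => constantCoeff_coe_zc _)]
  refine (finsum_congr fun m => ?_).trans
    (finsum_comp_equiv (Finsupp.equivCongrLeft (Fin.revPerm (n := k))))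
  rw [coeff_map_INV_genBar_of_strictAnti θ _ hp']
  have h1 : (fun a : Fin (k + 1) => p (k - (Fin.rev a : Fin (k + 1)))) = fun a : Fin (k + 1) => p a := by
    funext a
    congr 1
    rw [Fin.val_rev]
    omega
  rw [h1]
  have h2 : (m.prod fun (a : Fin k) e => ((-s (k - 1 - a) : Zc n R) : MvPowerSeries (Fin n) R) ^ e) =
      (-1) ^ (∑ a, m a) * ((Finsupp.equivCongrLeft Fin.revPerm m).prod fun (a : Fin k) e =>
        ((s a : Zc n R) : MvPowerSeries (Fin n) R) ^ e) := by
    rw [Finsupp.prod_fintype _ _ (fun _ => pow_zero _), Finsupp.prod_fintype _ _ (fun _ => pow_zero _),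
      ← Finset.prod_pow_eq_pow_sum, ← Equiv.prod_comp Fin.revPerm (fun a : Fin k =>
        ((s a : Zc n R) : MvPowerSeries (Fin n) R) ^ (Finsupp.equivCongrLeft Fin.revPerm m) a),
      ← Finset.prod_mul_distrib]
    refine Finset.prod_congr rfl fun a _ => ?_
    have h3 : k - 1 - (a : ℕ) = Fin.rev a := by rw [Fin.val_rev]; omega
    simp only [Fin.revPerm_apply, h3, Fin.rev_rev, Finsupp.equivCongrLeft_apply, Finsupp.equivMapDomain_apply,
      Fin.revPerm_symm, AddSubgroup.coe_neg]
    rw [← mul_pow, neg_one_mul]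
  rw [h2]
  have h4 : ((-1 : MvPowerSeries (Fin n) R)) ^ (∑ a, m a) =
      MvPowerSeries.C ((-1 : R) ^ (∑ a, m a)) := by simp
  rw [h4, MvPowerSeries.coeff_C_mul, smul_eq_mul, smul_eq_mul, Finsupp.equivCongrLeft_apply]
  have h5 : ((-1 : R) ^ (∑ a, m a)) * (-1) ^ (∑ a, m a) = 1 := by
    rw [← mul_pow]; simp
  linear_combination (MvPowerSeries.coeff (Finsupp.equivMapDomain Fin.revPerm m)
    (MvPowerSeries.map θ.toRingHom (invSeries k fun a => p a)) * MvPowerSeries.coeff e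
      ((Finsupp.equivMapDomain Fin.revPerm m).prod fun (a : Fin k) e =>
        ((s a : Zc n R) : MvPowerSeries (Fin n) R) ^ e)) * h5

end InvPoint

open Mould

/-! ### The inversion relation -/

section Pole

variable {P T K : Type*} [CommRing K]

/-- The mould of depth one with the values `ι t`. -/
def pole (ι : T → K) : Mould P T K
  | [x], _ => ι x.2
  | _, _ => 0

theorem pole_nil (ι : T → K) (q : P) : (pole ι : Mould P T K) [] q = 0 := rfl

theorem tail_pole (ι : T → K) (x : P × T) :
    (pole ι : Mould P T K).tail x = cst fun _ => ι x.2 := by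
  ext w q
  cases w <;> rfl

theorem mul_pole_mul_seg (N F : Mould P T K) (ι : T → K) (c : ℕ → P) (τ : ℕ → T) {i j : ℕ}
    (h : i ≤ j) : (N * (pole ι : Mould P T K) * F) (seg c τ i j) (c j) =
      ∑ m ∈ Finset.Ico i j, ι (τ m) * (N (seg c τ i m) (c m) * F (seg c τ (m + 1) j) (c j)) := by
  rw [mul_assoc, mul_seg _ _ _ _ h, ← Finset.sum_Ico_add_eq_sum_Icc h, seg_self c τ (le_refl j)]
  simp only [mul_nil, pole_nil, zero_mul, mul_zero, add_zero]
  refine Finset.sum_congr rfl fun m hm => ?_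
  rw [seg_cons c τ (Finset.mem_Ico.1 hm).2, mul_cons, tail_pole, pole_nil, cst_mul_apply]
  ring

variable [AddCommGroup T] [DecidableEq T]

/-- A substitution applied to a mould of depth one is a sum over a single block with a marked letter. -/
theorem SubstData.gax_pole_seg (D : SubstData P T K) (ι : T → K) (c : ℕ → P) (τ : ℕ → T) {i j : ℕ}
    (h : i ≤ j) : D.gax (pole ι) (seg c τ i j) (c j) =
      ∑ m ∈ Finset.Ico i j, ι (τ m) * D.blockTerm c τ i m j := by
  rcases h.eq_or_lt with rfl | h
  · simp [seg_self c τ le_rfl, SubstData.gax_nil, pole_nil]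
  · have e : D.gax (pole ι) (seg c τ i j) (c j) = ∑ s ∈ vars (seg c τ i j),
        (D.block s * D.gax ((pole ι : Mould P T K).tail (c i, s))) (seg c τ i j) (c j) := by
      rw [seg_cons c τ h, gax_cons]
    have hv : ∀ m ∈ Finset.Ico i j, τ m ∈ vars (seg c τ i j) := fun m hm => by
      have hm := Finset.mem_Ico.1 hm
      refine mem_vars.2 ⟨(c m, τ m), ?_, rfl⟩
      simp only [seg, List.mem_map, List.mem_range']
      exact ⟨m, ⟨m - i, by omega, by omega⟩, rfl⟩
    rw [e]
    simp only [tail_pole, gax_cst, mul_cst_apply, block_seg _ _ _ _ h.le, Finset.sum_mul]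
    rw [Finset.sum_comm]
    refine Finset.sum_congr rfl fun m hm => ?_
    simp only [ite_mul, zero_mul]
    rw [Finset.sum_ite_eq (vars (seg c τ i j)) (τ m), if_pos (hv m hm), mul_comm]

end Pole

section Relation

variable {R : Type*} [CommRing R] [Algebra ℚ R] {n : ℕ} {L : Type*} [CommRing L]

theorem iota_ptMould_seg_INV (κ : MvPowerSeries (Fin n) R →+* L) (θ : HSymb →ₐ[ℚ] R)
    {c : ℕ → ℕ+} (τ : ℕ → Zc n R) {i j : ℕ} (h : i ≤ j) (hc : StrictMonoOn c (Set.Icc i j)) :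
    iota (ptMould κ (θ.comp INV)) (seg c τ i j) (c j) = (-1) ^ (j - i) *
      κ (serOf θ invSeries (j - i) (fun a => c (a + i)) fun a => τ (a + i)) := by
  rw [iota_ptMould_seg _ _ _ _ h, ← ser_INV_of_strictMonoOn_rev]
  · congr 2
    refine ser_congr _ rfl (fun a ha => ?_) fun a ha => ?_
    · congr 1; omega
    · congr 2; omega
  · intro a ha b hb hab
    have ha : a ≤ j - i := ha
    have hb : b ≤ j - i := hb
    exact hc (Set.mem_Icc.2 (by omega)) (Set.mem_Icc.2 (by omega)) (by omega)

theorem ptMould_seg_INV (κ : MvPowerSeries (Fin n) R →+* L) (θ : HSymb →ₐ[ℚ] R)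
    {c : ℕ → ℕ+} (τ : ℕ → Zc n R) {i j : ℕ} (h : i ≤ j) (hc : StrictMonoOn c (Set.Icc i j)) :
    ptMould κ (θ.comp INV) (seg c τ i j) (c j) =
      κ (serOf θ genReg (j - i) (fun a => c (i + a)) fun a => τ (i + a)) := by
  rw [ptMould_seg _ _ _ _ h, serOf_genBar_of_strictMonoOn]
  intro a ha b hb hab
  have ha : a ≤ j - i := ha
  have hb : b ≤ j - i := hb
  exact hc (Set.mem_Icc.2 (by omega)) (Set.mem_Icc.2 (by omega)) (by omega)

theorem map_logTo {A B : Type*} [CommRing A] [CommRing B] [Algebra ℚ A] [Algebra ℚ B]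
    (f : A →ₐ[ℚ] B) (l : ℕ+ → A) (a b : ℕ+) :
    f (logTo l a b) = logTo (fun r => f (l r)) a b := by
  simp [logTo]

theorem INV_log (r : ℕ+) :
    INV (MvPolynomial.X (BarGen.log r)) = MvPolynomial.X (RegGen.log r) := INV_X _

/-- The block of a point that factors through `INV` is the term of the recursion for `INV` with the
exponential. -/
theorem blockTerm_INV (κ : MvPowerSeries (Fin n) R →+* L) (θ : HSymb →ₐ[ℚ] R)
    {c : ℕ → ℕ+} (τ : ℕ → Zc n R) {i j i' : ℕ} (hij : i ≤ j) (hji : j < i')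
    (hc : StrictMonoOn c (Set.Icc i i')) :
    (ptData κ (θ.comp INV)).blockTerm c τ i j i' =
      (-1) ^ (j - i) * (κ (serOf θ invSeries (j - i) (fun a => c (a + i))
          fun a => τ (a + i) - τ j) *
        κ (expSeries (θ (logTo (fun r => MvPolynomial.X (RegGen.log r)) (c i) (c i')))
          (τ j : MvPowerSeries (Fin n) R)) *
        κ (serOf θ genReg (i' - (j + 1)) (fun a => c (j + 1 + a))
          fun a => τ (j + 1 + a) - τ j)) := by
  rw [SubstData.blockTerm]
  change ev (ptChars κ _) _ _ * ev (ptChars κ _) _ _ *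
    (iota (ptMould κ _) _ _ * ptMould κ _ _ _) = _
  rw [ev_ptChars_mul, shiftWord_seg, shiftWord_seg,
    iota_ptMould_seg_INV κ θ _ hij (hc.mono (Set.Icc_subset_Icc_right hji.le)),
    ptMould_seg_INV κ θ _ hji (hc.mono (Set.Icc_subset_Icc_left (by omega))), map_logTo]
  simp only [AlgHom.comp_apply, INV_log]
  rw [← map_logTo]
  ring

theorem serOf_pt_extend {A : Type*} [CommRing A] [Algebra ℚ A] (θ : A →ₐ[ℚ] R)
    (G : (k : ℕ) → (Fin (k + 1) → ℕ+) → MvPowerSeries (Fin k) A) {d : ℕ}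
    (p : Fin (d + 1) → ℕ+) (s : Fin d → Zc n R) :
    serOf θ G d (fun a => pt p (a + 1)) (fun a => extend s (a + 1)) = evalSeries θ s (G d p) := by
  have h1 : (fun a : Fin (d + 1) => pt p (a + 1)) = p := by
    funext a
    rw [pt]
    congr 1
    ext
    have := a.2
    simp; omega
  have h2 : (fun a : Fin d => extend s (a + 1)) = s := by
    funext a
    rw [extend, dif_pos ⟨by omega, a.2⟩]
    rfl
  rw [serOf, h1, h2]

theorem neg_one_pow_mul_self {A : Type*} [CommRing A] (e : ℕ) : (-1 : A) ^ e * (-1) ^ e = 1 := by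
  rw [← mul_pow, neg_one_mul, neg_neg, one_pow]

/-- The recursion that defines `INV`, written as a relation between moulds. -/
theorem inversion_relation_seg (κ : MvPowerSeries (Fin n) R →+* L) (ι : Zc n R → L)
    (θ : HSymb →ₐ[ℚ] R) {d : ℕ} (p : Fin (d + 1) → ℕ+) (s : Fin d → Zc n R)
    (hc : StrictMonoOn (pt p) (Set.Icc 1 (d + 1)))
    (hι : ∀ j, 1 ≤ j → j ≤ d → κ (extend s j : MvPowerSeries (Fin n) R) * ι (extend s j) = 1) :
    ((ptData κ (θ.comp INV)).N * (1 - pole ι : Mould ℕ+ (Zc n R) L) *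
        (ptData κ (θ.comp INV)).F)
        (seg (pt p) (extend s) 1 (d + 1)) (pt p (d + 1)) =
      (ptData κ (θ.comp INV)).gax (1 - pole ι) (seg (pt p) (extend s) 1 (d + 1))
        (pt p (d + 1)) := by
  set D := ptData κ (θ.comp INV) with hD
  have e1 : D.N * (1 - pole ι : Mould ℕ+ (Zc n R) L) * D.F =
      D.N * D.F - D.N * (pole ι : Mould ℕ+ (Zc n R) L) * D.F := by
    rw [mul_sub, sub_mul, mul_one]
  rw [e1, map_sub, map_one, Mould.sub_apply, Mould.sub_apply, mul_pole_mul_seg _ _ _ _ _ (by omega),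
    D.gax_pole_seg _ _ _ (by omega), mul_seg _ _ _ _ (by omega)]
  by_cases hd : d = 0
  · subst hd
    have hN : D.N [] (pt p 1) = 1 := by rw [hD, ptData_N, iota_nil, ptMould_nil]
    have hF : D.F [] (pt p 1) = 1 := by rw [hD, ptData_F, ptMould_nil]
    have h1 : seg (pt p) (extend s) 1 (0 + 1) = [] := seg_self _ _ le_rfl
    simp [seg_self _ _ le_rfl, hN, hF]
    rw [h1, one_nil]
  have e2 : (1 : Mould ℕ+ (Zc n R) L) (seg (pt p) (extend s) 1 (d + 1)) (pt p (d + 1)) = 0 := by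
    rw [seg_cons _ _ (by omega), one_cons]
  have hN : ∀ j, j ≤ d → D.N (seg (pt p) (extend s) 1 (j + 1)) (pt p (j + 1)) = (-1) ^ j *
      κ (serOf θ invSeries j (fun a => pt p (a + 1)) fun a => extend s (a + 1)) := fun j hj =>
    iota_ptMould_seg_INV κ θ _ (by omega) (hc.mono (Set.Icc_subset_Icc_right (by omega)))
  have hF : ∀ j, 1 ≤ j → j ≤ d + 1 → D.F (seg (pt p) (extend s) j (d + 1)) (pt p (d + 1)) =
      κ (serOf θ genReg (d + 1 - j) (fun a => pt p (j + a)) fun a => extend s (j + a)) :=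
    fun j h1 h2 => ptMould_seg_INV κ θ _ h2 (hc.mono (Set.Icc_subset_Icc_left h1))
  have hS : ∀ f : ℕ → L, ∑ m ∈ Finset.Ico 1 (d + 1), f m = ∑ j : Fin d, f (j + 1) := fun f => by
    rw [Finset.sum_Ico_eq_sum_range, Fin.sum_univ_eq_sum_range (fun j => f (j + 1))]
    refine Finset.sum_congr rfl fun j _ => by rw [add_comm]
  rw [e2, ← Finset.sum_Ico_add_eq_sum_Icc (by omega), hS, hS, hS, hN d le_rfl,
    serOf_pt_extend, evalSeries_invSeries θ hd, hF (d + 1) (by omega) le_rfl]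
  have e3 : serOf θ genReg (d + 1 - (d + 1)) (fun a => pt p (d + 1 + a))
      (fun a => extend s (d + 1 + a)) = 1 := by
    rw [serOf_congr θ genReg (Nat.sub_self (d + 1)) (fun _ _ => rfl) (fun _ _ => rfl), serOf,
      genReg, map_one]
  rw [e3, map_one κ, mul_one, map_add, map_sum, map_sum, mul_add, Finset.mul_sum, Finset.mul_sum,
    ← Finset.sum_add_distrib, ← Finset.sum_add_distrib, ← Finset.sum_sub_distrib, zero_sub,
    ← Finset.sum_neg_distrib]
  refine Finset.sum_congr rfl fun j _ => ?_
  have hj := j.2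
  -- the equality holds for each marked letter: the poles of the block and of the product combine
  -- to the quotient `divVar j (invNumerator p j)`
  have hdiv := congrArg κ (extend_mul_divVar_invNumerator θ s p j)
  rw [evalSeries_invNumerator, map_mul, map_sub, map_mul, map_mul, map_mul] at hdiv
  have hb := blockTerm_INV κ θ (c := pt p) (extend s) (i := 1) (j := j + 1) (i' := d + 1) (by omega)
    (by omega) hc
  have e4 : d + 1 - (j + 1) = d - j := by omega
  have e5 : d + 1 - (j + 1 + 1) = d - (j + 1) := by omega
  rw [e5, Nat.add_sub_cancel] at hb
  rw [hb, hN j (by omega), hF (j + 1) (by omega) (by omega), hF (j + 1 + 1) (by omega) (by omega),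
    e4, e5, map_mul, map_mul, map_mul, map_pow, map_pow, map_neg, map_one κ]
  have hι' := hι (j + 1) (by omega) (by omega)
  obtain ⟨e, rfl⟩ : ∃ e, d = e + 1 := ⟨d - 1, by omega⟩
  rw [Nat.add_sub_cancel]
  generalize κ (extend s (j + 1) : MvPowerSeries (Fin n) R) = t at *
  generalize ι (extend s (j + 1)) = u at *
  generalize κ (evalSeries θ s (divVar j (invNumerator p j))) = D at *
  generalize κ (serOf θ invSeries j (fun a => pt p (a + 1))
          (fun a => extend s (a + 1) - extend s (j + 1))) = a1 at *
  generalize κ (expSeries (θ (logTo (fun r => MvPolynomial.X (RegGen.log r)) (pt p 1)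
    (pt p (e + 1 + 1)))) (extend s (j + 1) : MvPowerSeries (Fin n) R)) = a2 at *
  generalize κ (serOf θ genReg (e + 1 - (j + 1)) (fun a => pt p (j + 1 + 1 + a))
          (fun a => extend s (j + 1 + 1 + a) - extend s (j + 1))) = a3 at *
  generalize κ (serOf θ invSeries j (fun a => pt p (a + 1)) (fun a => extend s (a + 1))) = a4 at *
  generalize κ (serOf θ genReg (e + 1 - (j + 1)) (fun a => pt p (j + 1 + 1 + a))
          (fun a => extend s (j + 1 + 1 + a))) = a5 at *
  generalize κ (serOf θ genReg (e + 1 - j) (fun a => pt p (j + 1 + a))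
          (fun a => extend s (j + 1 + a))) = a6 at *
  have hs := neg_one_pow_mul_self (A := L) e
  have hD' : D = u * (a1 * a2 * a3 - a4 * a5) := by linear_combination u * hdiv - D * hι'
  rw [hD']
  simp only [pow_add, pow_one]
  linear_combination ((-1) ^ (j : ℕ) * (-a4 * a6 - u * (a1 * a2 * a3 - a4 * a5))) * hs

end Relation

open Mould SubstData

/-! ### Stability of the inversion relation -/

section GoodWords

variable {R : Type*} [CommRing R] {n : ℕ} {L : Type*} [CommRing L]

/-- The words with increasing points at whose variables `ι` is the inverse. -/
def GoodWord (κ : MvPowerSeries (Fin n) R →+* L) (ι : Zc n R → L) (w : List (ℕ+ × Zc n R))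
    (q : ℕ+) : Prop :=
  (w.map Prod.fst ++ [q]).Pairwise (· < ·) ∧
    ∀ x ∈ w, κ (x.2 : MvPowerSeries (Fin n) R) * ι x.2 = 1

theorem pairwise_append_head {P T : Type*} [LinearOrder P] {u v : List (P × T)} {q : P}
    (h : ((u ++ v).map Prod.fst ++ [q]).Pairwise (· < ·)) :
    (u.map Prod.fst ++ [head v q]).Pairwise (· < ·) ∧ (v.map Prod.fst ++ [q]).Pairwise (· < ·) := by
  rw [List.map_append, List.append_assoc] at h
  refine ⟨h.sublist ((List.Sublist.refl _).append ?_), h.sublist (List.sublist_append_right _ _)⟩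
  cases v <;> simp [head]

theorem GoodWord.append {κ : MvPowerSeries (Fin n) R →+* L} {ι : Zc n R → L}
    {u v : List (ℕ+ × Zc n R)} {q : ℕ+} (h : GoodWord κ ι (u ++ v) q) :
    GoodWord κ ι u (head v q) ∧ GoodWord κ ι v q :=
  ⟨⟨(pairwise_append_head h.1).1, fun x hx => h.2 x (List.mem_append_left v hx)⟩,
    (pairwise_append_head h.1).2, fun x hx => h.2 x (List.mem_append_right u hx)⟩

theorem GoodWord.contract {κ : MvPowerSeries (Fin n) R →+* L} {ι : Zc n R → L}
    {u w : List (ℕ+ × Zc n R)} {q : ℕ+} (h : GoodWord κ ι w q)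
    (hu : (u.map Prod.fst).Sublist (w.map Prod.fst)) (hv : ∀ y ∈ u, y.2 ∈ vars w) :
    GoodWord κ ι u q := by
  refine ⟨h.1.sublist (hu.append (List.Sublist.refl _)), fun y hy => ?_⟩
  obtain ⟨x, hx, hxy⟩ := mem_vars.1 (hv y hy)
  rw [← hxy]
  exact h.2 x hx

theorem GoodWord.monoWord {κ : MvPowerSeries (Fin n) R →+* L} {ι : Zc n R → L}
    {w : List (ℕ+ × Zc n R)} {q : ℕ+} (h : GoodWord κ ι w q) : MonoWord w q := Or.inl h.1

theorem goodWord_seg {κ : MvPowerSeries (Fin n) R →+* L} {ι : Zc n R → L} {c : ℕ → ℕ+}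
    {τ : ℕ → Zc n R} {i j : ℕ} (h : i ≤ j) (hc : StrictMonoOn c (Set.Icc i j))
    (hι : ∀ m, i ≤ m → m < j → κ (τ m : MvPowerSeries (Fin n) R) * ι (τ m) = 1) :
    GoodWord κ ι (seg c τ i j) (c j) := by
  constructor
  · have e : (seg c τ i j).map Prod.fst ++ [c j] = (List.range' i (j - i + 1)).map c := by
      rw [List.range'_concat, List.map_append, seg, List.map_map]
      have : i + 1 * (j - i) = j := by omega
      rw [this]
      rfl
    rw [e, List.pairwise_map]
    refine List.Pairwise.imp_of_mem (fun {a b} ha hb hab => ?_) List.pairwise_lt_range'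
    rw [List.mem_range'_1] at ha hb
    exact hc (Set.mem_Icc.2 (by omega)) (Set.mem_Icc.2 (by omega)) hab
  · intro x hx
    simp only [seg, List.mem_map, List.mem_range'_1] at hx
    obtain ⟨m, hm, rfl⟩ := hx
    exact hι m hm.1 (by omega)

variable [Algebra ℚ R]

/-- The relation that defines `INV`, for an arbitrary point: on words with increasing points,
the substitution has the same effect on the mould `1 - 1/t` as multiplication with the mould `N`
from the left and with `F` from the right. -/
def InvRel (κ : MvPowerSeries (Fin n) R →+* L) (ι : Zc n R → L) (φ : HBar →ₐ[ℚ] R) : Prop :=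
  ∀ w q, GoodWord κ ι w q →
    ((ptData κ φ).N * (1 - pole ι : Mould ℕ+ (Zc n R) L) * (ptData κ φ).F) w q =
      (ptData κ φ).gax (1 - pole ι) w q

theorem invRel_INV (κ : MvPowerSeries (Fin n) R →+* L) (ι : Zc n R → L) (θ : HSymb →ₐ[ℚ] R) :
    InvRel κ ι (θ.comp INV) := by
  intro w q hw
  obtain ⟨p, hpe⟩ : ∃ p : Fin (w.length + 1) → ℕ+,
      p = fun a : Fin (w.length + 1) => (w.map Prod.fst).getD a q := ⟨_, rfl⟩
  obtain ⟨s, hse⟩ : ∃ s : Fin w.length → Zc n R,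
      s = fun a : Fin w.length => (w.map Prod.snd).getD a 0 := ⟨_, rfl⟩
  have hwe := word_eq_seg w q
  have hq : q = pt p (w.length + 1) := by simp [pt, hpe]
  have hp : ∀ a (ha : a < w.length + 1), pt p (a + 1) =
      (w.map Prod.fst ++ [q])[a]'(by simpa using ha) := by
    intro a ha
    have e : min a w.length = a := by omega
    simp only [pt, hpe, Nat.add_sub_cancel, e]
    rcases (Nat.lt_succ_iff.1 ha).eq_or_lt with ha' | ha'
    · rw [List.getD_eq_default _ _ (by simp [ha']), List.getElem_append_right (by simp [ha'])]
      simp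
    · rw [List.getD_eq_getElem _ _ (by simpa using ha'), List.getElem_append_left]
  have hc : StrictMonoOn (pt p) (Set.Icc 1 (w.length + 1)) := by
    intro a ha b hb hab
    have ha := Set.mem_Icc.1 ha
    have hb := Set.mem_Icc.1 hb
    obtain ⟨a, rfl⟩ : ∃ a', a = a' + 1 := ⟨a - 1, by omega⟩
    obtain ⟨b, rfl⟩ : ∃ b', b = b' + 1 := ⟨b - 1, by omega⟩
    rw [hp a (by omega), hp b (by omega)]
    exact List.pairwise_iff_getElem.1 hw.1 _ _ _ _ (by omega)
  have hι : ∀ j, 1 ≤ j → j ≤ w.length →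
      κ (extend s j : MvPowerSeries (Fin n) R) * ι (extend s j) = 1 := by
    intro j h1 h2
    have e : extend s j = (w[j - 1]'(by omega)).2 := by
      rw [extend, dif_pos ⟨h1, h2⟩, hse]
      have h3 : j - 1 < (w.map Prod.snd).length := by rw [List.length_map]; omega
      change (w.map Prod.snd).getD (j - 1) 0 = _
      rw [List.getD_eq_getElem _ _ h3, List.getElem_map]
    rw [e]
    exact hw.2 _ (List.getElem_mem _)
  rw [← hpe, ← hse] at hwe
  rw [hwe, hq]
  exact inversion_relation_seg κ ι θ p s hc hι

/-- The relation is stable under the convolution of points. -/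
theorem InvRel.convPt {κ : MvPowerSeries (Fin n) R →+* L} {ι : Zc n R → L} {φ ψ : HBar →ₐ[ℚ] R}
    (hφ : InvRel κ ι φ) (hψ : InvRel κ ι ψ) : InvRel κ ι (convPt φ ψ) := by
  intro w q hw
  have h := ptData_convPt_agree κ φ ψ
  rw [h.gax (fun _ _ _ => rfl) hw.monoWord, ← SubstData.comp_stabilizes (ptData κ φ) (ptData κ ψ)
    (1 - pole ι) (GoodWord κ ι) (fun u v q h => h.append) (fun u w q h1 h2 h => h.contract h1 h2)
    hφ hψ w q hw]
  refine mul_congr fun u v huv => ?_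
  rw [huv] at hw
  rw [h.F _ _ hw.append.2.monoWord]
  congr 1
  refine mul_congr fun u' v' huv' => ?_
  have hu := hw.append.1
  rw [huv'] at hu
  rw [h.N _ _ hu.append.1.monoWord]

/-- The relation expresses the values at decreasing words of length `d` through the values at
increasing words and at shorter decreasing words. -/
theorem InvRel.N_eq {κ : MvPowerSeries (Fin n) R →+* L} {ι : Zc n R → L} {φ : HBar →ₐ[ℚ] R}
    (hφ : InvRel κ ι φ) {c : ℕ → ℕ+} {τ : ℕ → Zc n R} {d : ℕ}
    (hc : StrictMonoOn c (Set.Icc 1 (d + 1)))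
    (hι : ∀ m, 1 ≤ m → m < d + 1 → κ (τ m : MvPowerSeries (Fin n) R) * ι (τ m) = 1) :
    (ptData κ φ).N (seg c τ 1 (d + 1)) (c (d + 1)) =
      (1 : Mould ℕ+ (Zc n R) L) (seg c τ 1 (d + 1)) (c (d + 1)) -
      ∑ m ∈ Finset.Ico 1 (d + 1), ι (τ m) * (ptData κ φ).blockTerm c τ 1 m (d + 1) +
      ∑ m ∈ Finset.Ico 1 (d + 1), ι (τ m) * ((ptData κ φ).N (seg c τ 1 m) (c m) *
        (ptData κ φ).F (seg c τ (m + 1) (d + 1)) (c (d + 1))) -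
      ∑ m ∈ Finset.Ico 1 (d + 1), (ptData κ φ).N (seg c τ 1 m) (c m) *
        (ptData κ φ).F (seg c τ m (d + 1)) (c (d + 1)) := by
  have h := hφ _ _ (goodWord_seg (by omega) hc hι)
  generalize hD : ptData κ φ = D at *
  have e1 : D.N * (1 - pole ι : Mould ℕ+ (Zc n R) L) * D.F =
      D.N * D.F - D.N * (pole ι : Mould ℕ+ (Zc n R) L) * D.F := by
    rw [mul_sub, sub_mul, mul_one]
  have e2 : D.F (seg c τ (d + 1) (d + 1)) (c (d + 1)) = 1 := by
    rw [seg_self _ _ le_rfl, ← hD, ptData_F, ptMould_nil]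
  rw [e1, map_sub, map_one, Mould.sub_apply, Mould.sub_apply, mul_pole_mul_seg _ _ _ _ _ (by omega),
    D.gax_pole_seg _ _ _ (by omega), mul_seg _ _ _ _ (by omega),
    ← Finset.sum_Ico_add_eq_sum_Icc (by omega), e2, mul_one] at h
  linear_combination h

end GoodWords

/-! ### The inversion map is compatible with the coproducts -/

section Uniqueness

variable {R : Type*} [CommRing R]

theorem isUnit_algebraMap_X {n : ℕ} (a : Fin n) : IsUnit (algebraMap (MvPowerSeries (Fin n) R)
    (FractionRing (MvPowerSeries (Fin n) R)) (MvPowerSeries.X a)) :=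
  IsLocalization.map_units _ (⟨MvPowerSeries.X a, MvPowerSeries.X_mem_nonzeroDivisors⟩ :
    nonZeroDivisors (MvPowerSeries (Fin n) R))

variable [Algebra ℚ R]

/-- A point with the relation that defines `INV` is determined by its values at the `[x_i]_0` and at
the regular symbols. -/
theorem map_genBar_eq_of_invRel {φ ψ : HBar →ₐ[ℚ] R}
    (hφ : ∀ n, InvRel (algebraMap (MvPowerSeries (Fin n) R)
      (FractionRing (MvPowerSeries (Fin n) R))) (fun s => Ring.inverse (algebraMap _ _
        (s : MvPowerSeries (Fin n) R))) φ)
    (hψ : ∀ n, InvRel (algebraMap (MvPowerSeries (Fin n) R)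
      (FractionRing (MvPowerSeries (Fin n) R))) (fun s => Ring.inverse (algebraMap _ _
        (s : MvPowerSeries (Fin n) R))) ψ)
    (hlog : ∀ i, φ (MvPolynomial.X (BarGen.log i)) = ψ (MvPolynomial.X (BarGen.log i)))
    (hmono : ∀ d (p : Fin (d + 1) → ℕ+), StrictMono p →
      MvPowerSeries.map φ.toRingHom (genBar d p) = MvPowerSeries.map ψ.toRingHom (genBar d p)) :
    ∀ d (p : Fin (d + 1) → ℕ+), StrictAnti p →
      MvPowerSeries.map φ.toRingHom (genBar d p) = MvPowerSeries.map ψ.toRingHom (genBar d p) := by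
  intro d
  induction d using Nat.strong_induction_on with
  | _ d ih =>
  intro p hp
  set κ := algebraMap (MvPowerSeries (Fin d) R) (FractionRing (MvPowerSeries (Fin d) R)) with hκ
  have hser1 : ∀ k (p : ℕ → ℕ+) (s : ℕ → Zc d R), StrictMonoOn p (Set.Iic k) →
      ser φ k p s = ser ψ k p s := by
    intro k p s hp
    rw [ser, ser, hmono]
    intro a b hab
    exact hp (Nat.lt_succ_iff.1 a.2) (Nat.lt_succ_iff.1 b.2) hab
  have hser2 : ∀ k (p : ℕ → ℕ+) (s : ℕ → Zc d R), k < d → StrictAntiOn p (Set.Iic k) →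
      ser φ k p s = ser ψ k p s := by
    intro k p s hk hp
    rw [ser, ser, ih k hk]
    intro a b hab
    exact hp (Nat.lt_succ_iff.1 a.2) (Nat.lt_succ_iff.1 b.2) hab
  have hE : ptChars κ φ = ptChars κ ψ := by
    ext s q
    change κ _ = κ _
    have : φ (logPot q) = ψ (logPot q) := by
      rw [logPot, map_sum, map_sum]
      exact Finset.sum_congr rfl fun r _ => hlog r
    rw [this]
  -- the increasing word whose reversal has the end points `p` and the variables `t_1, …, t_d`
  let c : ℕ → ℕ+ := fun r => p ⟨min (d + 1 - r) d, by omega⟩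
  let τ : ℕ → Zc d R := fun r => if h : 1 ≤ r ∧ r ≤ d then
    -⟨MvPowerSeries.X ⟨d - r, by omega⟩, MvPowerSeries.constantCoeff_X _⟩ else 0
  have hc : StrictMonoOn c (Set.Icc 1 (d + 1)) := by
    intro a ha b hb hab
    have ha := Set.mem_Icc.1 ha
    have hb := Set.mem_Icc.1 hb
    refine hp (Fin.mk_lt_mk.2 ?_)
    omega
  have hι : ∀ m, 1 ≤ m → m < d + 1 → κ (τ m : MvPowerSeries (Fin d) R) *
      Ring.inverse (κ (τ m : MvPowerSeries (Fin d) R)) = 1 := by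
    intro m h1 h2
    refine Ring.mul_inverse_cancel _ ?_
    have e : (τ m : MvPowerSeries (Fin d) R) = -MvPowerSeries.X ⟨d - m, by omega⟩ := by
      simp only [τ]
      rw [dif_pos ⟨h1, by omega⟩]
      rfl
    rw [e, map_neg]
    exact (isUnit_algebraMap_X _).neg
  have hgen : ∀ χ : HBar →ₐ[ℚ] R, (ptData κ χ).N (seg c τ 1 (d + 1)) (c (d + 1)) =
      (-1) ^ d * κ (MvPowerSeries.map χ.toRingHom (genBar d p)) := by
    intro χ
    rw [ptData_N, iota_ptMould_seg _ _ _ _ (by omega), Nat.add_sub_cancel, ser]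
    have h1 : (fun a : Fin (d + 1) => c (d + 1 - a)) = p := by
      funext a
      have := a.2
      refine congrArg p (Fin.ext ?_)
      simp only
      omega
    have h2 : (fun a : Fin d => ((-τ (d - a) : Zc d R) : MvPowerSeries (Fin d) R)) =
        MvPowerSeries.X := by
      funext a
      have := a.2
      simp only [τ]
      rw [dif_pos ⟨by omega, by omega⟩, neg_neg]
      refine congrArg MvPowerSeries.X (Fin.ext ?_)
      simp only
      omega
    rw [h1, h2, MvPowerSeries.subst_self]
    rfl
  have hN : ∀ (τ : ℕ → Zc d R) m, m ∈ Finset.Ico 1 (d + 1) →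
      iota (ptMould κ φ) (seg c τ 1 m) (c m) = iota (ptMould κ ψ) (seg c τ 1 m) (c m) := by
    intro τ m hm
    have hm := Finset.mem_Ico.1 hm
    rw [iota_ptMould_seg _ _ _ _ hm.1, iota_ptMould_seg _ _ _ _ hm.1, hser2 _ _ _ (by omega)]
    intro a ha b hb hab
    have ha : a ≤ m - 1 := ha
    have hb : b ≤ m - 1 := hb
    exact hc (Set.mem_Icc.2 (by omega)) (Set.mem_Icc.2 (by omega)) (by omega)
  have hF : ∀ (τ : ℕ → Zc d R) m, 1 ≤ m → m ≤ d + 1 →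
      ptMould κ φ (seg c τ m (d + 1)) (c (d + 1)) =
        ptMould κ ψ (seg c τ m (d + 1)) (c (d + 1)) := by
    intro τ m h1 h2
    rw [ptMould_seg _ _ _ _ h2, ptMould_seg _ _ _ _ h2, hser1]
    intro a ha b hb hab
    have ha : a ≤ d + 1 - m := ha
    have hb : b ≤ d + 1 - m := hb
    exact hc (Set.mem_Icc.2 (by omega)) (Set.mem_Icc.2 (by omega)) (by omega)
  have key : (ptData κ φ).N (seg c τ 1 (d + 1)) (c (d + 1)) =
      (ptData κ ψ).N (seg c τ 1 (d + 1)) (c (d + 1)) := by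
    rw [(hφ d).N_eq hc hι, (hψ d).N_eq hc hι]
    refine congrArg₂ (· - ·) (congrArg₂ (· + ·) (congrArg (_ - ·) ?_) ?_) ?_
    · refine Finset.sum_congr rfl fun m hm => congrArg (HMul.hMul _) ?_
      rw [SubstData.blockTerm, SubstData.blockTerm, shiftWord_seg, shiftWord_seg]
      refine congrArg₂ (· * ·) ?_ (congrArg₂ (· * ·) (hN _ m hm) (hF _ (m + 1) (by omega) ?_))
      · change ev (ptChars κ φ) _ _ * ev (ptChars κ φ) _ _ = _
        rw [hE]
        rfl
      · have := Finset.mem_Ico.1 hm; omega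
    · refine Finset.sum_congr rfl fun m hm => congrArg (HMul.hMul _) ?_
      refine congrArg₂ (· * ·) (hN _ m hm) (hF _ (m + 1) (by omega) ?_)
      have := Finset.mem_Ico.1 hm; omega
    · refine Finset.sum_congr rfl fun m hm => ?_
      have hm' := Finset.mem_Ico.1 hm
      exact congrArg₂ (· * ·) (hN _ m hm) (hF _ m hm'.1 (by omega))
  rw [hgen, hgen] at key
  have h1 : κ (MvPowerSeries.map φ.toRingHom (genBar d p)) =
      κ (MvPowerSeries.map ψ.toRingHom (genBar d p)) := by
    have hs := neg_one_pow_mul_self (A := FractionRing (MvPowerSeries (Fin d) R)) d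
    linear_combination (-1) ^ d * key + (κ (MvPowerSeries.map ψ.toRingHom (genBar d p)) -
      κ (MvPowerSeries.map φ.toRingHom (genBar d p))) * hs
  exact IsLocalization.injective _ le_rfl h1

/-- A point with the relation that defines `INV` factors through `INV`. -/
theorem eq_comp_INV_of_invRel {φ : HBar →ₐ[ℚ] R}
    (hφ : ∀ n, InvRel (algebraMap (MvPowerSeries (Fin n) R)
      (FractionRing (MvPowerSeries (Fin n) R))) (fun s => Ring.inverse (algebraMap _ _
        (s : MvPowerSeries (Fin n) R))) φ) :
    φ = (φ.comp inclusion).comp INV := by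
  have hlog : ∀ i, φ (MvPolynomial.X (BarGen.log i)) =
      ((φ.comp inclusion).comp INV) (MvPolynomial.X (BarGen.log i)) := fun i => by
    rw [AlgHom.comp_apply, INV_log, AlgHom.comp_apply, inclusion, MvPolynomial.rename_X,
      RegGen.toBar]
  have hX : ∀ d (p : Fin (d + 2) → ℕ+) (hp : StrictMono p) m,
      φ (MvPolynomial.X (BarGen.poly d p (Or.inl hp) m)) =
        ((φ.comp inclusion).comp INV) (MvPolynomial.X (BarGen.poly d p (Or.inl hp) m)) := by
    intro d p hp m
    rw [AlgHom.comp_apply, INV_X, invGen, dif_pos hp, AlgHom.comp_apply, inclusion,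
      MvPolynomial.rename_X, RegGen.toBar]
  have hmono : ∀ d (p : Fin (d + 1) → ℕ+), StrictMono p →
      MvPowerSeries.map φ.toRingHom (genBar d p) =
        MvPowerSeries.map ((φ.comp inclusion).comp INV).toRingHom (genBar d p) := by
    intro d p hp
    cases d with
    | zero => rw [genBar, map_one (MvPowerSeries.map _), map_one (MvPowerSeries.map _)]
    | succ d =>
      ext m
      rw [map_genBar_succ _ _ (Or.inl hp), map_genBar_succ _ _ (Or.inl hp), hX d p hp]
  have hanti := map_genBar_eq_of_invRel hφ (fun n => invRel_INV _ _ (φ.comp inclusion)) hlog hmono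
  refine MvPolynomial.algHom_ext fun g => ?_
  cases g with
  | log i => exact hlog i
  | poly d p hp m =>
    rcases hp with hp | hp
    · exact hX d p hp m
    · have h := congrArg (MvPowerSeries.coeff (expo m)) (hanti (d + 1) p hp)
      rw [map_genBar_succ _ _ (Or.inr hp), map_genBar_succ _ _ (Or.inr hp)] at h
      have hm : (fun r => ((expo m) r).succPNat) = m := by
        funext r
        refine PNat.eq ?_
        simp only [expo, Finsupp.equivFunOnFinite_symm_apply_apply, Nat.succPNat_coe]
        exact Nat.succ_pred_eq_of_pos (m r).pos
      rwa [hm] at h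

end Uniqueness

theorem INV_comp_inclusion : INV.comp inclusion = AlgHom.id ℚ HSymb := by
  refine MvPolynomial.algHom_ext fun g => ?_
  rw [AlgHom.comp_apply, inclusion, MvPolynomial.rename_X, INV_X]
  cases g with
  | log i => rfl
  | poly d p hp n => exact dif_pos hp

theorem INV_inclusion (a : HSymb) : INV (inclusion a) = a :=
  congrArg (fun f => f a) INV_comp_inclusion

theorem INV_surjective : Function.Surjective INV := fun a => ⟨inclusion a, INV_inclusion a⟩

/-- The point `(INV ⊗ INV) ∘ Δ` is the convolution of two points that factor through `INV`, hence it
factors through `INV`, and `Δ_H` is its restriction to the regular symbols. -/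
theorem comulH_comp_INV :
    comulH.comp INV = (Algebra.TensorProduct.map INV INV).comp comulBar := by
  let θ₁ : HSymb →ₐ[ℚ] HSymb ⊗[ℚ] HSymb := Algebra.TensorProduct.includeLeft
  let θ₂ : HSymb →ₐ[ℚ] HSymb ⊗[ℚ] HSymb := Algebra.TensorProduct.includeRight
  have h1 : Algebra.TensorProduct.map INV INV =
      liftPt (R := HSymb ⊗[ℚ] HSymb) (θ₁.comp INV) (θ₂.comp INV) := by
    refine Algebra.TensorProduct.ext ?_ ?_
    · refine MvPolynomial.algHom_ext fun g => ?_
      simp [θ₁, liftPt_tmul_one]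
    · refine MvPolynomial.algHom_ext fun g => ?_
      simp [θ₂, liftPt_one_tmul]
  have h2 : (Algebra.TensorProduct.map INV INV).comp comulBar =
      convPt (R := HSymb ⊗[ℚ] HSymb) (θ₁.comp INV) (θ₂.comp INV) := by
    rw [h1, convPt]
  rw [comulH, ← AlgHom.comp_assoc, h2]
  exact (eq_comp_INV_of_invRel (R := HSymb ⊗[ℚ] HSymb) fun n =>
    (invRel_INV _ _ θ₁).convPt (invRel_INV _ _ θ₂)).symm

/-! ### Gradings of tensor squares -/

section TensorGrade

variable {A : Type*} [CommRing A] [Algebra ℚ A] {B : Type*} [CommRing B] [Algebra ℚ B]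

/-- The elements of total weight `n` in the tensor square of a graded algebra. -/
def tensorGrade (𝒜 : ℕ → Submodule ℚ A) (n : ℕ) : Submodule ℚ (A ⊗[ℚ] A) :=
  Submodule.span ℚ {x | ∃ i j, i + j = n ∧ ∃ a ∈ 𝒜 i, ∃ b ∈ 𝒜 j, x = a ⊗ₜ b}

theorem tmul_mem_tensorGrade {𝒜 : ℕ → Submodule ℚ A} {i j : ℕ} {a b : A} (ha : a ∈ 𝒜 i)
    (hb : b ∈ 𝒜 j) : a ⊗ₜ b ∈ tensorGrade 𝒜 (i + j) :=
  Submodule.subset_span ⟨i, j, rfl, a, ha, b, hb, rfl⟩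

theorem tmul_one_mem_tensorGrade {𝒜 : ℕ → Submodule ℚ A} [SetLike.GradedMonoid 𝒜] {n : ℕ} {a : A}
    (ha : a ∈ 𝒜 n) : a ⊗ₜ 1 ∈ tensorGrade 𝒜 n :=
  tmul_mem_tensorGrade (j := 0) ha (SetLike.one_mem_graded 𝒜)

theorem one_tmul_mem_tensorGrade {𝒜 : ℕ → Submodule ℚ A} [SetLike.GradedMonoid 𝒜] {n : ℕ} {a : A}
    (ha : a ∈ 𝒜 n) : 1 ⊗ₜ a ∈ tensorGrade 𝒜 n := by
  have h := tmul_mem_tensorGrade (SetLike.one_mem_graded 𝒜) ha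
  rwa [zero_add] at h

theorem tensorGrade_eq_iSup (𝒜 : ℕ → Submodule ℚ A) (n : ℕ) :
    tensorGrade 𝒜 n = ⨆ ij ∈ Finset.HasAntidiagonal.antidiagonal n,
      LinearMap.range (TensorProduct.map (𝒜 ij.1).subtype (𝒜 ij.2).subtype) := by
  refine le_antisymm (Submodule.span_le.2 ?_) (iSup₂_le fun ij hij => ?_)
  · rintro x ⟨i, j, hij, a, ha, b, hb, rfl⟩
    have h : (i, j) ∈ Finset.HasAntidiagonal.antidiagonal n := Finset.HasAntidiagonal.mem_antidiagonal.2 hij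
    refine Submodule.mem_iSup_of_mem (i, j) (Submodule.mem_iSup_of_mem h ?_)
    exact ⟨(⟨a, ha⟩ : 𝒜 i) ⊗ₜ (⟨b, hb⟩ : 𝒜 j), rfl⟩
  · rintro x ⟨y, rfl⟩
    induction y using TensorProduct.induction_on with
    | zero => rw [map_zero]; exact zero_mem _
    | add y z hy hz => rw [map_add]; exact add_mem hy hz
    | tmul a b =>
      rw [← Finset.HasAntidiagonal.mem_antidiagonal.1 hij]
      exact tmul_mem_tensorGrade a.2 b.2

theorem tensorGrade_gradedMonoid (𝒜 : ℕ → Submodule ℚ A) [SetLike.GradedMonoid 𝒜] :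
    SetLike.GradedMonoid (tensorGrade 𝒜) where
  one_mem := tmul_mem_tensorGrade (i := 0) (j := 0) SetLike.GradedOne.one_mem
    SetLike.GradedOne.one_mem
  mul_mem {m n x y} hx hy := by
    induction hx, hy using Submodule.span_induction₂ with
    | mem_mem x y hx hy =>
      obtain ⟨i, j, rfl, a, ha, b, hb, rfl⟩ := hx
      obtain ⟨i', j', rfl, a', ha', b', hb', rfl⟩ := hy
      rw [Algebra.TensorProduct.tmul_mul_tmul, add_add_add_comm]
      exact tmul_mem_tensorGrade (SetLike.mul_mem_graded ha ha') (SetLike.mul_mem_graded hb hb')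
    | zero_left y _ => rw [zero_mul]; exact zero_mem _
    | zero_right x _ => rw [mul_zero]; exact zero_mem _
    | add_left x y z _ _ _ hx hy => rw [add_mul]; exact add_mem hx hy
    | add_right x y z _ _ _ hx hy => rw [mul_add]; exact add_mem hx hy
    | smul_left r x y _ _ h => rw [smul_mul_assoc]; exact Submodule.smul_mem _ _ h
    | smul_right r x y _ _ h => rw [mul_smul_comm]; exact Submodule.smul_mem _ _ h

theorem map_mem_tensorGrade {𝒜 : ℕ → Submodule ℚ A} {ℬ : ℕ → Submodule ℚ B} {f g : A →ₐ[ℚ] B}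
    (hf : ∀ n, ∀ a ∈ 𝒜 n, f a ∈ ℬ n) (hg : ∀ n, ∀ a ∈ 𝒜 n, g a ∈ ℬ n) {n : ℕ} {x : A ⊗[ℚ] A}
    (hx : x ∈ tensorGrade 𝒜 n) : Algebra.TensorProduct.map f g x ∈ tensorGrade ℬ n := by
  induction hx using Submodule.span_induction with
  | mem x hx =>
    obtain ⟨i, j, rfl, a, ha, b, hb, rfl⟩ := hx
    exact tmul_mem_tensorGrade (hf i a ha) (hg j b hb)
  | zero => rw [map_zero]; exact zero_mem _
  | add x y _ _ hx hy => rw [map_add]; exact add_mem hx hy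
  | smul r x _ hx => rw [map_smul]; exact Submodule.smul_mem _ _ hx

end TensorGrade

/-! ### The antipode of a connected graded bialgebra -/

section Antipode

variable {A : Type*} [CommRing A] [Bialgebra ℚ A] {𝒜 : ℕ → Submodule ℚ A}

open WithConv

theorem conv_apply_congr (hΔ : ∀ n, ∀ a ∈ 𝒜 n, Coalgebra.comul (R := ℚ) a ∈ tensorGrade 𝒜 n)
    {f f' g g' : WithConv (A →ₗ[ℚ] A)} {n : ℕ} {a : A} (ha : a ∈ 𝒜 n)
    (h : ∀ i j, i + j = n → ∀ x ∈ 𝒜 i, ∀ y ∈ 𝒜 j, f x * g y = f' x * g' y) :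
    (f * g) a = (f' * g') a := by
  rw [LinearMap.convMul_apply, LinearMap.convMul_apply]
  have hx := hΔ n a ha
  generalize Coalgebra.comul (R := ℚ) a = z at hx ⊢
  induction hx using Submodule.span_induction with
  | mem x hx =>
    obtain ⟨i, j, hij, x, hx, y, hy, rfl⟩ := hx
    simpa using h i j hij x hx y hy
  | zero => simp
  | add x y _ _ hx hy => rw [map_add, map_add, map_add, map_add, hx, hy]
  | smul r x _ hx => rw [map_smul, map_smul, map_smul, map_smul, hx]

theorem conv_apply_mem [SetLike.GradedMonoid 𝒜]
    (hΔ : ∀ n, ∀ a ∈ 𝒜 n, Coalgebra.comul (R := ℚ) a ∈ tensorGrade 𝒜 n)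
    {f g : WithConv (A →ₗ[ℚ] A)} (hf : ∀ n, ∀ a ∈ 𝒜 n, f a ∈ 𝒜 n)
    (hg : ∀ n, ∀ a ∈ 𝒜 n, g a ∈ 𝒜 n) (n : ℕ) : ∀ a ∈ 𝒜 n, (f * g) a ∈ 𝒜 n := by
  intro a ha
  rw [LinearMap.convMul_apply]
  have hx := hΔ n a ha
  generalize Coalgebra.comul (R := ℚ) a = z at hx ⊢
  induction hx using Submodule.span_induction with
  | mem x hx =>
    obtain ⟨i, j, rfl, x, hx, y, hy, rfl⟩ := hx
    simpa using SetLike.mul_mem_graded (hf i x hx) (hg j y hy)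
  | zero => simp
  | add x y _ _ hx hy => rw [map_add, map_add]; exact add_mem hx hy
  | smul r x _ hx => rw [map_smul, map_smul]; exact Submodule.smul_mem _ _ hx

/-- A connected graded bialgebra has an antipode, the geometric series `∑ (η ε - id) ^ n` for the
convolution product. The series is finite on each homogeneous component, since the `n`-th power
vanishes in weights less than `n`. -/
theorem exists_conv_inverse [SetLike.GradedMonoid 𝒜] (hint : DirectSum.IsInternal 𝒜)
    (h0 : ∀ a ∈ 𝒜 0, ∃ c : ℚ, a = algebraMap ℚ A c)
    (hΔ : ∀ n, ∀ a ∈ 𝒜 n, Coalgebra.comul (R := ℚ) a ∈ tensorGrade 𝒜 n)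
    (hε : ∀ n, n ≠ 0 → ∀ a ∈ 𝒜 n, Coalgebra.counit (R := ℚ) a = 0) :
    ∃ S : A →ₗ[ℚ] A, toConv S * toConv (LinearMap.id : A →ₗ[ℚ] A) = 1 ∧
      toConv (LinearMap.id : A →ₗ[ℚ] A) * toConv S = 1 ∧ ∀ n, ∀ a ∈ 𝒜 n, S a ∈ 𝒜 n := by
  set e : WithConv (A →ₗ[ℚ] A) := toConv LinearMap.id with he
  set x : WithConv (A →ₗ[ℚ] A) := 1 - e with hx
  have hxa : ∀ a, x a = algebraMap ℚ A (Coalgebra.counit a) - a := fun a => rfl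
  have hx0 : ∀ a ∈ 𝒜 0, x a = 0 := by
    intro a ha
    obtain ⟨c, rfl⟩ := h0 a ha
    rw [hxa, Bialgebra.counit_algebraMap, sub_self]
  have hone : ∀ n, ∀ a ∈ 𝒜 n, (1 : WithConv (A →ₗ[ℚ] A)) a ∈ 𝒜 n := by
    intro n a ha
    change algebraMap ℚ A (Coalgebra.counit a) ∈ 𝒜 n
    by_cases hn : n = 0
    · subst hn
      rw [Algebra.algebraMap_eq_smul_one]
      exact Submodule.smul_mem _ _ SetLike.GradedOne.one_mem
    · rw [hε n hn a ha, map_zero]; exact zero_mem _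
  have hxm : ∀ n, ∀ a ∈ 𝒜 n, x a ∈ 𝒜 n := fun n a ha => sub_mem (hone n a ha) ha
  have hpow : ∀ k n, ∀ a ∈ 𝒜 n, (x ^ k) a ∈ 𝒜 n := by
    intro k
    induction k with
    | zero => rw [pow_zero]; exact hone
    | succ k ih => rw [pow_succ]; exact conv_apply_mem hΔ ih hxm
  have hkill : ∀ k n, n < k → ∀ a ∈ 𝒜 n, (x ^ k) a = 0 := by
    intro k
    induction k with
    | zero => intro n hn; omega
    | succ k ih =>
      intro n hn a ha
      have hz : ((0 : WithConv (A →ₗ[ℚ] A)) * 0) a = 0 := by rw [mul_zero]; rfl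
      rw [pow_succ, ← hz]
      refine conv_apply_congr hΔ ha fun i j hij u hu v hv => ?_
      change _ = (0 : A) * 0
      rcases Nat.eq_zero_or_pos j with rfl | hj
      · rw [hx0 v hv, mul_zero, mul_zero]
      · rw [ih i (by omega) u hu, zero_mul, zero_mul]
  let T : ℕ → WithConv (A →ₗ[ℚ] A) := fun N => ∑ k ∈ Finset.range N, x ^ k
  have hTmul : ∀ N, T N * e = 1 - x ^ N := fun N => by
    have : e = 1 - x := by rw [hx]; abel
    rw [this]; exact geom_sum_mul_neg x N
  have hmulT : ∀ N, e * T N = 1 - x ^ N := fun N => by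
    have : e = 1 - x := by rw [hx]; abel
    rw [this]; exact mul_neg_geom_sum x N
  have hTstep : ∀ N n, n < N → ∀ a ∈ 𝒜 n, T N a = T (n + 1) a := by
    intro N n hN
    induction N, hN using Nat.le_induction with
    | base => intro a _; rfl
    | succ N hN ih =>
      intro a ha
      have : T (N + 1) = T N + x ^ N := Finset.sum_range_succ _ _
      rw [this]
      change T N a + (x ^ N) a = _
      rw [ih a ha, hkill N n hN a ha, add_zero]
  have hTmem : ∀ N n, ∀ a ∈ 𝒜 n, T N a ∈ 𝒜 n := by
    intro N n a ha
    induction N with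
    | zero => exact zero_mem _
    | succ N ih =>
      have : T (N + 1) = T N + x ^ N := Finset.sum_range_succ _ _
      rw [this]
      exact add_mem ih (hpow N n a ha)
  let S : A →ₗ[ℚ] A := (DirectSum.toModule ℚ ℕ A fun n =>
    (T (n + 1)).ofConv ∘ₗ (𝒜 n).subtype) ∘ₗ
      (LinearEquiv.ofBijective (DirectSum.coeLinearMap 𝒜) hint).symm.toLinearMap
  have hS : ∀ n, ∀ a ∈ 𝒜 n, S a = T (n + 1) a := by
    intro n a ha
    have h1 : (LinearEquiv.ofBijective (DirectSum.coeLinearMap 𝒜) hint).symm a =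
        DirectSum.lof ℚ ℕ (fun i => 𝒜 i) n ⟨a, ha⟩ := by
      rw [LinearEquiv.symm_apply_eq]
      exact (DirectSum.coeLinearMap_lof 𝒜 n ⟨a, ha⟩).symm
    change (DirectSum.toModule ℚ ℕ A fun n => (T (n + 1)).ofConv ∘ₗ (𝒜 n).subtype)
      ((LinearEquiv.ofBijective (DirectSum.coeLinearMap 𝒜) hint).symm a) = _
    rw [h1, DirectSum.toModule_lof]
    rfl
  have hST : ∀ N n, n < N → ∀ a ∈ 𝒜 n, S a = T N a := fun N n h a ha => by
    rw [hS n a ha, hTstep N n h a ha]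
  have hext : ∀ f g : WithConv (A →ₗ[ℚ] A), (∀ n, ∀ a ∈ 𝒜 n, f a = g a) → f = g := by
    intro f g h
    have h1 : f.ofConv = g.ofConv := by
      ext a
      have ha : a ∈ ⨆ n, 𝒜 n := by rw [hint.submodule_iSup_eq_top]; trivial
      induction ha using Submodule.iSup_induction' with
      | mem n a ha => exact h n a ha
      | zero => rw [map_zero, map_zero]
      | add a b _ _ ha hb => rw [map_add, map_add, ha, hb]
    exact WithConv.ofConv_injective h1
  refine ⟨S, hext _ _ fun n a ha => ?_, hext _ _ fun n a ha => ?_, fun n a ha => ?_⟩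
  · have h1 : (toConv S * e) a = (T (n + 1) * e) a :=
      conv_apply_congr hΔ ha fun i j hij u hu v hv =>
        congrArg (· * _) (hST (n + 1) i (by omega) u hu)
    rw [h1, hTmul]
    change (1 : WithConv (A →ₗ[ℚ] A)) a - (x ^ (n + 1)) a = _
    rw [hkill (n + 1) n (by omega) a ha, sub_zero]
  · have h1 : (e * toConv S) a = (e * T (n + 1)) a :=
      conv_apply_congr hΔ ha fun i j hij u hu v hv =>
        congrArg (HMul.hMul _) (hST (n + 1) j (by omega) v hv)
    rw [h1, hmulT]
    change (1 : WithConv (A →ₗ[ℚ] A)) a - (x ^ (n + 1)) a = _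
    rw [hkill (n + 1) n (by omega) a ha, sub_zero]
  · rw [hS n a ha]
    exact hTmem _ n a ha

end Antipode

section GradedHopf

variable {A : Type*} [CommRing A] [Algebra ℚ A] {B : Type*} [CommRing B] [Algebra ℚ B]

open WithConv

theorem exists_isGradedHopfAlgebra {𝒜 : ℕ → Submodule ℚ A} {Δ : A →ₐ[ℚ] A ⊗[ℚ] A} {ε : A →ₐ[ℚ] ℚ}
    (hmon : SetLike.GradedMonoid 𝒜) (hint : DirectSum.IsInternal 𝒜)
    (hcoassoc : (Algebra.TensorProduct.assoc ℚ ℚ ℚ A A A).toAlgHom.comp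
      ((Algebra.TensorProduct.map Δ (AlgHom.id ℚ A)).comp Δ) =
        (Algebra.TensorProduct.map (AlgHom.id ℚ A) Δ).comp Δ)
    (hr : (Algebra.TensorProduct.map ε (AlgHom.id ℚ A)).comp Δ =
      (Algebra.TensorProduct.lid ℚ A).symm)
    (hl : (Algebra.TensorProduct.map (AlgHom.id ℚ A) ε).comp Δ =
      (Algebra.TensorProduct.rid ℚ ℚ A).symm)
    (h0 : ∀ a ∈ 𝒜 0, ∃ c : ℚ, a = algebraMap ℚ A c)
    (hΔ : ∀ n, ∀ a ∈ 𝒜 n, Δ a ∈ tensorGrade 𝒜 n)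
    (hε : ∀ n, n ≠ 0 → ∀ a ∈ 𝒜 n, ε a = 0) :
    ∃ S : A →ₗ[ℚ] A, IsGradedHopfAlgebra 𝒜 Δ ε S := by
  let : Bialgebra ℚ A := Bialgebra.ofAlgHom Δ ε hcoassoc hr hl
  obtain ⟨S, h1, h2, h3⟩ := exists_conv_inverse hint h0 hΔ hε
  refine ⟨S, hmon, hint, hcoassoc, hr, hl, ?_, ?_, ?_, hε, h3⟩
  · exact congrArg WithConv.ofConv h1
  · exact congrArg WithConv.ofConv h2
  · intro n a ha
    rw [← tensorGrade_eq_iSup]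
    exact hΔ n a ha

/-- A bialgebra homomorphism is compatible with antipodes, by the uniqueness of inverses for the
convolution product. -/
theorem antipode_comp_of_comul_comp {𝒜 : ℕ → Submodule ℚ A} {ΔA : A →ₐ[ℚ] A ⊗[ℚ] A}
    {εA : A →ₐ[ℚ] ℚ} {SA : A →ₗ[ℚ] A} {ℬ : ℕ → Submodule ℚ B} {ΔB : B →ₐ[ℚ] B ⊗[ℚ] B}
    {εB : B →ₐ[ℚ] ℚ} {SB : B →ₗ[ℚ] B} (hA : IsGradedHopfAlgebra 𝒜 ΔA εA SA)
    (hB : IsGradedHopfAlgebra ℬ ΔB εB SB) {f : A →ₐ[ℚ] B}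
    (hf : ΔB.comp f = (Algebra.TensorProduct.map f f).comp ΔA) (hε : εB.comp f = εA) :
    SB ∘ₗ f.toLinearMap = f.toLinearMap ∘ₗ SA := by
  let := hA.hopfAlgebra
  let := hB.hopfAlgebra
  let F : A →ₗc[ℚ] B :=
    { f.toLinearMap with
      counit_comp := congrArg AlgHom.toLinearMap hε
      map_comp_comul := (congrArg AlgHom.toLinearMap hf).symm }
  have h1 : toConv (f.toLinearMap ∘ₗ SA) * toConv f.toLinearMap = 1 := by
    have h := LinearMap.algHom_comp_convMul_distrib f (toConv SA)
      (toConv (LinearMap.id : A →ₗ[ℚ] A))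
    have h' : toConv SA * toConv (LinearMap.id : A →ₗ[ℚ] A) = 1 :=
      congrArg toConv hA.antipode_rTensor
    rw [h'] at h
    refine WithConv.ofConv_injective (Eq.trans h.symm ?_)
    ext a
    change f (algebraMap ℚ A (εA a)) = algebraMap ℚ B (εA a)
    exact f.commutes _
  have h2 : toConv f.toLinearMap * toConv (SB ∘ₗ f.toLinearMap) = 1 := by
    have h := LinearMap.convMul_comp_coalgHom_distrib (toConv (LinearMap.id : B →ₗ[ℚ] B))
      (toConv SB) F
    have h' : toConv (LinearMap.id : B →ₗ[ℚ] B) * toConv SB = 1 :=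
      congrArg toConv hB.antipode_lTensor
    rw [h'] at h
    refine WithConv.ofConv_injective (Eq.trans h.symm ?_)
    ext a
    change algebraMap ℚ B (εB (f a)) = algebraMap ℚ B (εA a)
    exact congrArg (algebraMap ℚ B) (congrArg (fun g => g a) hε)
  exact (congrArg WithConv.ofConv (left_inv_eq_right_inv h1 h2)).symm

/-- The coassociativity passes to quotients. -/
theorem coassoc_of_surjective {ΔA : A →ₐ[ℚ] A ⊗[ℚ] A} {ΔB : B →ₐ[ℚ] B ⊗[ℚ] B} {f : A →ₐ[ℚ] B}
    (hs : Function.Surjective f) (hf : ΔB.comp f = (Algebra.TensorProduct.map f f).comp ΔA)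
    (h : (Algebra.TensorProduct.assoc ℚ ℚ ℚ A A A).toAlgHom.comp
      ((Algebra.TensorProduct.map ΔA (AlgHom.id ℚ A)).comp ΔA) =
        (Algebra.TensorProduct.map (AlgHom.id ℚ A) ΔA).comp ΔA) :
    (Algebra.TensorProduct.assoc ℚ ℚ ℚ B B B).toAlgHom.comp
      ((Algebra.TensorProduct.map ΔB (AlgHom.id ℚ B)).comp ΔB) =
        (Algebra.TensorProduct.map (AlgHom.id ℚ B) ΔB).comp ΔB := by
  have hfa : ∀ a, ΔB (f a) = Algebra.TensorProduct.map f f (ΔA a) := fun a =>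
    congrArg (fun g => g a) hf
  have h1 : ∀ x : A ⊗[ℚ] A, Algebra.TensorProduct.assoc ℚ ℚ ℚ B B B
      (Algebra.TensorProduct.map ΔB (AlgHom.id ℚ B) (Algebra.TensorProduct.map f f x)) =
      Algebra.TensorProduct.map f (Algebra.TensorProduct.map f f)
        (Algebra.TensorProduct.assoc ℚ ℚ ℚ A A A
          (Algebra.TensorProduct.map ΔA (AlgHom.id ℚ A) x)) := by
    intro x
    induction x using TensorProduct.induction_on with
    | zero => simp only [map_zero]
    | add x y hx hy => simp only [map_add, hx, hy]
    | tmul a b =>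
      simp only [Algebra.TensorProduct.map_tmul, hfa, AlgHom.coe_id, id]
      generalize ΔA a = y
      induction y using TensorProduct.induction_on with
      | zero => simp only [map_zero, TensorProduct.zero_tmul]
      | add x y hx hy => simp only [map_add, TensorProduct.add_tmul, hx, hy]
      | tmul a b => simp
  have h2 : ∀ x : A ⊗[ℚ] A,
      Algebra.TensorProduct.map (AlgHom.id ℚ B) ΔB (Algebra.TensorProduct.map f f x) =
      Algebra.TensorProduct.map f (Algebra.TensorProduct.map f f)
        (Algebra.TensorProduct.map (AlgHom.id ℚ A) ΔA x) := by
    intro x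
    induction x using TensorProduct.induction_on with
    | zero => simp only [map_zero]
    | add x y hx hy => simp only [map_add, hx, hy]
    | tmul a b => simp [hfa]
  ext b
  obtain ⟨a, rfl⟩ := hs b
  have := congrArg (fun g => Algebra.TensorProduct.map f (Algebra.TensorProduct.map f f) (g a)) h
  change Algebra.TensorProduct.assoc ℚ ℚ ℚ B B B
    (Algebra.TensorProduct.map ΔB (AlgHom.id ℚ B) (ΔB (f a))) =
    Algebra.TensorProduct.map (AlgHom.id ℚ B) ΔB (ΔB (f a))
  rw [hfa, h1, h2]
  exact this

theorem rTensor_counit_of_surjective {ΔA : A →ₐ[ℚ] A ⊗[ℚ] A} {ΔB : B →ₐ[ℚ] B ⊗[ℚ] B}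
    {εA : A →ₐ[ℚ] ℚ} {εB : B →ₐ[ℚ] ℚ} {f : A →ₐ[ℚ] B} (hs : Function.Surjective f)
    (hf : ΔB.comp f = (Algebra.TensorProduct.map f f).comp ΔA) (hε : εB.comp f = εA)
    (h : (Algebra.TensorProduct.map εA (AlgHom.id ℚ A)).comp ΔA =
      (Algebra.TensorProduct.lid ℚ A).symm) :
    (Algebra.TensorProduct.map εB (AlgHom.id ℚ B)).comp ΔB =
      (Algebra.TensorProduct.lid ℚ B).symm := by
  ext b
  obtain ⟨a, rfl⟩ := hs b
  have h1 := congrArg (fun g => Algebra.TensorProduct.map (AlgHom.id ℚ ℚ) f (g a)) h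
  have h2 : (Algebra.TensorProduct.map εB (AlgHom.id ℚ B)).comp (Algebra.TensorProduct.map f f) =
      (Algebra.TensorProduct.map (AlgHom.id ℚ ℚ) f).comp
        (Algebra.TensorProduct.map εA (AlgHom.id ℚ A)) := by
    rw [← hε]
    ext <;> simp
  change Algebra.TensorProduct.map εB (AlgHom.id ℚ B) ((ΔB.comp f) a) = _
  rw [hf]
  refine (congrArg (fun g => g (ΔA a)) h2).trans (h1.trans ?_)
  simp

theorem lTensor_counit_of_surjective {ΔA : A →ₐ[ℚ] A ⊗[ℚ] A} {ΔB : B →ₐ[ℚ] B ⊗[ℚ] B}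
    {εA : A →ₐ[ℚ] ℚ} {εB : B →ₐ[ℚ] ℚ} {f : A →ₐ[ℚ] B} (hs : Function.Surjective f)
    (hf : ΔB.comp f = (Algebra.TensorProduct.map f f).comp ΔA) (hε : εB.comp f = εA)
    (h : (Algebra.TensorProduct.map (AlgHom.id ℚ A) εA).comp ΔA =
      (Algebra.TensorProduct.rid ℚ ℚ A).symm) :
    (Algebra.TensorProduct.map (AlgHom.id ℚ B) εB).comp ΔB =
      (Algebra.TensorProduct.rid ℚ ℚ B).symm := by
  ext b
  obtain ⟨a, rfl⟩ := hs b
  have h1 := congrArg (fun g => Algebra.TensorProduct.map f (AlgHom.id ℚ ℚ) (g a)) h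
  have h2 : (Algebra.TensorProduct.map (AlgHom.id ℚ B) εB).comp (Algebra.TensorProduct.map f f) =
      (Algebra.TensorProduct.map f (AlgHom.id ℚ ℚ)).comp
        (Algebra.TensorProduct.map (AlgHom.id ℚ A) εA) := by
    rw [← hε]
    ext <;> simp
  change Algebra.TensorProduct.map (AlgHom.id ℚ B) εB ((ΔB.comp f) a) = _
  rw [hf]
  refine (congrArg (fun g => g (ΔA a)) h2).trans (h1.trans ?_)
  simp

end GradedHopf

/-! ### Homogeneous power series -/

section HomogSeries

variable {A : Type*} [CommRing A] [Algebra ℚ A] {B : Type*} [CommRing B] [Algebra ℚ B]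

/-- A grading by natural numbers, extended by zero to negative weights. -/
def zGrade (𝒜 : ℕ → Submodule ℚ A) (z : ℤ) : Submodule ℚ A :=
  if 0 ≤ z then 𝒜 z.toNat else ⊥

theorem zGrade_natCast (𝒜 : ℕ → Submodule ℚ A) (n : ℕ) : zGrade 𝒜 n = 𝒜 n := by
  rw [zGrade, if_pos (Int.natCast_nonneg n), Int.toNat_natCast]

theorem zGrade_neg (𝒜 : ℕ → Submodule ℚ A) {z : ℤ} (h : z < 0) : zGrade 𝒜 z = ⊥ := by
  rw [zGrade, if_neg (by omega)]

instance zGrade_gradedMonoid (𝒜 : ℕ → Submodule ℚ A) [SetLike.GradedMonoid 𝒜] :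
    SetLike.GradedMonoid (zGrade 𝒜) where
  one_mem := by
    have h := zGrade_natCast 𝒜 0
    rw [Nat.cast_zero] at h
    rw [h]
    exact SetLike.GradedOne.one_mem
  mul_mem {i j x y} hx hy := by
    rcases lt_or_ge i 0 with hi | hi
    · rw [zGrade_neg 𝒜 hi, Submodule.mem_bot] at hx
      rw [hx, zero_mul]
      exact zero_mem _
    · rcases lt_or_ge j 0 with hj | hj
      · rw [zGrade_neg 𝒜 hj, Submodule.mem_bot] at hy
        rw [hy, mul_zero]
        exact zero_mem _
      · lift i to ℕ using hi
        lift j to ℕ using hj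
        rw [zGrade_natCast] at hx hy
        rw [← Nat.cast_add, zGrade_natCast]
        exact SetLike.mul_mem_graded hx hy

theorem map_mem_zGrade {𝒜 : ℕ → Submodule ℚ A} {ℬ : ℕ → Submodule ℚ B} {f : A →ₐ[ℚ] B}
    (hf : ∀ n, ∀ a ∈ 𝒜 n, f a ∈ ℬ n) (z : ℤ) (a : A) (ha : a ∈ zGrade 𝒜 z) :
    f a ∈ zGrade ℬ z := by
  rcases lt_or_ge z 0 with hz | hz
  · rw [zGrade_neg 𝒜 hz, Submodule.mem_bot] at ha
    rw [ha, map_zero]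
    exact zero_mem _
  · lift z to ℕ using hz
    rw [zGrade_natCast] at ha ⊢
    exact hf z a ha

/-- A power series over a graded algebra is homogeneous of degree `z` if its coefficients at the
monomials of total degree `k` have weight `k + z`. The variables have degree `-1`. -/
def HomogSeries {σ : Type*} (𝒢 : ℤ → Submodule ℚ A) (z : ℤ) (f : MvPowerSeries σ A) : Prop :=
  ∀ m : σ →₀ ℕ, MvPowerSeries.coeff m f ∈ 𝒢 (m.degree + z)

namespace HomogSeries

variable {σ τ : Type*} {𝒢 : ℤ → Submodule ℚ A} {z z' : ℤ} {f g : MvPowerSeries σ A}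

theorem cast (h : HomogSeries 𝒢 z f) (e : z = z') : HomogSeries 𝒢 z' f := e ▸ h

theorem zero : HomogSeries 𝒢 z (0 : MvPowerSeries σ A) := fun _ => zero_mem _

theorem add (hf : HomogSeries 𝒢 z f) (hg : HomogSeries 𝒢 z g) : HomogSeries 𝒢 z (f + g) :=
  fun m => add_mem (hf m) (hg m)

theorem neg (hf : HomogSeries 𝒢 z f) : HomogSeries 𝒢 z (-f) := fun m => neg_mem (hf m)

theorem sub (hf : HomogSeries 𝒢 z f) (hg : HomogSeries 𝒢 z g) : HomogSeries 𝒢 z (f - g) :=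
  fun m => sub_mem (hf m) (hg m)

theorem sum {ι : Type*} {s : Finset ι} {F : ι → MvPowerSeries σ A}
    (h : ∀ i ∈ s, HomogSeries 𝒢 z (F i)) : HomogSeries 𝒢 z (∑ i ∈ s, F i) := by
  intro m
  rw [map_sum]
  exact sum_mem fun i hi => h i hi m

theorem C {a : A} (ha : a ∈ 𝒢 z) : HomogSeries 𝒢 z (MvPowerSeries.C (σ := σ) a) := by
  classical
  intro m
  rw [MvPowerSeries.coeff_C]
  split_ifs with h
  · subst h
    simpa using ha
  · exact zero_mem _

theorem map {ℋ : ℤ → Submodule ℚ B} {φ : A →ₐ[ℚ] B} (hφ : ∀ z, ∀ a ∈ 𝒢 z, φ a ∈ ℋ z)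
    (hf : HomogSeries 𝒢 z f) : HomogSeries ℋ z (MvPowerSeries.map φ.toRingHom f) := by
  intro m
  rw [MvPowerSeries.coeff_map]
  exact hφ _ _ (hf m)

theorem divVar {d : ℕ} (j : Fin d) {f : MvPowerSeries (Fin d) A} (hf : HomogSeries 𝒢 z f) :
    HomogSeries 𝒢 (z + 1) (PolyHopf.divVar j f) := by
  intro m
  have h := hf (m + Finsupp.single j 1)
  rw [map_add, Finsupp.degree_single] at h
  have e : (((m.degree + 1 : ℕ) : ℤ) + z) = m.degree + (z + 1) := by push_cast; ring
  rw [e] at h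
  exact h

variable [SetLike.GradedMonoid 𝒢]

theorem one : HomogSeries 𝒢 0 (1 : MvPowerSeries σ A) := by
  have := C (σ := σ) (SetLike.one_mem_graded 𝒢)
  rwa [map_one] at this

theorem X (a : σ) : HomogSeries 𝒢 (-1) (MvPowerSeries.X a : MvPowerSeries σ A) := by
  classical
  intro m
  rw [MvPowerSeries.coeff_X]
  split_ifs with h
  · subst h
    rw [Finsupp.degree_single]
    exact SetLike.one_mem_graded 𝒢
  · exact zero_mem _

theorem mul (hf : HomogSeries 𝒢 z f) (hg : HomogSeries 𝒢 z' g) :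
    HomogSeries 𝒢 (z + z') (f * g) := by
  classical
  intro m
  rw [MvPowerSeries.coeff_mul]
  refine sum_mem fun ij hij => ?_
  have h := SetLike.mul_mem_graded (hf ij.1) (hg ij.2)
  have e : ((ij.1.degree : ℤ) + z + (ij.2.degree + z')) = m.degree + (z + z') := by
    rw [← Finset.HasAntidiagonal.mem_antidiagonal.1 hij, map_add]
    push_cast
    ring
  rwa [e] at h

theorem prod {ι : Type*} {s : Finset ι} {F : ι → MvPowerSeries σ A} {w : ι → ℤ}
    (h : ∀ i ∈ s, HomogSeries 𝒢 (w i) (F i)) :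
    HomogSeries 𝒢 (∑ i ∈ s, w i) (∏ i ∈ s, F i) := by
  classical
  induction s using Finset.induction_on with
  | empty => exact one
  | insert i s hi ih =>
    rw [Finset.sum_insert hi, Finset.prod_insert hi]
    exact (h i (Finset.mem_insert_self i s)).mul (ih fun j hj => h j (Finset.mem_insert_of_mem hj))

theorem pow (hf : HomogSeries 𝒢 z f) (k : ℕ) : HomogSeries 𝒢 (k * z) (f ^ k) := by
  have h := prod (s := Finset.range k) (F := fun _ => f) (w := fun _ => z) fun _ _ => hf
  rw [Finset.prod_const, Finset.card_range] at h
  exact h.cast (by simp)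

theorem neg_one_pow_mul (hf : HomogSeries 𝒢 z f) (k : ℕ) :
    HomogSeries 𝒢 z ((-1) ^ k * f) :=
  ((one.neg.pow k).mul hf).cast (by ring)

theorem subst {u : τ → MvPowerSeries σ A} [Finite τ] (hu0 : ∀ a, (u a).constantCoeff = 0)
    (hu : ∀ a, HomogSeries 𝒢 (-1) (u a)) {f : MvPowerSeries τ A} (hf : HomogSeries 𝒢 z f) :
    HomogSeries 𝒢 z (MvPowerSeries.subst u f) := by
  intro m
  rw [MvPowerSeries.coeff_subst (MvPowerSeries.hasSubst_of_constantCoeff_zero hu0)]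
  refine finsum_induction (· ∈ 𝒢 (m.degree + z)) (zero_mem _) (fun _ _ => add_mem) fun e => ?_
  have h := prod (s := e.support) (F := fun a => u a ^ e a) fun a _ => (hu a).pow (e a)
  have h2 := SetLike.mul_mem_graded (hf e) (h m)
  have e1 : ((e.degree : ℤ) + z + (m.degree + ∑ a ∈ e.support, (e a : ℤ) * (-1))) =
      m.degree + z := by
    rw [← Finset.sum_mul, Finsupp.degree_apply]
    push_cast
    ring
  rwa [e1] at h2

theorem expSeries {d : ℕ} {a : A} (ha : a ∈ 𝒢 1) {s : MvPowerSeries (Fin d) A}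
    (hs0 : s.constantCoeff = 0) (hs : HomogSeries 𝒢 (-1) s) :
    HomogSeries 𝒢 0 (PolyHopf.expSeries a s) := by
  have h0 : (MvPowerSeries.C a * s).constantCoeff = 0 := by rw [map_mul, hs0, mul_zero]
  intro m
  rw [PolyHopf.expSeries, PowerSeries.coeff_subst (PowerSeries.HasSubst.of_constantCoeff_zero h0)]
  refine finsum_induction (· ∈ 𝒢 (m.degree + 0)) (zero_mem _) (fun _ _ => add_mem) fun e => ?_
  refine Submodule.smul_mem _ _ ?_
  exact ((((C ha).mul hs).pow e).cast (by ring)) m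

theorem tVar (d r : ℕ) : HomogSeries 𝒢 (-1) (PolyHopf.tVar d r : MvPowerSeries (Fin d) A) := by
  rw [PolyHopf.tVar]
  split_ifs
  · exact X _
  · exact zero

end HomogSeries

theorem logTo_mem {𝒢 : Submodule ℚ A} {l : ℕ+ → A} (h : ∀ r, l r ∈ 𝒢) (a b : ℕ+) :
    logTo l a b ∈ 𝒢 :=
  sub_mem (sum_mem fun _ _ => h _) (sum_mem fun _ _ => h _)

end HomogSeries

/-! ### The weights of the coproduct and of the inversion map -/

section Weights

instance gradeBar_gradedMonoid : SetLike.GradedMonoid gradeBar :=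
  MvPolynomial.WeightedHomogeneousSubmodule.gradedMonoid

instance gradeH_gradedMonoid : SetLike.GradedMonoid gradeH :=
  MvPolynomial.WeightedHomogeneousSubmodule.gradedMonoid

theorem X_mem_gradeBar (g : BarGen) : MvPolynomial.X g ∈ gradeBar g.weight :=
  MvPolynomial.isWeightedHomogeneous_X _ _ _

theorem X_mem_gradeH (g : RegGen) : MvPolynomial.X g ∈ gradeH g.weight :=
  MvPolynomial.isWeightedHomogeneous_X _ _ _

/-- An algebra homomorphism from a polynomial ring respects the weights if it does so on the
variables. -/
theorem algHom_mem_of_weightedHomogeneous {σ : Type*} {w : σ → ℕ} {B : Type*} [CommRing B]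
    [Algebra ℚ B] {ℬ : ℕ → Submodule ℚ B} [SetLike.GradedMonoid ℬ]
    {f : MvPolynomial σ ℚ →ₐ[ℚ] B} (hf : ∀ g, f (MvPolynomial.X g) ∈ ℬ (w g)) (n : ℕ)
    (a : MvPolynomial σ ℚ) (ha : a ∈ MvPolynomial.weightedHomogeneousSubmodule ℚ w n) :
    f a ∈ ℬ n := by
  rw [a.as_sum, map_sum]
  refine sum_mem fun m hm => ?_
  have hw : Finsupp.weight w m = n := ha (MvPolynomial.mem_support_iff.1 hm)
  rw [MvPolynomial.monomial_eq, ← MvPolynomial.algebraMap_eq, map_mul, AlgHom.commutes,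
    Algebra.algebraMap_eq_smul_one, smul_mul_assoc, one_mul]
  refine Submodule.smul_mem _ _ ?_
  rw [Finsupp.prod, map_prod]
  simp only [map_pow]
  have h := SetLike.prod_pow_mem_graded ℬ w (fun g => f (MvPolynomial.X g)) m
    (F := m.support) fun g _ => hf g
  rw [Finsupp.weight_apply, Finsupp.sum] at hw
  rwa [hw] at h

theorem genBar_homog : ∀ (d : ℕ) (p : Fin (d + 1) → ℕ+),
    HomogSeries (zGrade gradeBar) d (genBar d p)
  | 0, _ => HomogSeries.one
  | d + 1, p => fun m => by
    change genBar (d + 1) p m ∈ _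
    rw [genBar]
    split_ifs with h
    · have h := X_mem_gradeBar (BarGen.poly d p h fun r => (m r).succPNat)
      rw [← zGrade_natCast gradeBar] at h
      convert h using 2
      simp [BarGen.weight, Finsupp.degree_eq_sum, Finset.sum_add_distrib]
    · exact zero_mem _

theorem genReg_homog : ∀ (d : ℕ) (p : Fin (d + 1) → ℕ+),
    HomogSeries (zGrade gradeH) d (genReg d p)
  | 0, _ => HomogSeries.one
  | d + 1, p => fun m => by
    change genReg (d + 1) p m ∈ _
    rw [genReg]
    split_ifs with h
    · have h := X_mem_gradeH (RegGen.poly d p h fun r => (m r).succPNat)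
      rw [← zGrade_natCast gradeH] at h
      convert h using 2
      simp [RegGen.weight, Finsupp.degree_eq_sum, Finset.sum_add_distrib]
    · exact zero_mem _

theorem comulFactor_homog {d : ℕ} (p : Fin (d + 1) → ℕ+) {i j i' : ℕ} (h1 : i ≤ j) (h2 : j < i') :
    HomogSeries (zGrade gradeBar) (i' - i - 1) (comulFactor p i j i') := by
  have hl : logTo (fun r => MvPolynomial.X (BarGen.log r)) (pt p i) (pt p i') ∈
      zGrade gradeBar 1 := by
    refine logTo_mem (fun r => ?_) _ _
    rw [← Nat.cast_one, zGrade_natCast]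
    exact X_mem_gradeBar (BarGen.log r)
  have e := HomogSeries.expSeries hl (constantCoeff_tVar d j) (HomogSeries.tVar d j)
  have b1 := (genBar_homog (j - i) fun a => pt p (j - a)).subst
    (u := fun a : Fin (j - i) => tVar d j - tVar d (j - 1 - a))
    (fun a => constantCoeff_tVar_sub HBar _ _ _)
    (fun a => (HomogSeries.tVar d _).sub (HomogSeries.tVar d _))
  have b2 := (genBar_homog (i' - 1 - j) fun a => pt p (j + 1 + a)).subst
    (u := fun a : Fin (i' - 1 - j) => tVar d (j + 1 + a) - tVar d j)
    (fun a => constantCoeff_tVar_sub HBar _ _ _)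
    (fun a => (HomogSeries.tVar d _).sub (HomogSeries.tVar d _))
  exact (((e.neg_one_pow_mul _).mul b1).mul b2).cast (by omega)

instance tensorGrade_gradeBar_gradedMonoid : SetLike.GradedMonoid (tensorGrade gradeBar) :=
  tensorGrade_gradedMonoid gradeBar

/-- The generating series in depth `d` has degree `d`, because its coefficient at
`t_1^(n_1-1) ⋯ t_d^(n_d-1)` has weight `n_1 + ⋯ + n_d`. -/
theorem comulSeries_homog {d : ℕ} (p : Fin (d + 1) → ℕ+) :
    HomogSeries (zGrade (tensorGrade gradeBar)) d (comulSeries p) := by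
  classical
  refine HomogSeries.sum fun k _ => HomogSeries.sum fun i _ => HomogSeries.sum fun j _ => ?_
  split_ifs with hij
  · have h1 : HomogSeries (zGrade gradeBar) k
        (brBar (fun a : Fin (k + 1) => pt p (i a.succ)) (fun a : Fin k => tVar d (j a.succ))) :=
      (genBar_homog k _).subst (fun a => constantCoeff_tVar _ _) (fun a => HomogSeries.tVar d _)
    have h2 : HomogSeries (zGrade gradeBar) (d - k)
        (∏ α : Fin (k + 1), comulFactor p (i α.castSucc) (j α) (i α.succ)) := by
      refine (HomogSeries.prod fun α _ =>
        comulFactor_homog p (hij.2.2.2 α).1 (hij.2.2.2 α).2).cast ?_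
      have ht : ∀ (k : ℕ) (f : Fin (k + 2) → ℤ),
          ∑ α : Fin (k + 1), (f α.succ - f α.castSucc - 1) =
            f (Fin.last _) - f 0 - (k + 1) := by
        intro k f
        rw [Finset.sum_sub_distrib, Finset.sum_sub_distrib]
        have h3 := Fin.sum_univ_succ f
        have h4 := Fin.sum_univ_castSucc f
        simp only [Finset.sum_const, Finset.card_univ, Fintype.card_fin, nsmul_eq_mul, mul_one]
        push_cast
        linarith
      have := ht k fun a => (i a : ℕ)
      rw [this, hij.1, hij.2.2.1]
      simp
    have hl : ∀ n, ∀ a ∈ gradeBar n, (Algebra.TensorProduct.includeLeft :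
        HBar →ₐ[ℚ] HBar ⊗[ℚ] HBar) a ∈ tensorGrade gradeBar n := fun n a ha =>
      tmul_one_mem_tensorGrade ha
    have hr : ∀ n, ∀ a ∈ gradeBar n, (Algebra.TensorProduct.includeRight :
        HBar →ₐ[ℚ] HBar ⊗[ℚ] HBar) a ∈ tensorGrade gradeBar n := fun n a ha =>
      one_tmul_mem_tensorGrade ha
    exact ((h1.map (map_mem_zGrade hl)).mul (h2.map (map_mem_zGrade hr))).cast (by ring)
  · exact HomogSeries.zero

theorem sum_expo {d : ℕ} (n : Fin (d + 1) → ℕ+) :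
    (expo n).degree + (d + 1) = ∑ r, (n r : ℕ) := by
  rw [Finsupp.degree_eq_sum]
  have : ∀ r, (n r : ℕ) = expo n r + 1 := fun r => by
    simp only [expo, Finsupp.equivFunOnFinite_symm_apply_apply]
    exact (Nat.sub_add_cancel (n r).pos).symm
  simp only [this, Finset.sum_add_distrib]
  simp

theorem HomogSeries.coeff_expo_mem {A : Type*} [CommRing A] [Algebra ℚ A] {𝒜 : ℕ → Submodule ℚ A}
    {d : ℕ} {f : MvPowerSeries (Fin (d + 1)) A} (hf : HomogSeries (zGrade 𝒜) (d + 1 : ℕ) f)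
    (n : Fin (d + 1) → ℕ+) : MvPowerSeries.coeff (expo n) f ∈ 𝒜 (∑ r, (n r : ℕ)) := by
  have h := hf (expo n)
  rwa [← Nat.cast_add, zGrade_natCast, sum_expo] at h

theorem comulBar_mem (n : ℕ) (a : HBar) (ha : a ∈ gradeBar n) :
    comulBar a ∈ tensorGrade gradeBar n := by
  refine algHom_mem_of_weightedHomogeneous (fun g => ?_) n a ha
  rw [comulBar, MvPolynomial.aeval_X]
  cases g with
  | log i =>
    have h1 : MvPolynomial.X (BarGen.log i) ∈ gradeBar 1 := X_mem_gradeBar (BarGen.log i)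
    exact add_mem (tmul_one_mem_tensorGrade h1) (one_tmul_mem_tensorGrade h1)
  | poly d p hp n => exact (comulSeries_homog p).coeff_expo_mem n

theorem invSeries_homog (d : ℕ) (p : Fin (d + 1) → ℕ+) :
    HomogSeries (zGrade gradeH) d (invSeries d p) := by
  induction d using Nat.strong_induction_on with
  | _ d ih =>
  by_cases hd : d = 0
  · subst hd
    rw [invSeries_zero]
    exact HomogSeries.one
  have hl : logTo (fun r => MvPolynomial.X (RegGen.log r)) (pt p 1) (pt p (d + 1)) ∈
      zGrade gradeH 1 := by
    refine logTo_mem (fun r => ?_) _ _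
    rw [← Nat.cast_one, zGrade_natCast]
    exact X_mem_gradeH (RegGen.log r)
  rw [invSeries_eq hd]
  refine (HomogSeries.sum fun j _ => ?_).add (HomogSeries.sum fun j _ => ?_)
  · have h1 := (ih j j.2 fun a => pt p (a + 1)).subst
      (u := fun a : Fin (j : ℕ) => (tVar d (a + 1) : MvPowerSeries (Fin d) HSymb))
      (fun a => constantCoeff_tVar _ _) (fun a => HomogSeries.tVar d _)
    have h2 := (genReg_homog (d - j) fun a => pt p (j + 1 + a)).subst
      (u := fun a : Fin (d - j) => (tVar d (j + 1 + a) : MvPowerSeries (Fin d) HSymb))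
      (fun a => constantCoeff_tVar _ _) (fun a => HomogSeries.tVar d _)
    exact ((h1.mul h2).neg_one_pow_mul _).cast (by omega)
  · refine HomogSeries.neg_one_pow_mul (HomogSeries.cast (HomogSeries.divVar j (z := d - 1) ?_)
      (by ring)) _
    have e := HomogSeries.expSeries hl (constantCoeff_tVar d (j + 1)) (HomogSeries.tVar d (j + 1))
    have h1 := (ih j j.2 fun a => pt p (a + 1)).subst
      (u := fun a : Fin (j : ℕ) =>
        (tVar d (a + 1) - tVar d (j + 1) : MvPowerSeries (Fin d) HSymb))
      (fun a => constantCoeff_tVar_sub HSymb _ _ _)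
      (fun a => (HomogSeries.tVar d _).sub (HomogSeries.tVar d _))
    have h2 := (genReg_homog (d - (j + 1)) fun a => pt p (j + 1 + 1 + a)).subst
      (u := fun a : Fin (d - (j + 1)) =>
        (tVar d (j + 1 + 1 + a) - tVar d (j + 1) : MvPowerSeries (Fin d) HSymb))
      (fun a => constantCoeff_tVar_sub HSymb _ _ _)
      (fun a => (HomogSeries.tVar d _).sub (HomogSeries.tVar d _))
    have h3 := (ih j j.2 fun a => pt p (a + 1)).subst
      (u := fun a : Fin (j : ℕ) => (tVar d (a + 1) : MvPowerSeries (Fin d) HSymb))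
      (fun a => constantCoeff_tVar _ _) (fun a => HomogSeries.tVar d _)
    have h4 := (genReg_homog (d - (j + 1)) fun a => pt p (j + 1 + 1 + a)).subst
      (u := fun a : Fin (d - (j + 1)) => (tVar d (j + 1 + 1 + a) : MvPowerSeries (Fin d) HSymb))
      (fun a => constantCoeff_tVar _ _) (fun a => HomogSeries.tVar d _)
    exact (((h1.mul e).mul h2).cast (by omega)).sub ((h3.mul h4).cast (by omega))

theorem INV_mem (n : ℕ) (a : HBar) (ha : a ∈ gradeBar n) : INV a ∈ gradeH n := by
  refine algHom_mem_of_weightedHomogeneous (fun g => ?_) n a ha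
  rw [INV_X]
  cases g with
  | log i => exact X_mem_gradeH (RegGen.log i)
  | poly d p hp n =>
    rw [invGen]
    split_ifs with h
    · exact X_mem_gradeH (RegGen.poly d p h n)
    · have h1 := (invSeries_homog (d + 1) fun r => p (Fin.rev r)).coeff_expo_mem
        fun r => n (Fin.rev r)
      have e : ∑ r, (n (Fin.rev r) : ℕ) = ∑ r, (n r : ℕ) :=
        Equiv.sum_comp Fin.revPerm fun r => (n r : ℕ)
      rw [e] at h1
      have h2 : ∀ k : ℕ, ((-1 : HSymb)) ^ k = algebraMap ℚ HSymb ((-1) ^ k) := fun k => by simp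
      rw [h2, ← Algebra.smul_def]
      exact Submodule.smul_mem _ _ h1

end Weights

/-! ### The graded Hopf algebras -/

section Connected

variable {σ : Type*} {w : σ → ℕ}

theorem weightedHomogeneous_isInternal (w : σ → ℕ) :
    DirectSum.IsInternal (MvPolynomial.weightedHomogeneousSubmodule ℚ w) := by
  classical
  let := MvPolynomial.weightedGradedAlgebra (R := ℚ) w
  exact DirectSum.Decomposition.isInternal _

theorem eq_algebraMap_of_mem_zero (hw : ∀ g, w g ≠ 0) (a : MvPolynomial σ ℚ)
    (ha : a ∈ MvPolynomial.weightedHomogeneousSubmodule ℚ w 0) :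
    ∃ c : ℚ, a = algebraMap ℚ (MvPolynomial σ ℚ) c := by
  classical
  refine ⟨a.coeff 0, ?_⟩
  ext m
  rw [MvPolynomial.algebraMap_eq, MvPolynomial.coeff_C]
  split_ifs with hm
  · rw [hm]
  · by_contra hc
    have h := ha hc
    rw [Finsupp.weight_apply, Finsupp.sum, Finset.sum_eq_zero_iff] at h
    refine hm (Finsupp.ext fun g => ?_).symm
    by_contra hg
    have := h g (Finsupp.mem_support_iff.2 hg)
    rw [smul_eq_mul, mul_eq_zero] at this
    exact this.elim hg (hw g)

theorem aeval_zero_eq_zero_of_mem {n : ℕ} (hn : n ≠ 0) (a : MvPolynomial σ ℚ)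
    (ha : a ∈ MvPolynomial.weightedHomogeneousSubmodule ℚ w n) :
    MvPolynomial.aeval (fun _ => (0 : ℚ)) a = 0 := by
  rw [MvPolynomial.aeval_zero', MvPolynomial.constantCoeff_eq]
  have h : a.coeff 0 = 0 := by
    by_contra hc
    have h := ha hc
    rw [map_zero] at h
    exact hn h.symm
  rw [h, map_zero]

end Connected

theorem sum_pnat_ne_zero {d : ℕ} (n : Fin (d + 1) → ℕ+) : ∑ r, (n r : ℕ) ≠ 0 := by
  rw [Fin.sum_univ_succ]
  have := (n 0).pos
  omega

theorem BarGen.weight_ne_zero (g : BarGen) : g.weight ≠ 0 := by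
  cases g with
  | log i => exact one_ne_zero
  | poly d p hp n => exact sum_pnat_ne_zero n

theorem RegGen.weight_ne_zero (g : RegGen) : g.weight ≠ 0 := by
  cases g with
  | log i => exact one_ne_zero
  | poly d p hp n => exact sum_pnat_ne_zero n

theorem counitH_comp_INV : counitH.comp INV = counitBar := by
  refine MvPolynomial.algHom_ext fun g => ?_
  rw [AlgHom.comp_apply, counitBar, MvPolynomial.aeval_X]
  exact aeval_zero_eq_zero_of_mem g.weight_ne_zero _ (INV_mem _ _ (X_mem_gradeBar g))

theorem inclusion_mem (n : ℕ) (a : HSymb) (ha : a ∈ gradeH n) : inclusion a ∈ gradeBar n := by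
  refine algHom_mem_of_weightedHomogeneous (fun g => ?_) n a ha
  rw [inclusion, MvPolynomial.rename_X]
  cases g with
  | log i => exact X_mem_gradeBar (BarGen.log i)
  | poly d p hp n => exact X_mem_gradeBar (BarGen.poly d p (Or.inl hp) n)

theorem comulH_mem (n : ℕ) (a : HSymb) (ha : a ∈ gradeH n) : comulH a ∈ tensorGrade gradeH n :=
  map_mem_tensorGrade INV_mem INV_mem (comulBar_mem n _ (inclusion_mem n a ha))

theorem exists_isGradedHopfAlgebra_HBar :
    ∃ S : HBar →ₗ[ℚ] HBar, IsGradedHopfAlgebra gradeBar comulBar counitBar S :=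
  exists_isGradedHopfAlgebra gradeBar_gradedMonoid (weightedHomogeneous_isInternal _)
    comulBar_coassoc comulBar_rTensor_counit comulBar_lTensor_counit
    (eq_algebraMap_of_mem_zero BarGen.weight_ne_zero) comulBar_mem
    fun _ hn => aeval_zero_eq_zero_of_mem hn

theorem exists_isGradedHopfAlgebra_HSymb :
    ∃ S : HSymb →ₗ[ℚ] HSymb, IsGradedHopfAlgebra gradeH comulH counitH S :=
  exists_isGradedHopfAlgebra gradeH_gradedMonoid (weightedHomogeneous_isInternal _)
    (coassoc_of_surjective INV_surjective comulH_comp_INV comulBar_coassoc)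
    (rTensor_counit_of_surjective INV_surjective comulH_comp_INV counitH_comp_INV
      comulBar_rTensor_counit)
    (lTensor_counit_of_surjective INV_surjective comulH_comp_INV counitH_comp_INV
      comulBar_lTensor_counit)
    (eq_algebraMap_of_mem_zero RegGen.weight_ne_zero) comulH_mem
    fun _ hn => aeval_zero_eq_zero_of_mem hn

end PolyHopf

end

theorem theorem2 :
    ∃ (SBar : PolyHopf.HBar →ₗ[ℚ] PolyHopf.HBar) (SH : PolyHopf.HSymb →ₗ[ℚ] PolyHopf.HSymb),
      PolyHopf.IsGradedHopfAlgebra PolyHopf.gradeBar PolyHopf.comulBar PolyHopf.counitBar SBar ∧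
      PolyHopf.IsGradedHopfAlgebra PolyHopf.gradeH PolyHopf.comulH PolyHopf.counitH SH ∧
      PolyHopf.IsGradedHopfHom
        PolyHopf.gradeBar PolyHopf.comulBar PolyHopf.counitBar SBar
        PolyHopf.gradeH PolyHopf.comulH PolyHopf.counitH SH PolyHopf.INV := by
  obtain ⟨SBar, hBar⟩ := PolyHopf.exists_isGradedHopfAlgebra_HBar
  obtain ⟨SH, hH⟩ := PolyHopf.exists_isGradedHopfAlgebra_HSymb
  exact ⟨SBar, SH, hBar, hH, PolyHopf.comulH_comp_INV, PolyHopf.counitH_comp_INV,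
    PolyHopf.antipode_comp_of_comul_comp hBar hH PolyHopf.comulH_comp_INV
      PolyHopf.counitH_comp_INV, PolyHopf.INV_mem⟩
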